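/- Let $K$ be a field and let $q\in K$ be generic, i.e. $q\neq 0$ and $q$ is not a root of unity (for example $K=\mathbb Q(q)$ with $q$ an indeterminate). Let $n\ge 2$, let $z$ be a formal variable, and work over the field $K((z))$ of formal Laurent series. Put $(u;p)_m=\prod_{k=1}^m(1-up^{k-1})$, $(p)_m=(p;p)_m$, $[m]=\frac{q^m-q^{-m}}{q-q^{-1}}$, $[m]!=[1]\cdots[m]$, and let $\binom{m}{k}_{p}=\frac{(p)_m}{(p)_k(p)_{m-k}}$ (zero unless $0\le k\le m$). **The trace reduction.** Let $F=\bigoplus_{m\ge 0}K|m\rangle$ and let $\mathscr R\in\mathrm{End}(F^{\otimes 3})$ be the 3d $R$: $\mathscr R(|i\rangle\otimes|j\rangle\otimes|k\rangle)=\sum_{a,b,c\ge 0}\mathscr R^{a,b,c}_{i,j,k}\,|a\rangle\otimes|b\rangle\otimes|c\rangle$ with $$\mathscr R^{a,b,c}_{i,j,k}=\delta_{a+b,i+j}\,\delta_{b+c,j+k}\sum_{\lambda+\mu=b}(-1)^\lambda q^{i(c-j)+(k+1)\lambda+\mu(\mu-k)}\frac{(q^2)_{c+\mu}}{(q^2)_c}\binom{i}{\mu}_{q^2}\binom{j}{\lambda}_{q^2}.$$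 For $\mathbf m=(m_1,\dots,m_n)\in(\mathbb Z_{\ge 0})^n$ write $|\mathbf m\rangle=|m_1\rangle\otimes\cdots\otimes|m_n\rangle\in F^{\otimes n}$ and $|\mathbf m|=m_1+\cdots+m_n$, and let $\mathbf e_1,\dots,\mathbf e_n$ be the unit vectors. On $F^{\otimes n}\otimes F^{\otimes n}\otimes F$ let $\mathscr R_{\alpha_r\beta_r3}$ be $\mathscr R$ acting on the $r$-th component of the first factor, the $r$-th component of the second factor and the last factor. Let $\mathbf h|m\rangle=m|m\rangle$ and $$S^{\mathrm{tr}}(z)=\mathrm{Tr}_3\bigl(z^{\mathbf h_3}\mathscr R_{\alpha_1\beta_13}\mathscr R_{\alpha_2\beta_23}\cdots\mathscr R_{\alpha_n\beta_n3}\bigr),$$ the trace over the last factor $F$. Its matrix elements are formal power series in $z$, and $S^{\mathrm{tr}}(z)$ acts on $F^{\otimes n}\otimes F^{\otimes n}$ over $K((z))$. **The quantum $R$ matrices.** Let $U_q=U_q(A^{(1)}_{n-1})$ (over $K((z))$, without derivation operator) be generated by $e_i,f_i,k_i^{\pm1}$ ($i\in\mathbb Z/n\mathbb Z$) with $k_ik_i^{-1}=k_i^{-1}k_i=1$,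 $[k_i,k_j]=0$, $k_ie_jk_i^{-1}=q^{a_{ij}}e_j$, $k_if_jk_i^{-1}=q^{-a_{ij}}f_j$, $[e_i,f_j]=\delta_{ij}\frac{k_i-k_i^{-1}}{q-q^{-1}}$ and, for $i\ne j$, $\sum_{\nu=0}^{1-a_{ij}}(-1)^\nu e_i^{(1-a_{ij}-\nu)}e_je_i^{(\nu)}=0$ and $\sum_{\nu=0}^{1-a_{ij}}(-1)^\nu f_i^{(1-a_{ij}-\nu)}f_jf_i^{(\nu)}=0$, where $e_i^{(\nu)}=e_i^\nu/[\nu]!$, $f_i^{(\nu)}=f_i^\nu/[\nu]!$, and $a_{ij}=2\delta_{i,j}-\delta_{i,j+1}-\delta_{i+1,j}$ with indices mod $n$ (so $a_{01}=a_{10}=-2$ if $n=2$). The coproduct is $\Delta k_i^{\pm1}=k_i^{\pm1}\otimes k_i^{\pm1}$, $\Delta e_i=1\otimes e_i+e_i\otimes k_i$, $\Delta f_i=f_i\otimes1+k_i^{-1}\otimes f_i$, and $\Delta'$ is $\Delta$ followed by the exchange of the two tensor factors. For $x\ne0$ in $K((z))$, $U_q$ acts on $V_x=F^{\otimes n}$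 (over $K((z))$) by $$e_j|\mathbf m\rangle=x^{\delta_{j,0}}[m_j]\,|\mathbf m-\mathbf e_j+\mathbf e_{j+1}\rangle,\quad f_j|\mathbf m\rangle=x^{-\delta_{j,0}}[m_{j+1}]\,|\mathbf m+\mathbf e_j-\mathbf e_{j+1}\rangle,\quad k_j|\mathbf m\rangle=q^{-m_j+m_{j+1}}|\mathbf m\rangle$$ with indices mod $n$, and $V_x=\bigoplus_{l\ge0}V_{x,l}$, where the submodule $V_{x,l}$ is spanned by the $|\mathbf m\rangle$ with $|\mathbf m|=l$. **Proposition.** For all $m,l\ge0$ there is an operator $R_{m,l}(z)$, the quantum $R$ matrix, such that for all nonzero $x,y\in K((z))$ with $x/y=z$ it is the unique $R\in\mathrm{End}(V_{x,m}\otimes V_{y,l})$ satisfying $$\Delta'(g)R=R\,\Delta(g)\ \ (g\in U_q),\qquad R\,(|m\mathbf e_n\rangle\otimes|l\mathbf e_n\rangle)=z^l\frac{(q^{m-l+2}z^{-1};q^2)_l}{(q^{m-l}z;q^2)_{l+1}}\,|m\mathbf e_n\rangle\otimes|l\mathbf e_n\rangle ,$$ and $$S^{\mathrm{tr}}(z)=\bigoplus_{m,l\ge0}R_{m,l}(z).$$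 -/

import Mathlib

open scoped TensorProduct

noncomputable section

namespace TraceReduction

/-! ### `q`-numbers -/

section QNumbers

variable {𝕜 : Type*} [Field 𝕜]

/-- `q` is generic: nonzero and not a root of unity. -/
def IsGeneric (q : 𝕜) : Prop := q ≠ 0 ∧ ∀ N : ℕ, 0 < N → q ^ N ≠ 1

/-- The `q`-shifted factorial `(z;Q)_m = ∏_{k=1}^m (1 - z Q^{k-1})`. -/
def qPoch (z Q : 𝕜) (m : ℕ) : 𝕜 := ∏ k ∈ Finset.range m, (1 - z * Q ^ k)

/-- The `q`-binomial `(Q)_m / ((Q)_k (Q)_{m-k})`, zero unless `k ≤ m`. -/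
def qBinom (Q : 𝕜) (m k : ℕ) : 𝕜 :=
  if k ≤ m then qPoch Q Q m / (qPoch Q Q k * qPoch Q Q (m - k)) else 0

/-- The symmetric `q`-integer `[m] = (q^m - q^{-m}) / (q - q^{-1})`. -/
def qInt (q : 𝕜) (m : ℤ) : 𝕜 := (q ^ m - q ^ (-m)) / (q - q⁻¹)

/-- The symmetric `q`-factorial `[m]! = [1] ⋯ [m]`. -/
def qFact (q : 𝕜) (m : ℕ) : 𝕜 := ∏ k ∈ Finset.range m, qInt q ((k + 1 : ℕ) : ℤ)

end QNumbers

/-! ### The algebra `U_q(A^{(1)}_{n-1})`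

All indices are integers modulo `n`. -/

section Algebra

/-- The Cartan matrix of `A^{(1)}_{n-1}` (`n ≥ 2`); for `n = 2` the off-diagonal entries
are `-2`. -/
def cartan (n : ℕ) (i j : ZMod n) : ℤ :=
  2 * (if i = j then 1 else 0) - (if i = j + 1 then 1 else 0) - (if j = i + 1 then 1 else 0)

variable {𝕜 : Type*} [Field 𝕜]

/-- The divided power `X^{(ν)} = X^ν / [ν]!`. -/
def divPow {B : Type*} [Ring B] [Algebra 𝕜 B] (q : 𝕜) (X : B) (ν : ℕ) : B :=
  (qFact q ν)⁻¹ • X ^ ν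

/-- The `q`-Serre expression `∑_{ν=0}^{1-a} (-1)^ν X^{(1-a-ν)} Y X^{(ν)}`. -/
def qSerre {B : Type*} [Ring B] [Algebra 𝕜 B] (q : 𝕜) (a : ℤ) (X Y : B) : B :=
  ∑ ν ∈ Finset.range ((1 - a).toNat + 1),
    (-1 : 𝕜) ^ ν • (divPow q X ((1 - a).toNat - ν) * Y * divPow q X ν)

/-- The defining relations of `U_q(A^{(1)}_{n-1})`, for elements of an algebra `B`. -/
structure UqRelations {B : Type*} [Ring B] [Algebra 𝕜 B] (q : 𝕜) (n : ℕ)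
    (e f k k' : ZMod n → B) : Prop where
  k_mul_kinv : ∀ i, k i * k' i = 1
  kinv_mul_k : ∀ i, k' i * k i = 1
  k_comm : ∀ i j, k i * k j = k j * k i
  k_e : ∀ i j, k i * e j * k' i = q ^ cartan n i j • e j
  k_f : ∀ i j, k i * f j * k' i = q ^ (-cartan n i j) • f j
  e_f : ∀ i j, e i * f j - f j * e i = if i = j then (q - q⁻¹)⁻¹ • (k i - k' i) else 0
  serre_e : ∀ i j, i ≠ j → qSerre q (cartan n i j) (e i) (e j) = 0
  serre_f : ∀ i j, i ≠ j → qSerre q (cartan n i j) (f i) (f j) = 0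

/-- The generators `e_i, f_i, k_i, k_i^{-1}`. -/
inductive UqGen (n : ℕ) : Type
  | e (i : ZMod n) : UqGen n
  | f (i : ZMod n) : UqGen n
  | k (i : ZMod n) : UqGen n
  | kinv (i : ZMod n) : UqGen n

/-- The free algebra on the generators. -/
abbrev UqFree (𝕜 : Type*) [Field 𝕜] (n : ℕ) := FreeAlgebra 𝕜 (UqGen n)

/-- The generators in the free algebra. -/
abbrev gen (𝕜 : Type*) [Field 𝕜] {n : ℕ} (g : UqGen n) : UqFree 𝕜 n := FreeAlgebra.ι 𝕜 g

/-- The defining relations of `U_q(A^{(1)}_{n-1})` in the free algebra. -/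
inductive UqRel (q : 𝕜) (n : ℕ) : UqFree 𝕜 n → UqFree 𝕜 n → Prop
  | k_mul_kinv (i : ZMod n) : UqRel q n (gen 𝕜 (.k i) * gen 𝕜 (.kinv i)) 1
  | kinv_mul_k (i : ZMod n) : UqRel q n (gen 𝕜 (.kinv i) * gen 𝕜 (.k i)) 1
  | k_comm (i j : ZMod n) :
      UqRel q n (gen 𝕜 (.k i) * gen 𝕜 (.k j)) (gen 𝕜 (.k j) * gen 𝕜 (.k i))
  | k_e (i j : ZMod n) :
      UqRel q n (gen 𝕜 (.k i) * gen 𝕜 (.e j) * gen 𝕜 (.kinv i))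
        (q ^ cartan n i j • gen 𝕜 (.e j))
  | k_f (i j : ZMod n) :
      UqRel q n (gen 𝕜 (.k i) * gen 𝕜 (.f j) * gen 𝕜 (.kinv i))
        (q ^ (-cartan n i j) • gen 𝕜 (.f j))
  | e_f (i j : ZMod n) :
      UqRel q n (gen 𝕜 (.e i) * gen 𝕜 (.f j) - gen 𝕜 (.f j) * gen 𝕜 (.e i))
        (if i = j then (q - q⁻¹)⁻¹ • (gen 𝕜 (.k i) - gen 𝕜 (.kinv i)) else 0)
  | serre_e (i j : ZMod n) (h : i ≠ j) :
      UqRel q n (qSerre q (cartan n i j) (gen 𝕜 (.e i)) (gen 𝕜 (.e j))) 0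
  | serre_f (i j : ZMod n) (h : i ≠ j) :
      UqRel q n (qSerre q (cartan n i j) (gen 𝕜 (.f i)) (gen 𝕜 (.f j))) 0

/-- The algebra `U_q(A^{(1)}_{n-1})` (without derivation operator) over `𝕜`. -/
abbrev Uq (q : 𝕜) (n : ℕ) := RingQuot (UqRel q n)

namespace Uq

/-- The class in `U_q` of an element of the free algebra. -/
abbrev mk (q : 𝕜) (n : ℕ) : UqFree 𝕜 n →ₐ[𝕜] Uq q n := RingQuot.mkAlgHom 𝕜 (UqRel q n)

/-- The generator `e_i`. -/
def e (q : 𝕜) {n : ℕ} (i : ZMod n) : Uq q n := mk q n (gen 𝕜 (.e i))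
/-- The generator `f_i`. -/
def f (q : 𝕜) {n : ℕ} (i : ZMod n) : Uq q n := mk q n (gen 𝕜 (.f i))
/-- The generator `k_i`. -/
def k (q : 𝕜) {n : ℕ} (i : ZMod n) : Uq q n := mk q n (gen 𝕜 (.k i))
/-- The generator `k_i^{-1}`. -/
def kinv (q : 𝕜) {n : ℕ} (i : ZMod n) : Uq q n := mk q n (gen 𝕜 (.kinv i))

end Uq

theorem map_qSerre {B C : Type*} [Ring B] [Algebra 𝕜 B] [Ring C] [Algebra 𝕜 C]
    (φ : B →ₐ[𝕜] C) (q : 𝕜) (a : ℤ) (X Y : B) :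
    φ (qSerre q a X Y) = qSerre q a (φ X) (φ Y) := by
  simp [qSerre, divPow, map_sum]

theorem Uq.relations (q : 𝕜) (n : ℕ) :
    UqRelations q n (Uq.e q) (Uq.f q) (Uq.k q) (Uq.kinv q (n := n)) where
  k_mul_kinv i := by
    have := RingQuot.mkAlgHom_rel 𝕜 (UqRel.k_mul_kinv (q := q) i)
    rwa [map_mul, map_one] at this
  kinv_mul_k i := by
    have := RingQuot.mkAlgHom_rel 𝕜 (UqRel.kinv_mul_k (q := q) i)
    rwa [map_mul, map_one] at this
  k_comm i j := by
    have := RingQuot.mkAlgHom_rel 𝕜 (UqRel.k_comm (q := q) i j)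
    rwa [map_mul, map_mul] at this
  k_e i j := by
    have := RingQuot.mkAlgHom_rel 𝕜 (UqRel.k_e (q := q) i j)
    rwa [map_mul, map_mul, map_smul] at this
  k_f i j := by
    have := RingQuot.mkAlgHom_rel 𝕜 (UqRel.k_f (q := q) i j)
    rwa [map_mul, map_mul, map_smul] at this
  e_f i j := by
    have := RingQuot.mkAlgHom_rel 𝕜 (UqRel.e_f (q := q) i j)
    rw [map_sub, map_mul, map_mul, apply_ite (RingQuot.mkAlgHom 𝕜 (UqRel q n)), map_smul,
      map_sub, map_zero] at this
    exact this
  serre_e i j h := by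
    have := RingQuot.mkAlgHom_rel 𝕜 (UqRel.serre_e (q := q) i j h)
    rwa [map_qSerre, map_zero] at this
  serre_f i j h := by
    have := RingQuot.mkAlgHom_rel 𝕜 (UqRel.serre_f (q := q) i j h)
    rwa [map_qSerre, map_zero] at this

/-- The map on generators determined by four families of elements. -/
def genMap {B : Type*} {n : ℕ} (e f k k' : ZMod n → B) : UqGen n → B
  | .e i => e i
  | .f i => f i
  | .k i => k i
  | .kinv i => k' i

/-- The universal property of `U_q`: elements satisfying the defining relations determine an
algebra homomorphism. -/
def Uq.lift {B : Type*} [Ring B] [Algebra 𝕜 B] {q : 𝕜} {n : ℕ} {e f k k' : ZMod n → B}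
    (h : UqRelations q n e f k k') : Uq q n →ₐ[𝕜] B :=
  RingQuot.liftAlgHom 𝕜 ⟨FreeAlgebra.lift 𝕜 (genMap e f k k'), by
    intro a b hab
    cases hab with
    | k_mul_kinv i => simpa [genMap] using h.k_mul_kinv i
    | kinv_mul_k i => simpa [genMap] using h.kinv_mul_k i
    | k_comm i j => simpa [genMap] using h.k_comm i j
    | k_e i j => simpa [genMap] using h.k_e i j
    | k_f i j => simpa [genMap] using h.k_f i j
    | e_f i j =>
      rw [apply_ite (FreeAlgebra.lift 𝕜 (genMap e f k k'))]
      simpa [genMap] using h.e_f i j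
    | serre_e i j hij => rw [map_qSerre]; simpa [genMap] using h.serre_e i j hij
    | serre_f i j hij => rw [map_qSerre]; simpa [genMap] using h.serre_f i j hij⟩

theorem Uq.lift_mk {B : Type*} [Ring B] [Algebra 𝕜 B] {q : 𝕜} {n : ℕ} {e f k k' : ZMod n → B}
    (h : UqRelations q n e f k k') (a : UqFree 𝕜 n) :
    Uq.lift h (Uq.mk q n a) = FreeAlgebra.lift 𝕜 (genMap e f k k') a := by
  simp [Uq.lift, Uq.mk]

end Algebra

/-! ### The coproduct -/

section Coproduct

variable {𝕜 : Type*} [Field 𝕜]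

theorem IsGeneric.sq_sub_one_ne {q : 𝕜} (hq : IsGeneric q) : q ^ 2 - 1 ≠ 0 :=
  sub_ne_zero.2 (hq.2 2 (by norm_num))

theorem IsGeneric.sq_add_one_ne {q : 𝕜} (hq : IsGeneric q) : q ^ 2 + 1 ≠ 0 := by
  intro h
  exact hq.2 4 (by norm_num) (by linear_combination (q ^ 2 - 1) * h)

theorem IsGeneric.three_ne {q : 𝕜} (hq : IsGeneric q) : q ^ 4 + q ^ 2 + 1 ≠ 0 := by
  intro h
  exact hq.2 6 (by norm_num) (by linear_combination (q ^ 2 - 1) * h)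

theorem IsGeneric.sub_inv_ne {q : 𝕜} (hq : IsGeneric q) : q - q⁻¹ ≠ 0 := by
  intro h
  apply hq.sq_sub_one_ne
  have := hq.1
  field_simp at h
  linear_combination h

theorem qFact_zero (q : 𝕜) : qFact q 0 = 1 := by simp [qFact]

theorem qFact_one {q : 𝕜} (hq : IsGeneric q) : qFact q 1 = 1 := by
  simp [qFact, qInt, div_self hq.sub_inv_ne]

theorem qInt_two {q : 𝕜} (hq : IsGeneric q) : qInt q 2 = (q ^ 2 + 1) / q := by
  have h1 := hq.sub_inv_ne
  have h0 := hq.1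
  rw [qInt, div_eq_iff h1, zpow_neg]
  norm_cast
  field_simp
  ring

theorem qInt_three {q : 𝕜} (hq : IsGeneric q) : qInt q 3 = (q ^ 4 + q ^ 2 + 1) / q ^ 2 := by
  have h1 := hq.sub_inv_ne
  have h0 := hq.1
  rw [qInt, div_eq_iff h1, zpow_neg]
  norm_cast
  field_simp
  ring

theorem qFact_two {q : 𝕜} (hq : IsGeneric q) : qFact q 2 = (q ^ 2 + 1) / q := by
  have := qFact_one hq
  rw [qFact, Finset.prod_range_succ, ← qFact, this, one_mul, ← qInt_two hq]
  norm_num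

theorem qFact_three {q : 𝕜} (hq : IsGeneric q) :
    qFact q 3 = (q ^ 2 + 1) / q * ((q ^ 4 + q ^ 2 + 1) / q ^ 2) := by
  have := qFact_two hq
  rw [qFact, Finset.prod_range_succ, ← qFact, this, ← qInt_three hq]
  norm_num

section Serre

variable {B : Type*} [Ring B] [Algebra 𝕜 B]

theorem qSerre_zero {q : 𝕜} (hq : IsGeneric q) (X Y : B) :
    qSerre q 0 X Y = X * Y - Y * X := by
  simp [qSerre, divPow, Finset.sum_range_succ, qFact_zero, qFact_one hq, sub_eq_add_neg]

theorem qSerre_one {q : 𝕜} (hq : IsGeneric q) (X Y : B) :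
    qSerre q (-1) X Y = (q / (q ^ 2 + 1)) • (X * (X * Y)) - X * (Y * X)
      + (q / (q ^ 2 + 1)) • (Y * (X * X)) := by
  simp [qSerre, divPow, Finset.sum_range_succ, qFact_zero, qFact_one hq, qFact_two hq,
    sub_eq_add_neg, pow_two, mul_assoc]

theorem qSerre_two {q : 𝕜} (hq : IsGeneric q) (X Y : B) :
    qSerre q (-2) X Y =
      (q ^ 3 / ((q ^ 2 + 1) * (q ^ 4 + q ^ 2 + 1))) • (X * (X * (X * Y)))
      - (q / (q ^ 2 + 1)) • (X * (X * (Y * X))) + (q / (q ^ 2 + 1)) • (X * (Y * (X * X)))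
      - (q ^ 3 / ((q ^ 2 + 1) * (q ^ 4 + q ^ 2 + 1))) • (Y * (X * (X * X))) := by
  have h3 : (1 - (-2 : ℤ)).toNat = 3 := rfl
  have h0 := hq.1
  have h1 := hq.sq_add_one_ne
  have h2 := hq.three_ne
  have h5 : (qFact q 3)⁻¹ = q ^ 3 / ((q ^ 2 + 1) * (q ^ 4 + q ^ 2 + 1)) := by
    rw [qFact_three hq]; field_simp
  have h6 : (qFact q 2)⁻¹ = q / (q ^ 2 + 1) := by
    rw [qFact_two hq]; field_simp
  rw [qSerre, h3]
  simp [divPow, Finset.sum_range_succ, qFact_zero, qFact_one hq, h5, h6,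
    sub_eq_add_neg, pow_succ, mul_assoc]

theorem qSerre_add_zero {q : 𝕜} (hq : IsGeneric q) {X Y X' Y' : B}
    (h2 : Y * X' = X' * Y) (h3 : Y' * X = X * Y')
    (hX : qSerre q 0 X X' = 0) (hY : qSerre q 0 Y Y' = 0) :
    qSerre q 0 (X + Y) (X' + Y') = 0 := by
  rw [qSerre_zero hq] at *
  have : (X + Y) * (X' + Y') - (X' + Y') * (X + Y)
      = (X * X' - X' * X) + (Y * Y' - Y' * Y) + (Y * X' - X' * Y) - (Y' * X - X * Y') := by
    noncomm_ring
  rw [this, hX, hY, h2, h3]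
  simp

theorem qSerre_add_one {q : 𝕜} (hq : IsGeneric q) {X Y X' Y' : B}
    (h1 : Y * X = q ^ 2 • (X * Y)) (h2 : Y * X' = q⁻¹ • (X' * Y)) (h3 : Y' * X = q⁻¹ • (X * Y'))
    (hX : qSerre q (-1) X X' = 0) (hY : qSerre q (-1) Y Y' = 0) :
    qSerre q (-1) (X + Y) (X' + Y') = 0 := by
  have h1' (t : B) : Y * (X * t) = q ^ 2 • (X * (Y * t)) := by
    rw [← mul_assoc, h1, smul_mul_assoc, mul_assoc]
  have h2' (t : B) : Y * (X' * t) = q⁻¹ • (X' * (Y * t)) := by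
    rw [← mul_assoc, h2, smul_mul_assoc, mul_assoc]
  have h3' (t : B) : Y' * (X * t) = q⁻¹ • (X * (Y' * t)) := by
    rw [← mul_assoc, h3, smul_mul_assoc, mul_assoc]
  have e0 := hq.1
  have e1 := hq.sq_add_one_ne
  rw [qSerre_one hq] at *
  refine Eq.trans ?_ ((congrArg₂ (· + ·) hX hY).trans (add_zero 0))
  simp only [mul_add, add_mul, mul_smul_comm, h1, h2, h3, h1', h2', h3',
    smul_add, smul_smul]
  match_scalars <;> field_simp <;> ring

theorem qSerre_add_two {q : 𝕜} (hq : IsGeneric q) {X Y X' Y' : B}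
    (h1 : Y * X = q ^ 2 • (X * Y)) (h2 : Y * X' = (q ^ 2)⁻¹ • (X' * Y))
    (h3 : Y' * X = (q ^ 2)⁻¹ • (X * Y'))
    (hX : qSerre q (-2) X X' = 0) (hY : qSerre q (-2) Y Y' = 0) :
    qSerre q (-2) (X + Y) (X' + Y') = 0 := by
  have h1' (t : B) : Y * (X * t) = q ^ 2 • (X * (Y * t)) := by
    rw [← mul_assoc, h1, smul_mul_assoc, mul_assoc]
  have h2' (t : B) : Y * (X' * t) = (q ^ 2)⁻¹ • (X' * (Y * t)) := by
    rw [← mul_assoc, h2, smul_mul_assoc, mul_assoc]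
  have h3' (t : B) : Y' * (X * t) = (q ^ 2)⁻¹ • (X * (Y' * t)) := by
    rw [← mul_assoc, h3, smul_mul_assoc, mul_assoc]
  have e0 := hq.1
  have e1 := hq.sq_add_one_ne
  have e2 := hq.three_ne
  rw [qSerre_two hq] at *
  obtain ⟨w, hw⟩ : ∃ w, w = q ^ 4 + q ^ 2 + 1 := ⟨_, rfl⟩
  rw [← hw] at e2 hX hY ⊢
  refine Eq.trans ?_ ((congrArg₂ (· + ·) hX hY).trans (add_zero 0))
  simp only [mul_add, add_mul, mul_assoc, mul_smul_comm, h1, h2, h3, h1', h2', h3',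
    smul_add, smul_smul]
  match_scalars <;> field_simp <;> (try simp only [hw]) <;> ring

theorem cartan_symm (n : ℕ) (i j : ZMod n) : cartan n i j = cartan n j i := by
  unfold cartan
  simp only [eq_comm (a := i) (b := j)]
  ring

theorem cartan_self {n : ℕ} {i j : ZMod n} (h : i ≠ j) : cartan n i i = 2 := by
  have h1 : i ≠ i + 1 := by
    intro h2
    have h3 : (1 : ZMod n) = 0 := by simpa using h2.symm
    exact h (by rw [← mul_one i, ← mul_one j, h3, mul_zero, mul_zero])
  unfold cartan
  rw [if_pos rfl, if_neg h1]
  norm_num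

theorem cartan_ne {n : ℕ} {i j : ZMod n} (h : i ≠ j) :
    cartan n i j = 0 ∨ cartan n i j = -1 ∨ cartan n i j = -2 := by
  unfold cartan
  rw [if_neg h]
  split_ifs <;> simp

/-- Additivity of the `q`-Serre relations under `q`-commutation. -/
theorem qSerre_add {q : 𝕜} (hq : IsGeneric q) {a : ℤ} (ha : a = 0 ∨ a = -1 ∨ a = -2)
    {X Y X' Y' : B}
    (h1 : Y * X = q ^ (2 : ℤ) • (X * Y)) (h2 : Y * X' = q ^ a • (X' * Y))
    (h3 : Y' * X = q ^ a • (X * Y'))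
    (hX : qSerre q a X X' = 0) (hY : qSerre q a Y Y' = 0) :
    qSerre q a (X + Y) (X' + Y') = 0 := by
  have h1' : Y * X = q ^ 2 • (X * Y) := by exact_mod_cast h1
  rcases ha with rfl | rfl | rfl
  · exact qSerre_add_zero hq (by simpa using h2) (by simpa using h3) hX hY
  · exact qSerre_add_one hq h1' (by simpa using h2) (by simpa using h3) hX hY
  · refine qSerre_add_two hq h1' ?_ ?_ hX hY
    · rw [h2, zpow_neg]; norm_cast
    · rw [h3, zpow_neg]; norm_cast

/-- The `q`-Serre relations persist after multiplication by `q`-commuting elements. -/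
theorem qSerre_tmul {C : Type*} [Ring C] [Algebra 𝕜 C] {q : 𝕜} (hq : IsGeneric q) {a : ℤ}
    (ha : a = 0 ∨ a = -1 ∨ a = -2)
    {X X' : B} {u u' : C} (hu : u * u' = u' * u) (hX : qSerre q a X X' = 0) :
    qSerre q a (X ⊗ₜ[𝕜] u) (X' ⊗ₜ[𝕜] u') = 0 := by
  have hu' (t : C) : u * (u' * t) = u' * (u * t) := by
    rw [← mul_assoc, hu, mul_assoc]
  rcases ha with rfl | rfl | rfl
  · rw [qSerre_zero hq] at *
    simp only [Algebra.TensorProduct.tmul_mul_tmul, hu, ← TensorProduct.sub_tmul, hX,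
      TensorProduct.zero_tmul]
  · rw [qSerre_one hq] at *
    simp only [Algebra.TensorProduct.tmul_mul_tmul, hu, hu', TensorProduct.smul_tmul',
      ← TensorProduct.sub_tmul, ← TensorProduct.add_tmul, hX, TensorProduct.zero_tmul]
  · rw [qSerre_two hq] at *
    simp only [Algebra.TensorProduct.tmul_mul_tmul, hu, hu', TensorProduct.smul_tmul',
      ← TensorProduct.sub_tmul, ← TensorProduct.add_tmul, hX, TensorProduct.zero_tmul]

theorem qSerre_tmul' {C : Type*} [Ring C] [Algebra 𝕜 C] {q : 𝕜} (hq : IsGeneric q) {a : ℤ}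
    (ha : a = 0 ∨ a = -1 ∨ a = -2)
    {X X' : B} {u u' : C} (hu : u * u' = u' * u) (hX : qSerre q a X X' = 0) :
    qSerre q a (u ⊗ₜ[𝕜] X) (u' ⊗ₜ[𝕜] X') = 0 := by
  have h := congrArg (Algebra.TensorProduct.comm 𝕜 B C).toAlgHom (qSerre_tmul hq ha hu hX)
  rw [map_qSerre] at h
  simpa using h

end Serre

namespace UqRelations

variable {B : Type*} [Ring B] [Algebra 𝕜 B] {q : 𝕜} {n : ℕ} {e f k k' : ZMod n → B}

theorem ke (h : UqRelations q n e f k k') (i j : ZMod n) :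
    k i * e j = q ^ cartan n i j • (e j * k i) := by
  rw [← smul_mul_assoc, ← h.k_e, mul_assoc, h.kinv_mul_k, mul_one]

theorem kf (h : UqRelations q n e f k k') (i j : ZMod n) :
    k i * f j = q ^ (-cartan n i j) • (f j * k i) := by
  rw [← smul_mul_assoc, ← h.k_f, mul_assoc, h.kinv_mul_k, mul_one]

theorem inv_swap (h : UqRelations q n e f k k') (hq : q ≠ 0) (i : ZMod n) (a : ℤ) (t : B)
    (ht : k i * t = q ^ a • (t * k i)) : k' i * t = q ^ (-a) • (t * k' i) := by
  have h1 : t * k' i = q ^ a • (k' i * t) := by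
    have := congrArg (fun s => k' i * s * k' i) ht
    simp only [mul_smul_comm, smul_mul_assoc] at this
    rw [← mul_assoc, h.kinv_mul_k, one_mul, mul_assoc, mul_assoc, h.k_mul_kinv, mul_one] at this
    exact this
  rw [h1, smul_smul, ← zpow_add₀ hq]
  simp

theorem kinv_e (h : UqRelations q n e f k k') (hq : q ≠ 0) (i j : ZMod n) :
    k' i * e j = q ^ (-cartan n i j) • (e j * k' i) := h.inv_swap hq i _ _ (h.ke i j)

theorem kinv_f (h : UqRelations q n e f k k') (hq : q ≠ 0) (i j : ZMod n) :
    k' i * f j = q ^ cartan n i j • (f j * k' i) := by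
  simpa using h.inv_swap hq i _ _ (h.kf i j)

theorem kinv_k (h : UqRelations q n e f k k') (hq : q ≠ 0) (i j : ZMod n) :
    k' i * k j = k j * k' i := by
  simpa using h.inv_swap hq i 0 (k j) (by simpa using h.k_comm i j)

theorem kinv_comm (h : UqRelations q n e f k k') (hq : q ≠ 0) (i j : ZMod n) :
    k' i * k' j = k' j * k' i := by
  simpa using h.inv_swap hq i 0 (k' j) (by simpa using (h.kinv_k hq j i).symm)

/-- The images of the generators under the coproduct satisfy the defining relations. -/
theorem coproduct (h : UqRelations q n e f k k') (hq : IsGeneric q) :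
    UqRelations q n
      (fun i => 1 ⊗ₜ[𝕜] e i + e i ⊗ₜ[𝕜] k i)
      (fun i => f i ⊗ₜ[𝕜] 1 + k' i ⊗ₜ[𝕜] f i)
      (fun i => k i ⊗ₜ[𝕜] k i)
      (fun i => k' i ⊗ₜ[𝕜] k' i) where
  k_mul_kinv i := by simp [h.k_mul_kinv, Algebra.TensorProduct.one_def]
  kinv_mul_k i := by simp [h.kinv_mul_k, Algebra.TensorProduct.one_def]
  k_comm i j := by simp [h.k_comm i j]
  k_e i j := by
    have : k i * k j * k' i = k j := by
      rw [h.k_comm, mul_assoc, h.k_mul_kinv, mul_one]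
    simp [mul_add, add_mul, h.k_mul_kinv, h.k_e, this, TensorProduct.tmul_smul,
      TensorProduct.smul_tmul']
  k_f i j := by
    have : k i * k' j * k' i = k' j := by
      rw [← h.kinv_k hq.1, mul_assoc, h.k_mul_kinv, mul_one]
    simp [mul_add, add_mul, h.k_mul_kinv, h.k_f, this, TensorProduct.tmul_smul,
      TensorProduct.smul_tmul']
  e_f i j := by
    have cross : (e i * k' j) ⊗ₜ[𝕜] (k i * f j) = (k' j * e i) ⊗ₜ[𝕜] (f j * k i) := by
      rw [h.kinv_e hq.1, h.kf, TensorProduct.tmul_smul, ← TensorProduct.smul_tmul', cartan_symm]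
    have expand : (1 ⊗ₜ[𝕜] e i + e i ⊗ₜ[𝕜] k i) * (f j ⊗ₜ[𝕜] 1 + k' j ⊗ₜ[𝕜] f j)
        - (f j ⊗ₜ[𝕜] 1 + k' j ⊗ₜ[𝕜] f j) * (1 ⊗ₜ[𝕜] e i + e i ⊗ₜ[𝕜] k i)
        = (e i * f j - f j * e i) ⊗ₜ[𝕜] k i + k' j ⊗ₜ[𝕜] (e i * f j - f j * e i) := by
      simp only [mul_add, add_mul, Algebra.TensorProduct.tmul_mul_tmul, one_mul, mul_one,
        TensorProduct.sub_tmul, TensorProduct.tmul_sub, cross]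
      abel
    rw [expand, h.e_f]
    split_ifs with hij
    · subst hij
      rw [← TensorProduct.smul_tmul', TensorProduct.tmul_smul, ← smul_add, TensorProduct.sub_tmul,
        TensorProduct.tmul_sub]
      congr 1
      abel
    · simp
  serre_e i j hij := by
    have hc := cartan_ne hij
    refine qSerre_add hq hc ?_ ?_ ?_ (qSerre_tmul' hq hc rfl (h.serre_e i j hij))
      (qSerre_tmul hq hc (h.k_comm i j) (h.serre_e i j hij))
    · simp only [Algebra.TensorProduct.tmul_mul_tmul, one_mul, mul_one, h.ke, cartan_self hij,
        TensorProduct.tmul_smul]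
    · simp only [Algebra.TensorProduct.tmul_mul_tmul, one_mul, mul_one, h.ke,
        TensorProduct.tmul_smul]
    · simp only [Algebra.TensorProduct.tmul_mul_tmul, one_mul, mul_one, h.ke j i,
        TensorProduct.tmul_smul, cartan_symm n j i]
  serre_f i j hij := by
    have hc := cartan_ne hij
    refine qSerre_add hq hc ?_ ?_ ?_ (qSerre_tmul hq hc rfl (h.serre_f i j hij))
      (qSerre_tmul' hq hc (h.kinv_comm hq.1 i j) (h.serre_f i j hij))
    · simp only [Algebra.TensorProduct.tmul_mul_tmul, one_mul, mul_one, h.kinv_f hq.1,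
        cartan_self hij, TensorProduct.smul_tmul']
    · simp only [Algebra.TensorProduct.tmul_mul_tmul, one_mul, mul_one, h.kinv_f hq.1,
        TensorProduct.smul_tmul']
    · simp only [Algebra.TensorProduct.tmul_mul_tmul, one_mul, mul_one, h.kinv_f hq.1 j i,
        TensorProduct.smul_tmul', cartan_symm n j i]

end UqRelations

/-- The coproduct `Δ` of `U_q`:
`Δ k_i^{±1} = k_i^{±1} ⊗ k_i^{±1}`, `Δ e_i = 1 ⊗ e_i + e_i ⊗ k_i`,
`Δ f_i = f_i ⊗ 1 + k_i^{-1} ⊗ f_i`. -/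
def Uq.comul {q : 𝕜} (hq : IsGeneric q) (n : ℕ) : Uq q n →ₐ[𝕜] Uq q n ⊗[𝕜] Uq q n :=
  Uq.lift ((Uq.relations q n).coproduct hq)

/-- The opposite coproduct `Δ' = P ∘ Δ`. -/
def Uq.comulOp {q : 𝕜} (hq : IsGeneric q) (n : ℕ) : Uq q n →ₐ[𝕜] Uq q n ⊗[𝕜] Uq q n :=
  (Algebra.TensorProduct.comm 𝕜 (Uq q n) (Uq q n)).toAlgHom.comp (Uq.comul hq n)

end Coproduct

/-! ### The `q`-oscillator representation on the Fock space -/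

section Representation

variable {𝕜 : Type*} [Field 𝕜]

/-- The `n`-fold tensor power `F^{⊗n}` of the Fock space, through its basis `|m⟩`,
`m ∈ (ℤ_{≥0})^n`; the `n` sites are labelled by the integers modulo `n`. -/
abbrev Fock (𝕜 : Type*) [Field 𝕜] (n : ℕ) := (ZMod n → ℕ) →₀ 𝕜

/-- The basis vector `|m⟩`. -/
abbrev ket (𝕜 : Type*) [Field 𝕜] {n : ℕ} (m : ZMod n → ℕ) : Fock 𝕜 n := Finsupp.single m 1

/-- `e_j |m⟩ = x^{δ_{j,0}} [m_j] |m - e_j + e_{j+1}⟩`. -/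
def opE (q : 𝕜) (x : 𝕜ˣ) {n : ℕ} (j : ZMod n) : Module.End 𝕜 (Fock 𝕜 n) :=
  Finsupp.linearCombination 𝕜 fun m =>
    ((if j = 0 then (x : 𝕜) else 1) * qInt q (m j)) •
      ket 𝕜 (m - Pi.single j 1 + Pi.single (j + 1) 1)

/-- `f_j |m⟩ = x^{-δ_{j,0}} [m_{j+1}] |m + e_j - e_{j+1}⟩`. -/
def opF (q : 𝕜) (x : 𝕜ˣ) {n : ℕ} (j : ZMod n) : Module.End 𝕜 (Fock 𝕜 n) :=
  Finsupp.linearCombination 𝕜 fun m =>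
    ((if j = 0 then (x : 𝕜)⁻¹ else 1) * qInt q (m (j + 1))) •
      ket 𝕜 (m - Pi.single (j + 1) 1 + Pi.single j 1)

/-- `k_j |m⟩ = q^{-m_j + m_{j+1}} |m⟩`. -/
def opK (q : 𝕜) {n : ℕ} (j : ZMod n) : Module.End 𝕜 (Fock 𝕜 n) :=
  Finsupp.linearCombination 𝕜 fun m => q ^ (-(m j : ℤ) + (m (j + 1) : ℤ)) • ket 𝕜 m

/-- `k_j^{-1} |m⟩ = q^{m_j - m_{j+1}} |m⟩`. -/
def opKinv (q : 𝕜) {n : ℕ} (j : ZMod n) : Module.End 𝕜 (Fock 𝕜 n) :=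
  Finsupp.linearCombination 𝕜 fun m => q ^ (-(-(m j : ℤ) + (m (j + 1) : ℤ))) • ket 𝕜 m

/-! To verify the defining relations we extend the formulas to the larger space with basis
labelled by `ℤ^n`, in which `F^{⊗n}` embeds. -/

/-- The space with basis labelled by `ℤ^n`. -/
abbrev FockZ (𝕜 : Type*) [Field 𝕜] (n : ℕ) := (ZMod n → ℤ) →₀ 𝕜

/-- The inclusion of `F^{⊗n}`. -/
def toZ (𝕜 : Type*) [Field 𝕜] (n : ℕ) : Fock 𝕜 n →ₗ[𝕜] FockZ 𝕜 n :=
  Finsupp.lmapDomain 𝕜 𝕜 fun m r => (m r : ℤ)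

theorem toZ_injective (𝕜 : Type*) [Field 𝕜] (n : ℕ) : Function.Injective (toZ 𝕜 n) :=
  Finsupp.mapDomain_injective fun a b h => funext fun r => by exact_mod_cast congrFun h r

/-- The operator `|m⟩ ↦ ξ [m_p] |m + s⟩`. -/
def zOp (q : 𝕜) {n : ℕ} (p : ZMod n) (s : ZMod n → ℤ) (ξ : 𝕜) : Module.End 𝕜 (FockZ 𝕜 n) :=
  Finsupp.linearCombination 𝕜 fun m => Finsupp.single (m + s) (ξ * qInt q (m p))

/-- The operator `|m⟩ ↦ q^{ε (-m_j + m_{j+1})} |m⟩`. -/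
def zDiag (q : 𝕜) {n : ℕ} (j : ZMod n) (ε : ℤ) : Module.End 𝕜 (FockZ 𝕜 n) :=
  Finsupp.linearCombination 𝕜 fun m => Finsupp.single m (q ^ (ε * (-m j + m (j + 1))))

theorem zOp_single (q : 𝕜) {n : ℕ} (p : ZMod n) (s : ZMod n → ℤ) (ξ : 𝕜) (m : ZMod n → ℤ)
    (c : 𝕜) :
    zOp q p s ξ (Finsupp.single m c) = Finsupp.single (m + s) (c * (ξ * qInt q (m p))) := by
  rw [zOp, Finsupp.linearCombination_single, Finsupp.smul_single, smul_eq_mul]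

theorem zDiag_single (q : 𝕜) {n : ℕ} (j : ZMod n) (ε : ℤ) (m : ZMod n → ℤ) (c : 𝕜) :
    zDiag q j ε (Finsupp.single m c)
      = Finsupp.single m (c * q ^ (ε * (-m j + m (j + 1)))) := by
  rw [zDiag, Finsupp.linearCombination_single, Finsupp.smul_single, smul_eq_mul]

theorem qInt_zero (q : 𝕜) : qInt q 0 = 0 := by simp [qInt]

theorem qInt_eq {q : 𝕜} (hq : IsGeneric q) (a : ℤ) :
    qInt q a = (q ^ a - (q ^ a)⁻¹) * q / (q ^ 2 - 1) := by
  have h0 := hq.1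
  have h1 := hq.sq_sub_one_ne
  have h2 := hq.sub_inv_ne
  rw [qInt, zpow_neg, div_eq_div_iff h2 h1]
  field_simp

theorem qInt_add {q : 𝕜} (hq : IsGeneric q) (a b : ℤ) :
    qInt q (a + b) = (q ^ a * q ^ b - (q ^ a)⁻¹ * (q ^ b)⁻¹) * q / (q ^ 2 - 1) := by
  rw [qInt_eq hq, zpow_add₀ hq.1, mul_inv]

theorem zOp_serre {q : 𝕜} (hq : IsGeneric q) {n : ℕ} {p p' : ZMod n} {s s' : ZMod n → ℤ}
    (ξ ξ' : 𝕜) (h1 : s p = -1)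
    (h3 : s' p = 0 ∨ s' p = 1) (h4 : s p' = 0 ∨ s p' = 1) :
    qSerre q (-(s' p + s p')) (zOp q p s ξ) (zOp q p' s' ξ') = 0 := by
  have e0 := hq.1
  have e1 := hq.sq_sub_one_ne
  have e2 := hq.sq_add_one_ne
  have e3 := hq.three_ne
  obtain ⟨w, hw⟩ : ∃ w, w = q ^ 4 + q ^ 2 + 1 := ⟨_, rfl⟩
  rw [← hw] at e3
  obtain ⟨v, hv⟩ : ∃ v, v = q ^ 2 - 1 := ⟨_, rfl⟩
  rw [← hv] at e1
  have c0 (m : ZMod n → ℤ) : m + s + s' = m + s' + s := add_right_comm _ _ _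
  have key : ∀ (m : ZMod n → ℤ) (c : 𝕜), c = 0 → Finsupp.single m c = 0 := by
    rintro m _ rfl; simp
  rcases h3 with h3 | h3 <;> rcases h4 with h4 | h4 <;> rw [h3, h4]
  · rw [show -((0 : ℤ) + 0) = 0 by norm_num, qSerre_zero hq]
    refine Finsupp.lhom_ext fun m c => ?_
    simp only [LinearMap.sub_apply, Module.End.mul_apply, LinearMap.zero_apply, zOp_single,
      Pi.add_apply, h3, h4, c0, add_zero, ← Finsupp.single_sub]
    apply key
    ring
  all_goals
    first
      | rw [show -((0 : ℤ) + 1) = -1 by norm_num, qSerre_one hq]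
      | rw [show -((1 : ℤ) + 0) = -1 by norm_num, qSerre_one hq]
      | rw [show -((1 : ℤ) + 1) = -2 by norm_num, qSerre_two hq]
    refine Finsupp.lhom_ext fun m c => ?_
    have hu : q ^ m p ≠ 0 := zpow_ne_zero _ e0
    have hu' : q ^ m p' ≠ 0 := zpow_ne_zero _ e0
    simp only [LinearMap.sub_apply, LinearMap.add_apply, LinearMap.smul_apply,
      Module.End.mul_apply, LinearMap.zero_apply, zOp_single, Finsupp.smul_single, smul_eq_mul,
      Pi.add_apply, h1, h3, h4, c0, ← Finsupp.single_sub, ← Finsupp.single_add]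
    apply key
    simp only [qInt_add hq, qInt_eq hq, add_zero, zpow_neg, zpow_one, zpow_add₀ e0,
      mul_inv, inv_inv, ← hw, ← hv]
    generalize q ^ m p = u at hu ⊢
    generalize q ^ m p' = u' at hu' ⊢
    field_simp
    try simp only [hw, hv]
    ring

/-- The vector `e_{j+1} - e_j`. -/
def rootVec {n : ℕ} (j : ZMod n) : ZMod n → ℤ := Pi.single (j + 1) 1 - Pi.single j 1

theorem rootVec_apply {n : ℕ} (j r : ZMod n) :
    rootVec j r = (if r = j + 1 then 1 else 0) - (if r = j then 1 else 0) := by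
  simp [rootVec, Pi.single_apply]

theorem toZ_ket {n : ℕ} (m : ZMod n → ℕ) (c : 𝕜) :
    toZ 𝕜 n (Finsupp.single m c) = Finsupp.single (fun r => (m r : ℤ)) c := by
  simp [toZ]

theorem toZ_shift (q : 𝕜) {n : ℕ} (m : ZMod n → ℕ) (a b : ZMod n) (ξ : 𝕜) :
    toZ 𝕜 n ((ξ * qInt q (m a)) • ket 𝕜 (m - Pi.single a 1 + Pi.single b 1))
      = Finsupp.single ((fun r => (m r : ℤ)) + (Pi.single b 1 - Pi.single a 1))
          (ξ * qInt q (m a)) := by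
  rw [map_smul, toZ_ket, Finsupp.smul_single, smul_eq_mul, mul_one]
  by_cases h : m a = 0
  · simp [h, qInt_zero]
  · congr 1
    funext r
    have : (Pi.single a 1 : ZMod n → ℕ) r ≤ m r := by
      rw [Pi.single_apply]
      split_ifs with hr
      · subst hr; omega
      · simp
    simp only [Pi.add_apply, Pi.sub_apply]
    push_cast [Nat.cast_sub this]
    simp only [Pi.single_apply]
    push_cast
    ring

theorem toZ_opE (q : 𝕜) (x : 𝕜ˣ) {n : ℕ} (j : ZMod n) (v : Fock 𝕜 n) :
    toZ 𝕜 n (opE q x j v)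
      = zOp q j (rootVec j) (if j = 0 then (x : 𝕜) else 1) (toZ 𝕜 n v) := by
  suffices h : toZ 𝕜 n ∘ₗ opE q x j
      = zOp q j (rootVec j) (if j = 0 then (x : 𝕜) else 1) ∘ₗ toZ 𝕜 n from
    LinearMap.congr_fun h v
  refine Finsupp.lhom_ext fun m c => ?_
  simp only [LinearMap.comp_apply, opE, Finsupp.linearCombination_single, toZ_ket, zOp_single]
  rw [map_smul, toZ_shift, Finsupp.smul_single, smul_eq_mul, rootVec]

theorem toZ_opF (q : 𝕜) (x : 𝕜ˣ) {n : ℕ} (j : ZMod n) (v : Fock 𝕜 n) :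
    toZ 𝕜 n (opF q x j v)
      = zOp q (j + 1) (-rootVec j) (if j = 0 then (x : 𝕜)⁻¹ else 1) (toZ 𝕜 n v) := by
  suffices h : toZ 𝕜 n ∘ₗ opF q x j
      = zOp q (j + 1) (-rootVec j) (if j = 0 then (x : 𝕜)⁻¹ else 1) ∘ₗ toZ 𝕜 n from
    LinearMap.congr_fun h v
  refine Finsupp.lhom_ext fun m c => ?_
  simp only [LinearMap.comp_apply, opF, Finsupp.linearCombination_single, toZ_ket, zOp_single]
  rw [map_smul, toZ_shift, Finsupp.smul_single, smul_eq_mul, rootVec, neg_sub]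

theorem toZ_opK (q : 𝕜) {n : ℕ} (j : ZMod n) (v : Fock 𝕜 n) :
    toZ 𝕜 n (opK q j v) = zDiag q j 1 (toZ 𝕜 n v) := by
  suffices h : toZ 𝕜 n ∘ₗ opK q j = zDiag q j 1 ∘ₗ toZ 𝕜 n from LinearMap.congr_fun h v
  refine Finsupp.lhom_ext fun m c => ?_
  simp only [LinearMap.comp_apply, opK, Finsupp.linearCombination_single, toZ_ket, zDiag_single,
    Finsupp.smul_single, smul_eq_mul, mul_one, one_mul]

theorem toZ_opKinv (q : 𝕜) {n : ℕ} (j : ZMod n) (v : Fock 𝕜 n) :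
    toZ 𝕜 n (opKinv q j v) = zDiag q j (-1) (toZ 𝕜 n v) := by
  suffices h : toZ 𝕜 n ∘ₗ opKinv q j = zDiag q j (-1) ∘ₗ toZ 𝕜 n from LinearMap.congr_fun h v
  refine Finsupp.lhom_ext fun m c => ?_
  simp only [LinearMap.comp_apply, opKinv, Finsupp.linearCombination_single, toZ_ket, zDiag_single,
    Finsupp.smul_single, smul_eq_mul, mul_one, neg_one_mul]

theorem zDiag_zOp {q : 𝕜} (hq : IsGeneric q) {n : ℕ} (i p : ZMod n) (s : ZMod n → ℤ) (ξ : 𝕜) :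
    zDiag q i 1 * zOp q p s ξ * zDiag q i (-1) = q ^ (-s i + s (i + 1)) • zOp q p s ξ := by
  refine Finsupp.lhom_ext fun m c => ?_
  have hexp : (q ^ (-(-m i + m (i + 1))) * q ^ (-(m + s) i + (m + s) (i + 1)) : 𝕜)
      = q ^ (-s i + s (i + 1)) := by
    rw [← zpow_add₀ hq.1]
    congr 1
    simp only [Pi.add_apply]
    ring
  simp only [Module.End.mul_apply, zDiag_single, zOp_single, LinearMap.smul_apply,
    Finsupp.smul_single, smul_eq_mul, one_mul, neg_one_mul]
  rw [← hexp]
  congr 1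
  ring

theorem rootVec_self {n : ℕ} (hn : 2 ≤ n) (i : ZMod n) :
    rootVec i i = -1 ∧ rootVec i (i + 1) = 1 := by
  have : Fact (1 < n) := ⟨hn⟩
  have hs : i ≠ i + 1 := by simp
  rw [rootVec_apply, rootVec_apply, if_neg hs, if_pos rfl, if_pos rfl, if_neg hs.symm]
  simp

theorem rootVec_of_ne {n : ℕ} {i j : ZMod n} (h : i ≠ j) :
    rootVec j i = (if i = j + 1 then 1 else 0) ∧
      rootVec j (i + 1) = -(if j = i + 1 then 1 else 0) := by
  have h1 : i + 1 ≠ j + 1 := fun h2 => h (add_right_cancel h2)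
  rw [rootVec_apply, rootVec_apply, if_neg h, if_neg h1]
  simp only [sub_zero, zero_sub, eq_comm (a := i + 1) (b := j), and_self]

theorem zOp_comm_self {q : 𝕜} (hq : IsGeneric q) {n : ℕ} (hn : 2 ≤ n) (i : ZMod n)
    {ξ ξ' : 𝕜} (hx : ξ * ξ' = 1) :
    zOp q i (rootVec i) ξ * zOp q (i + 1) (-rootVec i) ξ'
      - zOp q (i + 1) (-rootVec i) ξ' * zOp q i (rootVec i) ξ
      = (q - q⁻¹)⁻¹ • (zDiag q i 1 - zDiag q i (-1)) := by
  have e0 := hq.1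
  have e1 := hq.sq_sub_one_ne
  refine Finsupp.lhom_ext fun m c => ?_
  have h1 : (q - q⁻¹)⁻¹ = q / (q ^ 2 - 1) := by
    rw [← inv_div]; congr 1; field_simp
  have hm : m + -rootVec i + rootVec i = m := by abel
  have hm' : m + rootVec i + -rootVec i = m := by abel
  obtain ⟨v, hv⟩ : ∃ v, v = q ^ 2 - 1 := ⟨_, rfl⟩
  simp only [LinearMap.sub_apply, LinearMap.smul_apply, Module.End.mul_apply, zOp_single,
    zDiag_single, Finsupp.smul_single, smul_eq_mul, hm, hm', ← Finsupp.single_sub, Pi.add_apply,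
    Pi.neg_apply, (rootVec_self hn i).1, (rootVec_self hn i).2]
  congr 1
  have hu : q ^ m i ≠ 0 := zpow_ne_zero _ e0
  have hu' : q ^ m (i + 1) ≠ 0 := zpow_ne_zero _ e0
  rw [h1]
  simp only [qInt_eq hq, zpow_add₀ e0, neg_neg, zpow_one, one_mul, neg_one_mul, neg_add, zpow_neg]
  generalize q ^ m i = u at hu ⊢
  generalize q ^ m (i + 1) = u' at hu' ⊢
  rw [← hv] at e1 ⊢
  field_simp
  rw [hv]
  linear_combination (c * (q ^ 2 - 1) * (u' ^ 2 - u ^ 2)) * hx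

theorem zOp_comm_ne {q : 𝕜} {n : ℕ} {i j : ZMod n} (hij : i ≠ j) (ξ ξ' : 𝕜) :
    zOp q i (rootVec i) ξ * zOp q (j + 1) (-rootVec j) ξ'
      - zOp q (j + 1) (-rootVec j) ξ' * zOp q i (rootVec i) ξ = 0 := by
  refine Finsupp.lhom_ext fun m c => ?_
  have c0 : m + rootVec i + -rootVec j = m + -rootVec j + rootVec i := add_right_comm _ _ _
  simp only [LinearMap.sub_apply, Module.End.mul_apply, zOp_single,
    LinearMap.zero_apply, c0, ← Finsupp.single_sub, Pi.add_apply, Pi.neg_apply,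
    (rootVec_of_ne hij).1, (rootVec_of_ne hij.symm).2]
  rw [Finsupp.single_eq_zero]
  split_ifs with h2
  · subst h2
    ring
  · simp only [neg_zero, add_zero]
    ring

theorem neg_rootVec_cartan {n : ℕ} (i j : ZMod n) :
    -rootVec j i + rootVec j (i + 1) = cartan n i j := by
  simp only [rootVec_apply, cartan, add_left_inj, eq_comm (a := i + 1) (b := j)]
  ring

theorem toZ_qSerre {q : 𝕜} (hq : IsGeneric q) {n : ℕ} {a : ℤ} (ha : a = 0 ∨ a = -1 ∨ a = -2)
    {X Y : Module.End 𝕜 (Fock 𝕜 n)} {X' Y' : Module.End 𝕜 (FockZ 𝕜 n)}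
    (hX : ∀ v, toZ 𝕜 n (X v) = X' (toZ 𝕜 n v)) (hY : ∀ v, toZ 𝕜 n (Y v) = Y' (toZ 𝕜 n v))
    {v : Fock 𝕜 n}
    (h : qSerre q a X' Y' (toZ 𝕜 n v) = (0 : Module.End 𝕜 (FockZ 𝕜 n)) (toZ 𝕜 n v)) :
    toZ 𝕜 n (qSerre q a X Y v) = toZ 𝕜 n ((0 : Module.End 𝕜 (Fock 𝕜 n)) v) := by
  rw [LinearMap.zero_apply] at h
  rw [LinearMap.zero_apply, map_zero, ← h]
  rcases ha with rfl | rfl | rfl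
  · rw [qSerre_zero hq, qSerre_zero hq]
    simp only [LinearMap.sub_apply, Module.End.mul_apply, map_sub, hX, hY]
  · rw [qSerre_one hq, qSerre_one hq]
    simp only [LinearMap.sub_apply, LinearMap.add_apply, LinearMap.smul_apply,
      Module.End.mul_apply, map_sub, map_add, map_smul, hX, hY]
  · rw [qSerre_two hq, qSerre_two hq]
    simp only [LinearMap.sub_apply, LinearMap.add_apply, LinearMap.smul_apply,
      Module.End.mul_apply, map_sub, map_add, map_smul, hX, hY]

/-- The operators of the `q`-oscillator representation satisfy the defining relations. -/
theorem opRelations {q : 𝕜} (hq : IsGeneric q) {n : ℕ} (hn : 2 ≤ n) (x : 𝕜ˣ) :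
    UqRelations q n (opE q x) (opF q x) (opK q) (opKinv q (n := n)) where
  k_mul_kinv i := by
    refine Finsupp.lhom_ext fun m c => ?_
    simp only [Module.End.mul_apply, Module.End.one_apply, opK, opKinv,
      Finsupp.linearCombination_single, Finsupp.smul_single, smul_eq_mul, mul_one, mul_assoc]
    rw [← zpow_add₀ hq.1, neg_add_cancel, zpow_zero, mul_one]
  kinv_mul_k i := by
    refine Finsupp.lhom_ext fun m c => ?_
    simp only [Module.End.mul_apply, Module.End.one_apply, opK, opKinv,
      Finsupp.linearCombination_single, Finsupp.smul_single, smul_eq_mul, mul_one, mul_assoc]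
    rw [← zpow_add₀ hq.1, add_neg_cancel, zpow_zero, mul_one]
  k_comm i j := by
    refine Finsupp.lhom_ext fun m c => ?_
    simp only [Module.End.mul_apply, opK,
      Finsupp.linearCombination_single, Finsupp.smul_single, smul_eq_mul, mul_one, mul_assoc]
    congr 2
    exact mul_comm _ _
  k_e i j := by
    refine LinearMap.ext fun v => toZ_injective 𝕜 n ?_
    have := LinearMap.congr_fun (zDiag_zOp hq i j (rootVec j) (if j = 0 then (x : 𝕜) else 1))
      (toZ 𝕜 n v)
    rw [neg_rootVec_cartan] at this
    simpa [toZ_opE, toZ_opK, toZ_opKinv] using this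
  k_f i j := by
    refine LinearMap.ext fun v => toZ_injective 𝕜 n ?_
    have := LinearMap.congr_fun (zDiag_zOp hq i (j + 1) (-rootVec j)
      (if j = 0 then (x : 𝕜)⁻¹ else 1)) (toZ 𝕜 n v)
    rw [Pi.neg_apply, Pi.neg_apply, ← neg_add, neg_rootVec_cartan] at this
    simpa [toZ_opF, toZ_opK, toZ_opKinv] using this
  e_f i j := by
    refine LinearMap.ext fun v => toZ_injective 𝕜 n ?_
    by_cases hij : i = j
    · subst hij
      have := LinearMap.congr_fun (zOp_comm_self hq hn i (ξ := if i = 0 then (x : 𝕜) else 1)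
        (ξ' := if i = 0 then (x : 𝕜)⁻¹ else 1) (by split_ifs <;> simp)) (toZ 𝕜 n v)
      rw [if_pos rfl]
      simpa only [toZ_opE, toZ_opF, toZ_opK, toZ_opKinv, LinearMap.sub_apply,
        LinearMap.smul_apply, Module.End.mul_apply, map_sub, map_smul] using this
    · have := LinearMap.congr_fun (zOp_comm_ne (q := q) hij (if i = 0 then (x : 𝕜) else 1)
        (if j = 0 then (x : 𝕜)⁻¹ else 1)) (toZ 𝕜 n v)
      rw [if_neg hij]
      simpa only [toZ_opE, toZ_opF, LinearMap.sub_apply, LinearMap.zero_apply,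
        Module.End.mul_apply, map_sub, map_zero] using this
  serre_e i j hij := by
    refine LinearMap.ext fun v => toZ_injective 𝕜 n ?_
    have h1 := (rootVec_of_ne hij).1
    have h2 := (rootVec_of_ne hij.symm).1
    have := LinearMap.congr_fun (zOp_serre hq (p := i) (p' := j) (s := rootVec i)
      (s' := rootVec j) (if i = 0 then (x : 𝕜) else 1) (if j = 0 then (x : 𝕜) else 1)
      (rootVec_self hn i).1 (by rw [h1]; split_ifs <;> simp)
      (by rw [h2]; split_ifs <;> simp)) (toZ 𝕜 n v)
    rw [show -(rootVec j i + rootVec i j) = cartan n i j by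
      rw [h1, h2, cartan, if_neg hij]; ring] at this
    exact toZ_qSerre hq (cartan_ne hij) (toZ_opE q x i) (toZ_opE q x j) this
  serre_f i j hij := by
    refine LinearMap.ext fun v => toZ_injective 𝕜 n ?_
    have h1 := (rootVec_of_ne hij).2
    have h2 := (rootVec_of_ne hij.symm).2
    have := LinearMap.congr_fun (zOp_serre hq (p := i + 1) (p' := j + 1) (s := -rootVec i)
      (s' := -rootVec j) (if i = 0 then (x : 𝕜)⁻¹ else 1) (if j = 0 then (x : 𝕜)⁻¹ else 1)
      (by rw [Pi.neg_apply, (rootVec_self hn i).2])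
      (by rw [Pi.neg_apply, h1]; split_ifs <;> simp)
      (by rw [Pi.neg_apply, h2]; split_ifs <;> simp)) (toZ 𝕜 n v)
    rw [show -((-rootVec j) (i + 1) + (-rootVec i) (j + 1)) = cartan n i j by
      rw [Pi.neg_apply, Pi.neg_apply, h1, h2, cartan, if_neg hij]; ring] at this
    exact toZ_qSerre hq (cartan_ne hij) (toZ_opF q x i) (toZ_opF q x j) this

/-- The `q`-oscillator representation `π_x` of `U_q(A^{(1)}_{n-1})` on `V_x = F^{⊗n}`. -/
def rep {q : 𝕜} (hq : IsGeneric q) {n : ℕ} (hn : 2 ≤ n) (x : 𝕜ˣ) :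
    Uq q n →ₐ[𝕜] Module.End 𝕜 (Fock 𝕜 n) :=
  Uq.lift (opRelations hq hn x)

/-- The component `V_{x,l}` of `V_x`, spanned by the `|m⟩` with `|m| = m_1 + ⋯ + m_n = l`. -/
def level (𝕜 : Type*) [Field 𝕜] (n : ℕ) [NeZero n] (l : ℕ) : Submodule 𝕜 (Fock 𝕜 n) :=
  Finsupp.supported 𝕜 𝕜 {m | ∑ r, m r = l}

theorem ket_mem_level {n : ℕ} [NeZero n] {l : ℕ} {m : ZMod n → ℕ} (h : ∑ r, m r = l) :
    ket 𝕜 m ∈ level 𝕜 n l :=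
  Finsupp.single_mem_supported 𝕜 _ h

theorem level_of_ket {n : ℕ} [NeZero n] {l : ℕ} (g : (ZMod n → ℕ) → Fock 𝕜 n)
    (hg : ∀ m, ∑ r, m r = l → g m ∈ level 𝕜 n l) {v : Fock 𝕜 n} (hv : v ∈ level 𝕜 n l) :
    Finsupp.linearCombination 𝕜 g v ∈ level 𝕜 n l := by
  rw [Finsupp.linearCombination_apply]
  refine Submodule.sum_mem _ fun m hm => Submodule.smul_mem _ _ (hg m ?_)
  exact (Finsupp.mem_supported 𝕜 v).1 hv hm

theorem shift_mem_level (q : 𝕜) {n : ℕ} [NeZero n] {l : ℕ} (m : ZMod n → ℕ)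
    (hm : ∑ r, m r = l) (a b : ZMod n) (ξ : 𝕜) :
    (ξ * qInt q (m a)) • ket 𝕜 (m - Pi.single a 1 + Pi.single b 1) ∈ level 𝕜 n l := by
  by_cases h : m a = 0
  · simp [h, qInt_zero]
  · refine Submodule.smul_mem _ _ (ket_mem_level ?_)
    have hle : ∀ r ∈ Finset.univ, (Pi.single a 1 : ZMod n → ℕ) r ≤ m r := by
      intro r _
      rw [Pi.single_apply]
      split_ifs with hr
      · subst hr; omega
      · simp
    simp only [Pi.add_apply, Pi.sub_apply, Finset.sum_add_distrib]
    rw [Finset.sum_tsub_distrib _ hle, hm]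
    have h1 : ∑ r, (Pi.single a 1 : ZMod n → ℕ) r = 1 := by simp
    have h2 : ∑ r, (Pi.single b 1 : ZMod n → ℕ) r = 1 := by simp
    have h3 : m a ≤ l := hm ▸ Finset.single_le_sum (f := m) (by simp) (Finset.mem_univ a)
    rw [h1, h2]
    omega

/-- Each `V_{x,l}` is a submodule of `V_x`. -/
theorem rep_mem_level {q : 𝕜} (hq : IsGeneric q) {n : ℕ} [NeZero n] (hn : 2 ≤ n) (x : 𝕜ˣ)
    (l : ℕ) (g : Uq q n) : ∀ v ∈ level 𝕜 n l, rep hq hn x g v ∈ level 𝕜 n l := by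
  obtain ⟨a, rfl⟩ := RingQuot.mkAlgHom_surjective 𝕜 (UqRel q n) g
  change ∀ v ∈ level 𝕜 n l, Uq.lift (opRelations hq hn x) (Uq.mk q n a) v ∈ level 𝕜 n l
  rw [Uq.lift_mk]
  induction a using FreeAlgebra.induction with
  | grade0 r =>
    intro v hv
    rw [AlgHom.commutes]
    exact Submodule.smul_mem _ _ hv
  | grade1 g =>
    intro v hv
    rw [FreeAlgebra.lift_ι_apply]
    cases g with
    | e j => exact level_of_ket _ (fun m hm => shift_mem_level q m hm _ _ _) hv
    | f j => exact level_of_ket _ (fun m hm => shift_mem_level q m hm _ _ _) hv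
    | k j =>
      exact level_of_ket _ (fun m hm => Submodule.smul_mem _ _ (ket_mem_level hm)) hv
    | kinv j =>
      exact level_of_ket _ (fun m hm => Submodule.smul_mem _ _ (ket_mem_level hm)) hv
  | mul a b ha hb =>
    intro v hv
    rw [map_mul]
    exact ha _ (hb v hv)
  | add a b ha hb =>
    intro v hv
    rw [map_add]
    exact Submodule.add_mem _ (ha v hv) (hb v hv)

/-- The representation of `U_q(A^{(1)}_{n-1})` on `V_{x,l}`. -/
def repLevel {q : 𝕜} (hq : IsGeneric q) {n : ℕ} [NeZero n] (hn : 2 ≤ n) (x : 𝕜ˣ) (l : ℕ) :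
    Uq q n →ₐ[𝕜] Module.End 𝕜 (level 𝕜 n l) :=
  AlgHom.ofLinearMap
    { toFun := fun g => (rep hq hn x g).restrict (rep_mem_level hq hn x l g)
      map_add' := fun a b => by ext1 v; apply Subtype.ext; simp
      map_smul' := fun c a => by ext1 v; apply Subtype.ext; simp }
    (by ext1 v; apply Subtype.ext; simp)
    (fun a b => by ext1 v; apply Subtype.ext; simp)

/-- The vector `|l e_n⟩ ∈ V_{x,l}` (the site `n` is `0` modulo `n`). -/
def topKet (𝕜 : Type*) [Field 𝕜] (n : ℕ) [NeZero n] (l : ℕ) : level 𝕜 n l :=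
  ⟨ket 𝕜 (Pi.single (n : ZMod n) l), ket_mem_level (by simp)⟩

/-- The action of an element of `U_q ⊗ U_q` on `V_{x,m} ⊗ V_{y,l}`. -/
def repTensor {q : 𝕜} (hq : IsGeneric q) {n : ℕ} [NeZero n] (hn : 2 ≤ n) (x y : 𝕜ˣ) (m l : ℕ) :
    Uq q n ⊗[𝕜] Uq q n →ₐ[𝕜] Module.End 𝕜 (level 𝕜 n m ⊗[𝕜] level 𝕜 n l) :=
  (Module.endTensorEndAlgHom (R := 𝕜) (A := 𝕜)).comp
    (Algebra.TensorProduct.map (repLevel hq hn x m) (repLevel hq hn y l))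

/-- `R` is the quantum `R` matrix `R_{m,l}(x/y)` on `V_{x,m} ⊗ V_{y,l}`: it satisfies
`Δ'(g) R = R Δ(g)` for all `g ∈ U_q`, and, with `z = x/y`,
`R (|m e_n⟩ ⊗ |l e_n⟩) = z^l (q^{m-l+2} z^{-1}; q²)_l / (q^{m-l} z; q²)_{l+1} |m e_n⟩ ⊗ |l e_n⟩`. -/
structure IsQuantumR {q : 𝕜} (hq : IsGeneric q) {n : ℕ} [NeZero n] (hn : 2 ≤ n) (x y : 𝕜ˣ)
    (m l : ℕ) (R : Module.End 𝕜 (level 𝕜 n m ⊗[𝕜] level 𝕜 n l)) : Prop where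
  intertwines : ∀ g : Uq q n,
    repTensor hq hn x y m l (Uq.comulOp hq n g) * R
      = R * repTensor hq hn x y m l (Uq.comul hq n g)
  normalized : R (topKet 𝕜 n m ⊗ₜ[𝕜] topKet 𝕜 n l)
    = ((x / y : 𝕜) ^ l * qPoch (q ^ ((m : ℤ) - l + 2) * (x / y : 𝕜)⁻¹) (q ^ 2) l
        / qPoch (q ^ ((m : ℤ) - l) * (x / y : 𝕜)) (q ^ 2) (l + 1)) •
      (topKet 𝕜 n m ⊗ₜ[𝕜] topKet 𝕜 n l)

/-- The direct sum `⨁_{m,l} R_{m,l}` of endomorphisms of the components `V_m ⊗ V_l`, as an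
endomorphism of `F^{⊗n} ⊗ F^{⊗n}`: on `|i⟩ ⊗ |j⟩` it acts as `R_{|i|,|j|}`. -/
def directSumR {n : ℕ} [NeZero n]
    (R : ∀ m l : ℕ, Module.End 𝕜 (level 𝕜 n m ⊗[𝕜] level 𝕜 n l)) :
    Module.End 𝕜 (Fock 𝕜 n ⊗[𝕜] Fock 𝕜 n) :=
  TensorProduct.lift <| Finsupp.lift _ 𝕜 _ fun i => Finsupp.linearCombination 𝕜 fun j =>
    TensorProduct.map (level 𝕜 n (∑ r, i r)).subtype (level 𝕜 n (∑ r, j r)).subtype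
      (R (∑ r, i r) (∑ r, j r)
        (⟨ket 𝕜 i, ket_mem_level rfl⟩ ⊗ₜ[𝕜] ⟨ket 𝕜 j, ket_mem_level rfl⟩))

end Representation

/-! ### The 3d `R` and its trace reduction -/

section TraceReduction

variable {K : Type*} [Field K]

/-- The matrix element `R^{a,b,c}_{i,j,k}` of the 3d `R`. -/
def threeDR (q : K) (a b c i j k : ℕ) : K :=
  if a + b = i + j ∧ b + c = j + k then
    ∑ p ∈ Finset.HasAntidiagonal.antidiagonal b,
      (-1) ^ p.1 * q ^ ((i : ℤ) * ((c : ℤ) - j) + ((k : ℤ) + 1) * p.1 + p.2 * ((p.2 : ℤ) - k))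
        * (qPoch (q ^ 2) (q ^ 2) (c + p.2) / qPoch (q ^ 2) (q ^ 2) c)
        * qBinom (q ^ 2) i p.2 * qBinom (q ^ 2) j p.1
  else 0

/-- Labels of the basis vectors `|i⟩ ⊗ |j⟩ ⊗ |k⟩` of `F^{⊗n} ⊗ F^{⊗n} ⊗ F`. -/
abbrev Idx (n : ℕ) := (ZMod n → ℕ) × (ZMod n → ℕ) × ℕ

/-- The operator `R_{α_r, β_r, 3}` on `F^{⊗n} ⊗ F^{⊗n} ⊗ F`: the 3d `R` acting on the
`r`-th component of the first factor, the `r`-th component of the second factor and the third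
factor. The sum runs over all `a, b, c` allowed by the conservation law. -/
def siteR (q : K) {n : ℕ} (r : ZMod n) : Module.End K (Idx n →₀ K) :=
  Finsupp.linearCombination K fun t : Idx n =>
    ∑ a ∈ Finset.range (t.1 r + t.2.1 r + 1), ∑ b ∈ Finset.range (t.1 r + t.2.1 r + 1),
      ∑ c ∈ Finset.range (t.2.1 r + t.2.2 + 1),
        Finsupp.single (Function.update t.1 r a, Function.update t.2.1 r b, c)
          (threeDR q a b c (t.1 r) (t.2.1 r) t.2.2)

/-- The product `R_{α_1, β_1, 3} R_{α_2, β_2, 3} ⋯ R_{α_n, β_n, 3}`. -/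
def monodromy (q : K) (n : ℕ) : Module.End K (Idx n →₀ K) :=
  ((List.range n).map fun r => siteR q ((r + 1 : ℕ) : ZMod n)).prod

/-- The matrix element `S^{tr}(z)^{a,b}_{i,j}` of
`Tr_3 (z^{h_3} R_{α_1, β_1, 3} ⋯ R_{α_n, β_n, 3})`, a formal power series in `z`: the
coefficient of `z^c` is the contribution of the vector `|c⟩` of the third factor to the trace. -/
def trEntry (q : K) {n : ℕ} (a b i j : ZMod n → ℕ) : PowerSeries K :=
  PowerSeries.mk fun c => monodromy q n (Finsupp.single (i, j, c) 1) (a, b, c)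

theorem siteR_conserves (q : K) {n : ℕ} (r : ZMod n) (s : ZMod n → ℕ) (v : Idx n →₀ K)
    (hv : v ∈ Finsupp.supported K K {t : Idx n | t.1 + t.2.1 = s}) :
    siteR q r v ∈ Finsupp.supported K K {t : Idx n | t.1 + t.2.1 = s} := by
  rw [siteR, Finsupp.linearCombination_apply]
  refine Submodule.sum_mem _ fun t ht => Submodule.smul_mem _ _ ?_
  have ht' : t.1 + t.2.1 = s := (Finsupp.mem_supported K v).1 hv ht
  refine Submodule.sum_mem _ fun a _ => Submodule.sum_mem _ fun b _ =>
    Submodule.sum_mem _ fun c _ => ?_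
  by_cases h : a + b = t.1 r + t.2.1 r
  · refine Finsupp.single_mem_supported K _ ?_
    change Function.update t.1 r a + Function.update t.2.1 r b = s
    rw [← ht']
    funext r'
    by_cases hr : r' = r
    · subst hr; simp [h]
    · simp [Function.update_of_ne hr]
  · have : threeDR q a b c (t.1 r) (t.2.1 r) t.2.2 = 0 := if_neg fun h' => h h'.1
    rw [this, Finsupp.single_zero]
    exact Submodule.zero_mem _

/-- The conservation law: `S^{tr}(z)^{a,b}_{i,j} = 0` unless `a + b = i + j`. -/
theorem trEntry_eq_zero (q : K) {n : ℕ} {a b i j : ZMod n → ℕ} (h : a + b ≠ i + j) :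
    trEntry q a b i j = 0 := by
  have key : ∀ (L : List (ZMod n)) (v : Idx n →₀ K),
      v ∈ Finsupp.supported K K {t : Idx n | t.1 + t.2.1 = i + j} →
      (L.map (siteR q)).prod v ∈ Finsupp.supported K K {t : Idx n | t.1 + t.2.1 = i + j} := by
    intro L
    induction L with
    | nil => intro v hv; simpa using hv
    | cons r L ih =>
      intro v hv
      rw [List.map_cons, List.prod_cons]
      exact siteR_conserves q r _ _ (ih v hv)
  ext c
  rw [trEntry, PowerSeries.coeff_mk, map_zero]
  have h1 := key ((List.range n).map fun r => ((r + 1 : ℕ) : ZMod n)) (Finsupp.single (i, j, c) 1)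
    (Finsupp.single_mem_supported K _ rfl)
  rw [List.map_map] at h1
  by_contra h2
  exact h ((Finsupp.mem_supported K _).1 h1 (Finsupp.mem_support_iff.2 h2))

/-- The trace reduction `S^{tr}(z)`, acting on `F^{⊗n} ⊗ F^{⊗n}` over the field `K((z))`:
`S^{tr}(z) (|i⟩ ⊗ |j⟩) = ∑_{a,b} S^{tr}(z)^{a,b}_{i,j} |a⟩ ⊗ |b⟩`. By the conservation law it
suffices to sum over `a, b ≤ i + j`. -/
def traceS (q : K) (n : ℕ) [NeZero n] :
    Module.End (LaurentSeries K)
      (Fock (LaurentSeries K) n ⊗[LaurentSeries K] Fock (LaurentSeries K) n) :=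
  TensorProduct.lift <| Finsupp.lift _ (LaurentSeries K) _ fun i =>
    Finsupp.linearCombination (LaurentSeries K) fun j =>
      ∑ a ∈ Finset.Icc 0 (i + j), ∑ b ∈ Finset.Icc 0 (i + j),
        (trEntry q a b i j : LaurentSeries K) •
          (ket (LaurentSeries K) a ⊗ₜ[LaurentSeries K] ket (LaurentSeries K) b)

/-- The formal variable `z`, as an element of `K((z))`. -/
def zVar (K : Type*) [Field K] : LaurentSeries K := HahnSeries.single 1 1

/-- A generic `q ∈ K` stays generic in `K((z))`. -/
theorem IsGeneric.laurent {q : K} (hq : IsGeneric q) :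
    IsGeneric (HahnSeries.C q : LaurentSeries K) := by
  refine ⟨by simpa using hq.1, fun N hN h => hq.2 N hN ?_⟩
  rw [← map_pow] at h
  exact HahnSeries.C_injective (h.trans (map_one _).symm)

end TraceReduction

end TraceReduction

end

/-! On three commuting `q`-oscillators the 3d `R` is governed by two operators `X` and `Y`. Up to
the factor `q ^ (i * j)`, the vector |i,j,k⟩ arises from |0,0,k⟩ by applying `j` times the second
creation operator and then `i` times the first one dressed by the second number operator. `R` sends
it to `q ^ (-i * j)` times `X ^ i * Y ^ j` applied to |0,0,k⟩: each of `X`, `Y` is a sum of two `q ^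
2`-commuting terms, and the noncommutative `q`-binomial theorem yields exactly the given matrix
elements (`siteR_single`). Hence `R` fixes the vectors vacuous in the first two factors and
intertwines the two dressed creation operators with `Y` and `X`. Every further intertwining relation
then needs checking only on vacuum vectors (`IsThreeDR.intertwines_of_vac`), and these relations
come in mutually inverse pairs.

Up to a diagonal factor, the coproduct of `e_r` or `f_r` is a sum of two products of oscillators at
the sites `r` and `r + 1`. The operator of one site turns such an oscillator into terms containing
an oscillator of the third factor, and the operator of the other site absorbs it
(`SiteExchange.interior`). The sites `n` and `1` stand at opposite ends of the monodromy; there the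
oscillator of the third factor travels around the trace, and passing `z ^ h` produces the spectral
parameter (`SiteExchange.wrap`). The `k_r` commute with the trace by conservation of the occupation
of each site. Together this gives `traceS_intertwines`. A second conservation law shows that both
total degrees are preserved, so `S^{tr}` splits into the blocks `traceSLevel`.

On the top vectors all sites but one are vacuous, and the trace reduces to a sum over `c` of
diagonal elements of a single 3d `R`. It is a finite combination of `q`-binomial series, evaluated
by `qBinom_series` and a Vandermonde-type expansion (`sum_antidiagonal_qPoch`).

Uniqueness is a `z`-adic argument and does not use irreducibility. The difference of two solutions
kills the top vector. If all its matrix elements lie in `z ^ w K[[z]]`, the intertwining relations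
move this vanishing from the top vector to all vectors, at the cost of error terms divisible by `z ^
(w + 1)` (`IsNullIntertwiner.mem_succ`). Iterating, the difference is zero. -/

noncomputable section

namespace TraceReduction

/-! ### `q`-oscillators -/

section Oscillators

variable {K E : Type*} [Field K] [Ring E] [Algebra K E]

/-- A `q`-oscillator in an algebra: a creation operator `p`, an annihilation operator `m` and a
number operator `k`. -/
structure Oscillator (K : Type*) [Field K] (q : K) (E : Type*) [Ring E] [Algebra K E] where
  /-- creation operator -/
  p : E
  /-- annihilation operator -/
  m : E
  /-- number operator `q^N` -/
  k : E
  p_k : p * k = q⁻¹ • (k * p)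
  m_k : m * k = q • (k * m)
  p_m : p * m = 1 - k * k
  m_p : m * p = 1 - q ^ 2 • (k * k)

/-- Two `q`-oscillators commute with each other. -/
structure Oscillator.Commutes {q : K} (A B : Oscillator K q E) : Prop where
  cpp : B.p * A.p = A.p * B.p
  cpm : B.p * A.m = A.m * B.p
  cpk : B.p * A.k = A.k * B.p
  cmp : B.m * A.p = A.p * B.m
  cmm : B.m * A.m = A.m * B.m
  cmk : B.m * A.k = A.k * B.m
  ckp : B.k * A.p = A.p * B.k
  ckm : B.k * A.m = A.m * B.k
  ckk : B.k * A.k = A.k * B.k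

/-- Lets a rewriting rule for `x * y` fire inside a right-associated word. -/
theorem mul_mul_of_mul_eq {x y z : E} (h : x * y = z) (t : E) : x * (y * t) = z * t := by
  rw [← mul_assoc, h]

/-- Three mutually commuting `q`-oscillators. -/
structure OscillatorTriple (K : Type*) [Field K] (q : K) (E : Type*) [Ring E]
    [Algebra K E] where
  /-- first oscillator -/
  A : Oscillator K q E
  /-- second oscillator -/
  B : Oscillator K q E
  /-- third oscillator -/
  C : Oscillator K q E
  hAB : A.Commutes B
  hAC : A.Commutes C
  hBC : B.Commutes C

namespace OscillatorTriple

variable {q : K} (T : OscillatorTriple K q E)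

/-- The operator `X` with `R (k_2 a_1^+) = X R`. -/
def X : E := T.C.k * T.A.p + T.A.k * T.B.p * T.C.m
/-- The operator `Y` with `R a_2^+ = Y R`. -/
def Y : E := T.A.p * T.C.p - q • (T.A.k * T.C.k * T.B.p)
/-- The operator `Z` with `R (k_2 a_3^+) = Z R`. -/
def Z : E := T.A.k * T.C.p + T.C.k * T.A.m * T.B.p
/-- The operator `Xb` with `R (k_2 a_1^-) = Xb R`. -/
def Xb : E := T.C.k * T.A.m + T.A.k * T.B.m * T.C.p
/-- The operator `Yb` with `R a_2^- = Yb R`. -/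
def Yb : E := T.A.m * T.C.m - q • (T.A.k * T.C.k * T.B.m)
/-- The operator `Zb` with `R (k_2 a_3^-) = Zb R`. -/
def Zb : E := T.A.k * T.C.m + T.C.k * T.A.p * T.B.m

/-- The algebra relations among the operators `X`, `Y`, `Z`, `Xb`, `Yb`, `Zb`, and
their commutation with the oscillators. -/
structure Relations : Prop where
  X_Y : T.X * T.Y = q • (T.Y * T.X)
  Z_Y : T.Z * T.Y = q • (T.Y * T.Z)
  Z_X : T.Z * T.X = T.X * T.Z
  Xb_Y : T.Xb * T.Y = q • (T.Y * T.Xb)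
  Xb_X : T.Xb * T.X = T.X * T.Xb + (1 - q ^ 2) • ((T.A.k * T.B.k) * (T.A.k * T.B.k))
  Yb_Y : T.Yb * T.Y = q ^ 2 • (T.Y * T.Yb) + (1 - q ^ 2) • 1
  Yb_X : T.Yb * T.X = q • (T.X * T.Yb)
  kp_p : T.B.k * T.C.p * T.B.p = q • (T.B.p * (T.B.k * T.C.p))
  kp_kp : T.B.k * T.C.p * (T.B.k * T.A.p) = T.B.k * T.A.p * (T.B.k * T.C.p)
  kam_p : T.B.k * T.A.m * T.B.p = q • (T.B.p * (T.B.k * T.A.m))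
  kam_kp : T.B.k * T.A.m * (T.B.k * T.A.p)
    = T.B.k * T.A.p * (T.B.k * T.A.m) + (1 - q ^ 2) • ((T.A.k * T.B.k) * (T.A.k * T.B.k))
  m_p : T.B.m * T.B.p = q ^ 2 • (T.B.p * T.B.m) + (1 - q ^ 2) • 1
  m_kp : T.B.m * (T.B.k * T.A.p) = q • (T.B.k * T.A.p * T.B.m)
  kk_p : T.A.k * T.B.k * T.B.p = q • (T.B.p * (T.A.k * T.B.k))
  kk_kp : T.A.k * T.B.k * (T.B.k * T.A.p) = q • (T.B.k * T.A.p * (T.A.k * T.B.k))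
  kk_Y : T.A.k * T.B.k * T.Y = q • (T.Y * (T.A.k * T.B.k))
  kk_X : T.A.k * T.B.k * T.X = q • (T.X * (T.A.k * T.B.k))
  kkC_p : T.B.k * T.C.k * T.B.p = q • (T.B.p * (T.B.k * T.C.k))
  kkC_kp : T.B.k * T.C.k * (T.B.k * T.A.p) = T.B.k * T.A.p * (T.B.k * T.C.k)
  kkC_Y : T.B.k * T.C.k * T.Y = q • (T.Y * (T.B.k * T.C.k))
  kkC_X : T.B.k * T.C.k * T.X = T.X * (T.B.k * T.C.k)
  Y_p : T.Y * T.B.p = T.B.p * T.Y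
  Y_kp : T.Y * (T.B.k * T.A.p) = T.B.k * T.A.p * T.Y
  X_p : T.X * T.B.p = T.B.p * T.X
  X_kp : T.X * (T.B.k * T.A.p) = T.B.k * T.A.p * T.X
  Zb_p : T.Zb * T.B.p = T.B.p * T.Zb + (1 - q ^ 2) • ((T.B.k * T.C.k) * (T.B.k * T.A.p))
  km_Y : T.B.k * T.C.m * T.Y = T.Y * (T.B.k * T.C.m) + (1 - q ^ 2) • ((T.B.k * T.C.k) * T.X)
  Zb_kp : T.Zb * (T.B.k * T.A.p) = q • (T.B.k * T.A.p * T.Zb)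
  km_X : T.B.k * T.C.m * T.X = q • (T.X * (T.B.k * T.C.m))
  Xb_p : T.Xb * T.B.p = T.B.p * T.Xb + (1 - q ^ 2) • ((T.A.k * T.B.k) * (T.B.k * T.C.p))
  kam_Y : T.B.k * T.A.m * T.Y = T.Y * (T.B.k * T.A.m) + (1 - q ^ 2) • ((T.A.k * T.B.k) * T.Z)
  Xb_kp : T.Xb * (T.B.k * T.A.p)
    = q ^ 2 • (T.B.k * T.A.p * T.Xb) + (1 - q ^ 2) • (T.B.k * T.C.k)
  kam_X : T.B.k * T.A.m * T.X = q ^ 2 • (T.X * (T.B.k * T.A.m)) + (1 - q ^ 2) • (T.B.k * T.C.k)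
  Yb_p : T.Yb * T.B.p
    = T.B.p * T.Yb - (q * (1 - q ^ 2)) • ((T.A.k * T.B.k) * (T.B.k * T.C.k))
  m_Y : T.B.m * T.Y = T.Y * T.B.m - (q * (1 - q ^ 2)) • ((T.A.k * T.B.k) * (T.B.k * T.C.k))
  Yb_kp : T.Yb * (T.B.k * T.A.p)
    = T.B.k * T.A.p * T.Yb + (1 - q ^ 2) • ((T.A.k * T.B.k) * T.Zb)
  m_X : T.B.m * T.X = T.X * T.B.m + (1 - q ^ 2) • ((T.A.k * T.B.k) * (T.B.k * T.C.m))

set_option maxHeartbeats 1000000 in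
set_option linter.unusedSimpArgs false in
-- Both sides are brought to normal order: the letters of `A`, `B`, `C` are sorted in this sequence,
-- `k` stands to the left of `p` and `m`, and every adjacent pair of `p` and `m` of one oscillator
-- is replaced by a polynomial in `k`. Coefficients of equal words are then compared.
theorem relations (hq : q ≠ 0) : T.Relations := by
  obtain ⟨A, B, C, hAB, hAC, hBC⟩ := T
  constructor <;>
  simp only [X, Y, Z, Xb, Yb, Zb, mul_add, add_mul, mul_sub, sub_mul, mul_assoc, one_mul,
    mul_one, smul_mul_assoc, mul_smul_comm, smul_add, smul_sub, smul_smul,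
    A.p_k, A.m_k, A.p_m, A.m_p, B.p_k, B.m_k, B.p_m, B.m_p, C.p_k, C.m_k, C.p_m, C.m_p,
    mul_mul_of_mul_eq A.p_k, mul_mul_of_mul_eq A.m_k, mul_mul_of_mul_eq A.p_m,
    mul_mul_of_mul_eq A.m_p, mul_mul_of_mul_eq B.p_k, mul_mul_of_mul_eq B.m_k,
    mul_mul_of_mul_eq B.p_m, mul_mul_of_mul_eq B.m_p, mul_mul_of_mul_eq C.p_k,
    mul_mul_of_mul_eq C.m_k, mul_mul_of_mul_eq C.p_m, mul_mul_of_mul_eq C.m_p,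
    hAB.cpp, hAB.cpm, hAB.cpk, hAB.cmp, hAB.cmm, hAB.cmk, hAB.ckp, hAB.ckm, hAB.ckk,
    hAC.cpp, hAC.cpm, hAC.cpk, hAC.cmp, hAC.cmm, hAC.cmk, hAC.ckp, hAC.ckm, hAC.ckk,
    hBC.cpp, hBC.cpm, hBC.cpk, hBC.cmp, hBC.cmm, hBC.cmk, hBC.ckp, hBC.ckm, hBC.ckk,
    mul_mul_of_mul_eq hAB.cpp, mul_mul_of_mul_eq hAB.cpm, mul_mul_of_mul_eq hAB.cpk,
    mul_mul_of_mul_eq hAB.cmp, mul_mul_of_mul_eq hAB.cmm, mul_mul_of_mul_eq hAB.cmk,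
    mul_mul_of_mul_eq hAB.ckp, mul_mul_of_mul_eq hAB.ckm, mul_mul_of_mul_eq hAB.ckk,
    mul_mul_of_mul_eq hAC.cpp, mul_mul_of_mul_eq hAC.cpm, mul_mul_of_mul_eq hAC.cpk,
    mul_mul_of_mul_eq hAC.cmp, mul_mul_of_mul_eq hAC.cmm, mul_mul_of_mul_eq hAC.cmk,
    mul_mul_of_mul_eq hAC.ckp, mul_mul_of_mul_eq hAC.ckm, mul_mul_of_mul_eq hAC.ckk,
    mul_mul_of_mul_eq hBC.cpp, mul_mul_of_mul_eq hBC.cpm, mul_mul_of_mul_eq hBC.cpk,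
    mul_mul_of_mul_eq hBC.cmp, mul_mul_of_mul_eq hBC.cmm, mul_mul_of_mul_eq hBC.cmk,
    mul_mul_of_mul_eq hBC.ckp, mul_mul_of_mul_eq hBC.ckm, mul_mul_of_mul_eq hBC.ckk] <;>
  match_scalars <;> field_simp <;> ring

end OscillatorTriple

end Oscillators

/-! ### The intertwining relations of the 3d `R` -/

section ThreeDR

variable {K V : Type*} [Field K] [AddCommGroup V] [Module K V] {q : K}

/-- An operator `R` on a module over three `q`-oscillators that fixes the vectors annihilated
by the first two annihilation operators and intertwines the first two creation operators with
`Y` and `X`; the module is generated from the vacuum vectors. -/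
structure IsThreeDR (T : OscillatorTriple K q (Module.End K V)) (R : Module.End K V)
    (vac : Submodule K V) : Prop where
  R_p : R * T.B.p = T.Y * R
  R_kp : R * (T.B.k * T.A.p) = T.X * R
  R_vac : ∀ v ∈ vac, R v = v
  Am_vac : ∀ v ∈ vac, T.A.m v = 0
  Bm_vac : ∀ v ∈ vac, T.B.m v = 0
  Ak_vac : ∀ v ∈ vac, T.A.k v = v
  Bk_vac : ∀ v ∈ vac, T.B.k v = v
  Cp_vac : ∀ v ∈ vac, T.C.p v ∈ vac
  Cm_vac : ∀ v ∈ vac, T.C.m v ∈ vac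
  Ck_vac : ∀ v ∈ vac, T.C.k v ∈ vac
  generated : ∀ D : Module.End K V, (∀ v, D v = 0 → D (T.B.p v) = 0) →
    (∀ v, D v = 0 → D ((T.B.k * T.A.p) v) = 0) → (∀ v ∈ vac, D v = 0) → D = 0

namespace IsThreeDR

variable {T : OscillatorTriple K q (Module.End K V)} {R : Module.End K V} {vac : Submodule K V}

/-- Intertwining relations can be checked on the vacuum vectors. -/
theorem intertwines_of_vac (h : IsThreeDR T R vac) {U W : Module.End K V} {b a : K}
    (hb : (R * U - W * R) * T.B.p = b • (T.Y * (R * U - W * R)))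
    (ha : (R * U - W * R) * (T.B.k * T.A.p) = a • (T.X * (R * U - W * R)))
    (hv : ∀ v ∈ vac, R (U v) = W v) : R * U = W * R := by
  -- The kernel of `R * U - W * R` is stable under both generators by `hb` and `ha`, and contains
  -- the vacuum vectors by `hv`; hence it is everything.
  refine sub_eq_zero.1 (h.generated _ (fun v hv' => ?_) (fun v hv' => ?_) fun v hv' => ?_)
  · rw [← Module.End.mul_apply, hb, LinearMap.smul_apply, Module.End.mul_apply, hv', map_zero,
      smul_zero]
  · rw [← Module.End.mul_apply, ha, LinearMap.smul_apply, Module.End.mul_apply, hv', map_zero,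
      smul_zero]
  · rw [LinearMap.sub_apply, Module.End.mul_apply, Module.End.mul_apply, hv v hv', h.R_vac v hv',
      sub_self]

/-- The corrections `d • P` and `d • P'` cancel because `R * P = P' * R` is already known. This
dictates the order of the relations below: the products of number operators come first, and `R_Yb`,
whose correction involves `Zb`, comes after `R_Zb`. -/
theorem sub_mul_eq {E : Type*} [Ring E] [Algebra K E] {R b y U W P P' : E} {c d : K}
    (h : R * b = y * R) (hU : U * b = c • (b * U) + d • P) (hW : W * y = c • (y * W) + d • P')
    (hP : R * P = P' * R) : (R * U - W * R) * b = c • (y * (R * U - W * R)) := by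
  rw [sub_mul, mul_assoc R, hU, mul_assoc W, h, ← mul_assoc W, hW, mul_add, mul_smul_comm,
    mul_smul_comm, hP, ← mul_assoc R, h, add_mul, smul_mul_assoc, smul_mul_assoc, mul_sub,
    smul_sub, mul_assoc, mul_assoc]
  abel

theorem sub_mul_eq' {E : Type*} [Ring E] [Algebra K E] {R b y U W : E} {c : K}
    (h : R * b = y * R) (hU : U * b = c • (b * U)) (hW : W * y = c • (y * W)) :
    (R * U - W * R) * b = c • (y * (R * U - W * R)) :=
  sub_mul_eq (c := c) (d := 0) (P := 0) (P' := 0) h (by simp [hU]) (by simp [hW]) (by simp)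

theorem R_kk (h : IsThreeDR T R vac) (hq : q ≠ 0) :
    R * (T.A.k * T.B.k) = T.A.k * T.B.k * R :=
  h.intertwines_of_vac (sub_mul_eq' h.R_p (T.relations hq).kk_p (T.relations hq).kk_Y)
    (sub_mul_eq' h.R_kp (T.relations hq).kk_kp (T.relations hq).kk_X) fun v hv => by
    rw [Module.End.mul_apply, h.Bk_vac v hv, h.Ak_vac v hv, h.R_vac v hv]

theorem R_kkC (h : IsThreeDR T R vac) (hq : q ≠ 0) :
    R * (T.B.k * T.C.k) = T.B.k * T.C.k * R :=
  h.intertwines_of_vac (sub_mul_eq' h.R_p (T.relations hq).kkC_p (T.relations hq).kkC_Y)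
    (sub_mul_eq' (c := 1) h.R_kp (by rw [one_smul, (T.relations hq).kkC_kp])
      (by rw [one_smul, (T.relations hq).kkC_X])) fun v hv => by
    rw [Module.End.mul_apply, h.Bk_vac _ (h.Ck_vac v hv), h.R_vac _ (h.Ck_vac v hv)]

theorem R_kp_C (h : IsThreeDR T R vac) (hq : q ≠ 0) :
    R * (T.B.k * T.C.p) = T.Z * R :=
  h.intertwines_of_vac (sub_mul_eq' h.R_p (T.relations hq).kp_p (T.relations hq).Z_Y)
    (sub_mul_eq' (c := 1) h.R_kp (by rw [one_smul, (T.relations hq).kp_kp])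
      (by rw [one_smul, (T.relations hq).Z_X])) fun v hv => by
    have e : T.A.m (T.B.p v) = T.B.p (T.A.m v) := (LinearMap.congr_fun T.hAB.cpm v).symm
    rw [Module.End.mul_apply, h.Bk_vac _ (h.Cp_vac v hv), h.R_vac _ (h.Cp_vac v hv), OscillatorTriple.Z,
      LinearMap.add_apply, Module.End.mul_apply, Module.End.mul_apply, Module.End.mul_apply,
      h.Ak_vac _ (h.Cp_vac v hv), e, h.Am_vac v hv, map_zero, map_zero, add_zero]

theorem R_km (h : IsThreeDR T R vac) (hq : q ≠ 0) :
    R * (T.B.k * T.A.m) = T.Xb * R :=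
  h.intertwines_of_vac (sub_mul_eq' h.R_p (T.relations hq).kam_p (T.relations hq).Xb_Y)
    (sub_mul_eq (c := 1) (d := 1 - q ^ 2) h.R_kp (by rw [one_smul, (T.relations hq).kam_kp])
      (by rw [one_smul, (T.relations hq).Xb_X])
      (by rw [← mul_assoc, h.R_kk hq, mul_assoc, h.R_kk hq, ← mul_assoc])) fun v hv => by
    have e : T.B.m (T.C.p v) = 0 := h.Bm_vac _ (h.Cp_vac v hv)
    simp only [OscillatorTriple.Xb, LinearMap.add_apply, Module.End.mul_apply, e, h.Am_vac v hv, map_zero, add_zero]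

theorem R_m (h : IsThreeDR T R vac) (hq : q ≠ 0) :
    R * T.B.m = T.Yb * R :=
  h.intertwines_of_vac
    (sub_mul_eq h.R_p (T.relations hq).m_p (T.relations hq).Yb_Y (by rw [mul_one, one_mul]))
    (sub_mul_eq' h.R_kp (T.relations hq).m_kp (T.relations hq).Yb_X) fun v hv => by
    have e : T.A.m (T.C.m v) = 0 := h.Am_vac _ (h.Cm_vac v hv)
    simp only [OscillatorTriple.Yb, LinearMap.sub_apply, LinearMap.smul_apply, Module.End.mul_apply, e,
      h.Bm_vac v hv, map_zero, smul_zero, sub_zero]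

theorem R_kp_vac (h : IsThreeDR T R vac) {v : V} (hv : v ∈ vac) : R (T.A.p v) = T.X v := by
  have e : T.B.k (T.A.p v) = T.A.p v := by
    rw [← Module.End.mul_apply, T.hAB.ckp, Module.End.mul_apply, h.Bk_vac v hv]
  have := LinearMap.congr_fun h.R_kp v
  rwa [Module.End.mul_apply, Module.End.mul_apply, Module.End.mul_apply, e, h.R_vac v hv] at this

theorem R_p_vac (h : IsThreeDR T R vac) {v : V} (hv : v ∈ vac) : R (T.B.p v) = T.Y v := by
  have := LinearMap.congr_fun h.R_p v
  rwa [Module.End.mul_apply, Module.End.mul_apply, h.R_vac v hv] at this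

theorem Ak_Bp_vac (h : IsThreeDR T R vac) {v : V} (hv : v ∈ vac) :
    T.A.k (T.B.p v) = T.B.p v := by
  rw [← Module.End.mul_apply, ← T.hAB.cpk, Module.End.mul_apply, h.Ak_vac v hv]

theorem X_vac (h : IsThreeDR T R vac) {v : V} (hv : v ∈ vac) :
    T.X v = T.A.p (T.C.k v) + T.B.p (T.C.m v) := by
  have e : T.C.k (T.A.p v) = T.A.p (T.C.k v) := LinearMap.congr_fun T.hAC.ckp v
  rw [OscillatorTriple.X, LinearMap.add_apply, Module.End.mul_apply, Module.End.mul_apply, Module.End.mul_apply, e,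
    h.Ak_Bp_vac (h.Cm_vac v hv)]

theorem Y_vac (h : IsThreeDR T R vac) {v : V} (hv : v ∈ vac) :
    T.Y v = T.A.p (T.C.p v) - q • T.B.p (T.C.k v) := by
  have e : T.C.k (T.B.p v) = T.B.p (T.C.k v) := LinearMap.congr_fun T.hBC.ckp v
  rw [OscillatorTriple.Y, LinearMap.sub_apply, LinearMap.smul_apply, Module.End.mul_apply, Module.End.mul_apply,
    Module.End.mul_apply, e, h.Ak_Bp_vac (h.Ck_vac v hv)]

/-- The converse of `R_kp`, reflecting that `R` behaves as an involution. On a vacuum vector the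
terms with `B.p` cancel because `C.m` and `C.k` commute up to `q`, and the terms with `A.p` add up
to a single one by `C.p_m`. In `R_Y` the roles of `A.p` and `B.p` are exchanged. -/
theorem R_X (h : IsThreeDR T R vac) (hq : q ≠ 0) :
    R * T.X = T.B.k * T.A.p * R :=
  h.intertwines_of_vac
    (sub_mul_eq' (c := 1) h.R_p (by rw [one_smul, (T.relations hq).X_p])
      (by rw [one_smul, (T.relations hq).Y_kp]))
    (sub_mul_eq' (c := 1) h.R_kp (by rw [one_smul, (T.relations hq).X_kp])
      (by rw [one_smul, (T.relations hq).X_kp])) fun v hv => by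
    have e1 : T.B.k (T.A.p v) = T.A.p v := by
      rw [← Module.End.mul_apply, T.hAB.ckp, Module.End.mul_apply, h.Bk_vac v hv]
    have e2 : T.C.m (T.C.k v) = q • T.C.k (T.C.m v) := LinearMap.congr_fun T.C.m_k v
    have e3 : T.C.p (T.C.m v) = v - T.C.k (T.C.k v) := LinearMap.congr_fun T.C.p_m v
    rw [h.X_vac hv, map_add, h.R_kp_vac (h.Ck_vac v hv), h.R_p_vac (h.Cm_vac v hv),
      h.X_vac (h.Ck_vac v hv), h.Y_vac (h.Cm_vac v hv), Module.End.mul_apply, e1, e2, e3,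
      map_sub, map_smul]
    abel

theorem R_Y (h : IsThreeDR T R vac) (hq : q ≠ 0) :
    R * T.Y = T.B.p * R :=
  h.intertwines_of_vac
    (sub_mul_eq' (c := 1) h.R_p (by rw [one_smul, (T.relations hq).Y_p])
      (by rw [one_smul, (T.relations hq).Y_p]))
    (sub_mul_eq' (c := 1) h.R_kp (by rw [one_smul, (T.relations hq).Y_kp])
      (by rw [one_smul, (T.relations hq).X_p])) fun v hv => by
    have e2 : T.C.p (T.C.k v) = q⁻¹ • T.C.k (T.C.p v) := LinearMap.congr_fun T.C.p_k v
    have e3 : T.C.m (T.C.p v) = v - q ^ 2 • T.C.k (T.C.k v) := LinearMap.congr_fun T.C.m_p v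
    rw [h.Y_vac hv, map_sub, map_smul, h.R_kp_vac (h.Cp_vac v hv), h.R_p_vac (h.Ck_vac v hv),
      h.X_vac (h.Cp_vac v hv), h.Y_vac (h.Ck_vac v hv), e2, e3, map_sub, map_smul, map_smul,
      smul_sub, smul_smul, smul_smul, mul_inv_cancel₀ hq, one_smul, pow_two]
    abel

theorem R_Zb (h : IsThreeDR T R vac) (hq : q ≠ 0) :
    R * T.Zb = T.B.k * T.C.m * R :=
  h.intertwines_of_vac
    (sub_mul_eq (c := 1) (d := 1 - q ^ 2) h.R_p (by rw [one_smul, (T.relations hq).Zb_p])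
      (by rw [one_smul, (T.relations hq).km_Y])
      (by rw [← mul_assoc, h.R_kkC hq, mul_assoc, h.R_kp, ← mul_assoc]))
    (sub_mul_eq' h.R_kp (T.relations hq).Zb_kp (T.relations hq).km_X) fun v hv => by
    simp only [OscillatorTriple.Zb, LinearMap.add_apply, Module.End.mul_apply, h.Bm_vac v hv, map_zero, add_zero,
      h.Ak_vac _ (h.Cm_vac v hv), h.Bk_vac _ (h.Cm_vac v hv), h.R_vac _ (h.Cm_vac v hv)]

theorem R_Xb (h : IsThreeDR T R vac) (hq : q ≠ 0) :
    R * T.Xb = T.B.k * T.A.m * R :=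
  h.intertwines_of_vac
    (sub_mul_eq (c := 1) (d := 1 - q ^ 2) h.R_p (by rw [one_smul, (T.relations hq).Xb_p])
      (by rw [one_smul, (T.relations hq).kam_Y])
      (by rw [← mul_assoc, h.R_kk hq, mul_assoc, h.R_kp_C hq, ← mul_assoc]))
    (sub_mul_eq h.R_kp (T.relations hq).Xb_kp (T.relations hq).kam_X (h.R_kkC hq)) fun v hv => by
    have e : T.B.m (T.C.p v) = 0 := h.Bm_vac _ (h.Cp_vac v hv)
    simp only [OscillatorTriple.Xb, LinearMap.add_apply, Module.End.mul_apply, e, h.Am_vac v hv, map_zero, add_zero]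

theorem R_Yb (h : IsThreeDR T R vac) (hq : q ≠ 0) :
    R * T.Yb = T.B.m * R :=
  h.intertwines_of_vac
    (sub_mul_eq (c := 1) (d := -(q * (1 - q ^ 2))) h.R_p
      (by rw [one_smul, neg_smul, ← sub_eq_add_neg, (T.relations hq).Yb_p])
      (by rw [one_smul, neg_smul, ← sub_eq_add_neg, (T.relations hq).m_Y])
      (by rw [← mul_assoc, h.R_kk hq, mul_assoc, h.R_kkC hq, ← mul_assoc]))
    (sub_mul_eq (c := 1) (d := 1 - q ^ 2) h.R_kp (by rw [one_smul, (T.relations hq).Yb_kp])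
      (by rw [one_smul, (T.relations hq).m_X])
      (by rw [← mul_assoc, h.R_kk hq, mul_assoc, h.R_Zb hq, ← mul_assoc])) fun v hv => by
    have e : T.A.m (T.C.m v) = 0 := h.Am_vac _ (h.Cm_vac v hv)
    simp only [OscillatorTriple.Yb, LinearMap.sub_apply, LinearMap.smul_apply, Module.End.mul_apply, e,
      h.Bm_vac v hv, map_zero, smul_zero, sub_zero]

end IsThreeDR

end ThreeDR

/-! ### The `q`-binomial theorem -/

section QBinomial

variable {K : Type*} [Field K]

theorem qPoch_succ (z Q : K) (m : ℕ) : qPoch z Q (m + 1) = qPoch z Q m * (1 - z * Q ^ m) :=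
  Finset.prod_range_succ _ _

theorem qPoch_zero (z Q : K) : qPoch z Q 0 = 1 := Finset.prod_range_zero _

theorem IsGeneric.one_sub_ne {q : K} (hq : IsGeneric q) (m : ℕ) : 1 - q ^ (m + 1) ≠ 0 :=
  fun h => hq.2 (m + 1) m.succ_pos (sub_eq_zero.1 h).symm

theorem IsGeneric.qPoch_ne {q : K} (hq : IsGeneric q) (m : ℕ) : qPoch (q ^ 2) (q ^ 2) m ≠ 0 := by
  refine Finset.prod_ne_zero_iff.2 fun k _ => ?_
  rw [← pow_succ', ← pow_mul, show 2 * (k + 1) = (2 * k + 1) + 1 by ring]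
  exact hq.one_sub_ne _

theorem qBinom_zero {Q : K} (hQ : ∀ m, qPoch Q Q m ≠ 0) (n : ℕ) : qBinom Q n 0 = 1 := by
  simp [qBinom, qPoch_zero, div_self (hQ n)]

theorem qBinom_self {Q : K} (hQ : ∀ m, qPoch Q Q m ≠ 0) (n : ℕ) : qBinom Q n n = 1 := by
  simp [qBinom, qPoch_zero, div_self (hQ n)]

theorem qBinom_of_lt (Q : K) {n k : ℕ} (h : n < k) : qBinom Q n k = 0 := if_neg (by omega)

theorem qBinom_succ {Q : K} (hQ : ∀ m, qPoch Q Q m ≠ 0) (n k : ℕ) :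
    qBinom Q (n + 1) (k + 1) = qBinom Q n k + Q ^ (k + 1) * qBinom Q n (k + 1) := by
  rcases lt_trichotomy n k with h | rfl | h
  · rw [qBinom_of_lt Q h, qBinom_of_lt Q (by omega : n + 1 < k + 1),
      qBinom_of_lt Q (by omega : n < k + 1)]
    simp
  · rw [qBinom_self hQ, qBinom_self hQ, qBinom_of_lt Q (by omega : n < n + 1)]
    simp
  · obtain ⟨d, rfl⟩ : ∃ d, n = k + 1 + d := ⟨n - (k + 1), by omega⟩
    rw [qBinom, qBinom, qBinom, if_pos (by omega), if_pos (by omega), if_pos (by omega),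
      show k + 1 + d + 1 - (k + 1) = d + 1 by omega, show k + 1 + d - k = d + 1 by omega,
      show k + 1 + d - (k + 1) = d by omega, qPoch_succ Q Q (k + 1 + d), qPoch_succ Q Q d,
      qPoch_succ Q Q k]
    have h1 := hQ (k + 1)
    have h2 := hQ (d + 1)
    rw [qPoch_succ] at h1 h2
    have h3 := left_ne_zero_of_mul h1
    have h4 := right_ne_zero_of_mul h1
    have h5 := left_ne_zero_of_mul h2
    have h6 := right_ne_zero_of_mul h2
    rw [eq_comm, mul_div_assoc', div_add_div _ _ (by positivity) (by positivity),
      div_eq_div_iff (by positivity) (by positivity)]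
    ring

theorem pow_mul_of_qCommute {E : Type*} [Ring E] [Algebra K E] {Q : K} {a b : E}
    (h : b * a = Q • (a * b)) (k : ℕ) : b ^ k * a = Q ^ k • (a * b ^ k) := by
  induction k with
  | zero => simp
  | succ k ih =>
    rw [pow_succ', mul_assoc, ih, mul_smul_comm, ← mul_assoc, h, smul_mul_assoc, smul_smul,
      mul_assoc, pow_succ Q]

/-- The noncommutative `q`-binomial theorem. -/
theorem add_pow_of_qCommute {E : Type*} [Ring E] [Algebra K E] {Q : K}
    (hQ : ∀ m, qPoch Q Q m ≠ 0) {a b : E} (h : b * a = Q • (a * b)) (n : ℕ) :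
    (a + b) ^ n = ∑ k ∈ Finset.range (n + 1), qBinom Q n k • (a ^ (n - k) * b ^ k) := by
  induction n with
  | zero => simp [qBinom_zero hQ]
  | succ n ih =>
    -- Moving `a` to the left past `b ^ k` costs `Q ^ k`. The vanishing term `k = n + 1` is included
    -- so that, once `k = 0` is split off, this sum lines up with `e2` and Pascal's rule applies
    -- termwise.
    have e1 : (∑ k ∈ Finset.range (n + 1), qBinom Q n k • (a ^ (n - k) * b ^ k)) * a
        = ∑ k ∈ Finset.range (n + 2), (Q ^ k * qBinom Q n k) • (a ^ (n + 1 - k) * b ^ k) := by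
      rw [Finset.sum_range_succ _ (n + 1), qBinom_of_lt Q (Nat.lt_succ_self n), mul_zero,
        zero_smul, add_zero, Finset.sum_mul]
      refine Finset.sum_congr rfl fun k hk' => ?_
      have hkn : k ≤ n := by simpa [Nat.lt_succ_iff] using hk'
      rw [smul_mul_assoc, mul_assoc, pow_mul_of_qCommute h, mul_smul_comm, smul_smul, ← mul_assoc, ← pow_succ,
        Nat.sub_add_comm hkn, mul_comm]
    have e2 : (∑ k ∈ Finset.range (n + 1), qBinom Q n k • (a ^ (n - k) * b ^ k)) * b
        = ∑ k ∈ Finset.range (n + 1), qBinom Q n k • (a ^ (n - k) * b ^ (k + 1)) := by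
      rw [Finset.sum_mul]
      refine Finset.sum_congr rfl fun k _ => ?_
      rw [smul_mul_assoc, mul_assoc, ← pow_succ]
    rw [pow_succ, ih, mul_add, e1, e2, Finset.sum_range_succ' _ (n + 1),
      Finset.sum_range_succ' _ (n + 1), add_right_comm, ← Finset.sum_add_distrib]
    congr 1
    · refine Finset.sum_congr rfl fun k _ => ?_
      rw [qBinom_succ hQ, Nat.add_sub_add_right, add_smul, add_comm]
    · simp [qBinom_zero hQ]

end QBinomial

/-! ### Oscillators acting by weighted shifts -/

section Ladders

variable {K ι : Type*} [Field K]

/-- The operator `|t⟩ ↦ w(t) |σ(t)⟩`. -/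
def wShift (w : ι → K) (σ : ι → ι) : Module.End K (ι →₀ K) :=
  Finsupp.linearCombination K fun t => Finsupp.single (σ t) (w t)

theorem wShift_single (w : ι → K) (σ : ι → ι) (t : ι) (c : K) :
    wShift w σ (Finsupp.single t c) = Finsupp.single (σ t) (c * w t) := by
  rw [wShift, Finsupp.linearCombination_single, Finsupp.smul_single, smul_eq_mul]

theorem wShift_comm {w w' : ι → K} {σ σ' : ι → ι} (h : ∀ t, σ (σ' t) = σ' (σ t))
    (hw : ∀ t, w (σ' t) = w t) (hw' : ∀ t, w' (σ t) = w' t) :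
    wShift w σ * wShift w' σ' = wShift w' σ' * wShift w σ := by
  refine Finsupp.lhom_ext fun t c => ?_
  simp only [Module.End.mul_apply, wShift_single, h, hw, hw']
  rw [mul_right_comm]

/-- A number function on a set of labels together with raising and lowering maps. -/
structure Ladder (ι : Type*) where
  /-- number function -/
  N : ι → ℕ
  /-- raising map -/
  up : ι → ι
  /-- lowering map -/
  down : ι → ι
  N_up : ∀ t, N (up t) = N t + 1
  N_down : ∀ t, N (down t) = N t - 1
  down_up : ∀ t, down (up t) = t
  up_down : ∀ t, N t ≠ 0 → up (down t) = t

/-- The `q`-oscillator of a ladder. -/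
def Ladder.osc (L : Ladder ι) {q : K} (hq : q ≠ 0) : Oscillator K q (Module.End K (ι →₀ K)) where
  p := wShift (fun _ => 1) L.up
  -- At `L.N t = 0`, where `down` is not inverse to `up`, the weight vanishes.
  m := wShift (fun t => 1 - (q ^ 2) ^ L.N t) L.down
  k := wShift (fun t => q ^ L.N t) id
  p_k := by
    refine Finsupp.lhom_ext fun t c => ?_
    simp only [Module.End.mul_apply, wShift_single, LinearMap.smul_apply, Finsupp.smul_single,
      L.N_up, id, smul_eq_mul]
    congr 1
    rw [pow_succ]
    field_simp
  m_k := by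
    refine Finsupp.lhom_ext fun t c => ?_
    simp only [Module.End.mul_apply, wShift_single, LinearMap.smul_apply, Finsupp.smul_single,
      L.N_down, id, smul_eq_mul]
    congr 1
    rcases Nat.eq_zero_or_pos (L.N t) with h | h
    · rw [h]; simp
    · obtain ⟨d, hd⟩ : ∃ d, L.N t = d + 1 := ⟨L.N t - 1, by omega⟩
      rw [hd, Nat.add_sub_cancel]
      ring
  p_m := by
    refine Finsupp.lhom_ext fun t c => ?_
    simp only [Module.End.mul_apply, wShift_single, LinearMap.sub_apply, Module.End.one_apply,
      id, ← Finsupp.single_sub]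
    by_cases h : L.N t = 0
    · simp [h]
    · rw [L.up_down t h]
      congr 1
      ring
  m_p := by
    refine Finsupp.lhom_ext fun t c => ?_
    simp only [Module.End.mul_apply, wShift_single, LinearMap.sub_apply, Module.End.one_apply,
      LinearMap.smul_apply, Finsupp.smul_single, id, ← Finsupp.single_sub, L.down_up, L.N_up,
      smul_eq_mul]
    congr 1
    ring

/-- Two ladders that do not interact. -/
structure Ladder.Commutes (L L' : Ladder ι) : Prop where
  N_up' : ∀ t, L.N (L'.up t) = L.N t
  N_down' : ∀ t, L.N (L'.down t) = L.N t
  N'_up : ∀ t, L'.N (L.up t) = L'.N t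
  N'_down : ∀ t, L'.N (L.down t) = L'.N t
  up_up : ∀ t, L'.up (L.up t) = L.up (L'.up t)
  up_down : ∀ t, L'.up (L.down t) = L.down (L'.up t)
  down_up : ∀ t, L'.down (L.up t) = L.up (L'.down t)
  down_down : ∀ t, L'.down (L.down t) = L.down (L'.down t)

theorem Ladder.Commutes.osc {L L' : Ladder ι} (h : L.Commutes L') {q : K} (hq : q ≠ 0) :
    (L.osc hq).Commutes (L'.osc hq) where
  cpp := wShift_comm h.up_up (fun _ => rfl) (fun _ => rfl)
  cpm := wShift_comm h.up_down (fun _ => rfl) (fun t => by rw [h.N_up'])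
  cpk := wShift_comm (fun _ => rfl) (fun _ => rfl) (fun t => by rw [h.N_up'])
  cmp := wShift_comm h.down_up (fun t => by rw [h.N'_up]) (fun _ => rfl)
  cmm := wShift_comm h.down_down (fun t => by rw [h.N'_down]) (fun t => by rw [h.N_down'])
  cmk := wShift_comm (fun _ => rfl) (fun _ => rfl) (fun t => by rw [h.N_down'])
  ckp := wShift_comm (fun _ => rfl) (fun t => by rw [h.N'_up]) (fun _ => rfl)
  ckm := wShift_comm (fun _ => rfl) (fun t => by rw [h.N'_down]) (fun _ => rfl)
  ckk := wShift_comm (fun _ => rfl) (fun _ => rfl) (fun _ => rfl)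

/-- The ladder of the `r`-th component of the first factor. -/
def ladderA {n : ℕ} (r : ZMod n) : Ladder (Idx n) where
  N t := t.1 r
  up t := (t.1 + Pi.single r 1, t.2)
  down t := (t.1 - Pi.single r 1, t.2)
  N_up t := by simp
  N_down t := by simp
  down_up t := by simp
  up_down t h := by
    refine Prod.ext (funext fun s => ?_) rfl
    by_cases hs : s = r
    · subst hs; simp; omega
    · simp [hs]

/-- The ladder of the `r`-th component of the second factor. -/
def ladderB {n : ℕ} (r : ZMod n) : Ladder (Idx n) where
  N t := t.2.1 r
  up t := (t.1, t.2.1 + Pi.single r 1, t.2.2)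
  down t := (t.1, t.2.1 - Pi.single r 1, t.2.2)
  N_up t := by simp
  N_down t := by simp
  down_up t := by simp
  up_down t h := by
    refine Prod.ext rfl (Prod.ext (funext fun s => ?_) rfl)
    by_cases hs : s = r
    · subst hs; simp; omega
    · simp [hs]

/-- The ladder of the third factor. -/
def ladderC (n : ℕ) : Ladder (Idx n) where
  N t := t.2.2
  up t := (t.1, t.2.1, t.2.2 + 1)
  down t := (t.1, t.2.1, t.2.2 - 1)
  N_up _ := rfl
  N_down _ := rfl
  down_up _ := rfl
  up_down _ h := Prod.ext rfl (Prod.ext rfl (Nat.succ_pred h))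

/-- The three oscillators on which `R_{α_r, β_r, 3}` acts. -/
def siteTriple {q : K} (hq : q ≠ 0) {n : ℕ} (r : ZMod n) :
    OscillatorTriple K q (Module.End K (Idx n →₀ K)) where
  A := (ladderA r).osc hq
  B := (ladderB r).osc hq
  C := (ladderC n).osc hq
  hAB := Ladder.Commutes.osc (by constructor <;> intro _ <;> rfl) hq
  hAC := Ladder.Commutes.osc (by constructor <;> intro _ <;> rfl) hq
  hBC := Ladder.Commutes.osc (by constructor <;> intro _ <;> rfl) hq

end Ladders

/-! ### The 3d `R` in terms of `q`-oscillators -/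

section SiteR

variable {K : Type*} [Field K] {q : K} {n : ℕ}

/-- The label with entries `a`, `b`, `c` in the `r`-th component of the first factor, the `r`-th
component of the second factor and the third factor, and otherwise as in `t`. -/
def setSite (r : ZMod n) (t : Idx n) (a b c : ℕ) : Idx n :=
  (Function.update t.1 r a, Function.update t.2.1 r b, c)

theorem setSite_self (r : ZMod n) (t : Idx n) : setSite r t (t.1 r) (t.2.1 r) t.2.2 = t := by
  simp [setSite]

section Action

variable (hq : q ≠ 0) (r : ZMod n) (t : Idx n) (a b c : ℕ) (x : K)

theorem update_add_single (f : ZMod n → ℕ) (a : ℕ) :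
    Function.update f r a + Pi.single r 1 = Function.update f r (a + 1) := by
  funext s
  by_cases hs : s = r
  · subst hs; simp
  · simp [hs]

theorem update_sub_single (f : ZMod n → ℕ) (a : ℕ) :
    Function.update f r a - Pi.single r 1 = Function.update f r (a - 1) := by
  funext s
  by_cases hs : s = r
  · subst hs; simp
  · simp [hs]

theorem Ap_setSite : (siteTriple hq r).A.p (Finsupp.single (setSite r t a b c) x)
    = Finsupp.single (setSite r t (a + 1) b c) x := by
  simp [siteTriple, Ladder.osc, wShift_single, ladderA, setSite, update_add_single]

theorem Bp_setSite : (siteTriple hq r).B.p (Finsupp.single (setSite r t a b c) x)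
    = Finsupp.single (setSite r t a (b + 1) c) x := by
  simp [siteTriple, Ladder.osc, wShift_single, ladderB, setSite, update_add_single]

theorem Cp_setSite : (siteTriple hq r).C.p (Finsupp.single (setSite r t a b c) x)
    = Finsupp.single (setSite r t a b (c + 1)) x := by
  simp [siteTriple, Ladder.osc, wShift_single, ladderC, setSite]

theorem Am_setSite : (siteTriple hq r).A.m (Finsupp.single (setSite r t a b c) x)
    = Finsupp.single (setSite r t (a - 1) b c) (x * (1 - (q ^ 2) ^ a)) := by
  simp [siteTriple, Ladder.osc, wShift_single, ladderA, setSite, update_sub_single]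

theorem Bm_setSite : (siteTriple hq r).B.m (Finsupp.single (setSite r t a b c) x)
    = Finsupp.single (setSite r t a (b - 1) c) (x * (1 - (q ^ 2) ^ b)) := by
  simp [siteTriple, Ladder.osc, wShift_single, ladderB, setSite, update_sub_single]

theorem Cm_setSite : (siteTriple hq r).C.m (Finsupp.single (setSite r t a b c) x)
    = Finsupp.single (setSite r t a b (c - 1)) (x * (1 - (q ^ 2) ^ c)) := by
  simp [siteTriple, Ladder.osc, wShift_single, ladderC, setSite]

theorem Ak_setSite : (siteTriple hq r).A.k (Finsupp.single (setSite r t a b c) x)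
    = Finsupp.single (setSite r t a b c) (x * q ^ a) := by
  simp [siteTriple, Ladder.osc, wShift_single, ladderA, setSite]

theorem Bk_setSite : (siteTriple hq r).B.k (Finsupp.single (setSite r t a b c) x)
    = Finsupp.single (setSite r t a b c) (x * q ^ b) := by
  simp [siteTriple, Ladder.osc, wShift_single, ladderB, setSite]

theorem Ck_setSite : (siteTriple hq r).C.k (Finsupp.single (setSite r t a b c) x)
    = Finsupp.single (setSite r t a b c) (x * q ^ c) := by
  simp [siteTriple, Ladder.osc, wShift_single, ladderC, setSite]

theorem ApCp_pow (d : ℕ) :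
    ((siteTriple hq r).A.p * (siteTriple hq r).C.p) ^ d
      • (Finsupp.single (setSite r t a b c) x : Idx n →₀ K)
      = Finsupp.single (setSite r t (a + d) b (c + d)) x := by
  induction d with
  | zero => simp
  | succ d ih =>
    rw [pow_succ', mul_smul, ih, Module.End.smul_def, Module.End.mul_apply, Cp_setSite,
      Ap_setSite]
    rfl

theorem BpAkCk_pow (d : ℕ) :
    (-(q • ((siteTriple hq r).A.k * (siteTriple hq r).C.k * (siteTriple hq r).B.p))) ^ d
      • (Finsupp.single (setSite r t a b c) x : Idx n →₀ K)
      = Finsupp.single (setSite r t a (b + d) c) (x * ((-1) ^ d * q ^ ((1 + a + c) * d))) := by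
  induction d with
  | zero => simp
  | succ d ih =>
    rw [pow_succ', mul_smul, ih, Module.End.smul_def, LinearMap.neg_apply, LinearMap.smul_apply,
      Module.End.mul_apply, Module.End.mul_apply, Bp_setSite, Ck_setSite, Ak_setSite,
      Finsupp.smul_single, ← Finsupp.single_neg, smul_eq_mul, ← add_assoc]
    congr 1
    ring

theorem CkAp_pow (d : ℕ) :
    ((siteTriple hq r).C.k * (siteTriple hq r).A.p) ^ d
      • (Finsupp.single (setSite r t a b c) x : Idx n →₀ K)
      = Finsupp.single (setSite r t (a + d) b c) (x * q ^ (c * d)) := by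
  induction d with
  | zero => simp
  | succ d ih =>
    rw [pow_succ', mul_smul, ih, Module.End.smul_def, Module.End.mul_apply, Ap_setSite,
      Ck_setSite, ← add_assoc]
    congr 1
    ring

theorem AkBpCm_pow (d : ℕ) :
    ((siteTriple hq r).A.k * (siteTriple hq r).B.p * (siteTriple hq r).C.m) ^ d
      • (Finsupp.single (setSite r t a b c) x : Idx n →₀ K)
      = Finsupp.single (setSite r t a (b + d) (c - d))
          (x * (q ^ (a * d) * ∏ s ∈ Finset.range d, (1 - (q ^ 2) ^ (c - s)))) := by
  induction d with
  | zero => simp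
  | succ d ih =>
    rw [pow_succ', mul_smul, ih, Module.End.smul_def, Module.End.mul_apply, Module.End.mul_apply,
      Cm_setSite, Bp_setSite, Ak_setSite, ← add_assoc, Finset.prod_range_succ, Nat.sub_sub]
    congr 1
    ring

end Action

theorem prod_one_sub_pow (Q : K) (c d : ℕ) (hQ : ∀ m, qPoch Q Q m ≠ 0) :
    ∏ s ∈ Finset.range d, (1 - Q ^ (c + d - s)) = qPoch Q Q (c + d) / qPoch Q Q c := by
  rw [eq_div_iff (hQ c)]
  induction d with
  | zero => simp
  | succ d ih =>
    rw [Finset.prod_range_succ', ← add_assoc, qPoch_succ, ← ih]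
    simp only [Nat.sub_zero, Nat.add_sub_add_right]
    rw [pow_succ' Q (c + d)]
    ring

/-- The factor with `s = c` is zero. Lowering the third factor more than `c` times therefore gives
zero, although the truncated label `c - d` still makes sense. -/
theorem prod_one_sub_pow_eq_zero (Q : K) {c d : ℕ} (h : c < d) :
    ∏ s ∈ Finset.range d, (1 - Q ^ (c - s)) = 0 :=
  Finset.prod_eq_zero (Finset.mem_range.2 h) (by simp)

/-- The terms of the matrix elements of the 3d `R`. -/
def threeDRTerm (q : K) (i j k lam mu c : ℕ) : K :=
  (-1) ^ lam * q ^ ((i : ℤ) * ((c : ℤ) - j) + ((k : ℤ) + 1) * lam + mu * ((mu : ℤ) - k))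
    * (qPoch (q ^ 2) (q ^ 2) (c + mu) / qPoch (q ^ 2) (q ^ 2) c)
    * qBinom (q ^ 2) i mu * qBinom (q ^ 2) j lam

theorem sum_comm_three {α β γ δ M : Type*} [AddCommMonoid M] (s : Finset α) (t : Finset β)
    (u : Finset γ) (v : Finset δ) (f : α → β → γ → δ → M) :
    ∑ a ∈ s, ∑ b ∈ t, ∑ c ∈ u, ∑ d ∈ v, f a b c d
      = ∑ d ∈ v, ∑ a ∈ s, ∑ b ∈ t, ∑ c ∈ u, f a b c d := by
  rw [Finset.sum_comm (s := v)]
  refine Finset.sum_congr rfl fun a _ => ?_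
  rw [Finset.sum_comm (s := v)]
  exact Finset.sum_congr rfl fun b _ => Finset.sum_comm

/-- For given `lam` and `mu` the conservation laws determine the three output labels, so only a
double sum survives. The guard expresses that the third output label is a natural number. -/
theorem siteR_single_eq_sum (q : K) (r : ZMod n) (t : Idx n) :
    siteR q r (Finsupp.single t 1)
      = ∑ lam ∈ Finset.range (t.2.1 r + 1), ∑ mu ∈ Finset.range (t.1 r + 1),
          if lam + mu ≤ t.2.1 r + t.2.2 then
            Finsupp.single (setSite r t (t.1 r + t.2.1 r - (lam + mu)) (lam + mu)
                (t.2.1 r + t.2.2 - (lam + mu)))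
              (threeDRTerm q (t.1 r) (t.2.1 r) t.2.2 lam mu (t.2.1 r + t.2.2 - (lam + mu)))
          else 0 := by
  obtain ⟨i, hi⟩ : ∃ i, i = t.1 r := ⟨_, rfl⟩
  obtain ⟨j, hj⟩ : ∃ j, j = t.2.1 r := ⟨_, rfl⟩
  obtain ⟨k, hk⟩ : ∃ k, k = t.2.2 := ⟨_, rfl⟩
  have key (a b c : ℕ) : Finsupp.single (setSite r t a b c) (threeDR q a b c i j k)
      = ∑ p ∈ Finset.range (j + 1) ×ˢ Finset.range (i + 1),
          if p.1 + p.2 = b ∧ a + b = i + j ∧ b + c = j + k then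
            Finsupp.single (setSite r t a b c) (threeDRTerm q i j k p.1 p.2 c) else 0 := by
    rw [threeDR]
    split_ifs with h
    · simp only [h, and_true]
      rw [← Finset.sum_filter, ← Finsupp.single_finsetSum]
      congr 1
      -- Pairs of the antidiagonal outside the box `lam ≤ j`, `mu ≤ i` have a vanishing
      -- `q`-binomial.
      refine (Finset.sum_subset (fun p hp => ?_) fun p hp hp' => ?_).symm
      · rw [Finset.mem_filter] at hp
        rw [Finset.HasAntidiagonal.mem_antidiagonal, hp.2]
      · rw [Finset.HasAntidiagonal.mem_antidiagonal] at hp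
        by_cases h1 : p.1 ≤ j
        · have h2 : i < p.2 := by
            by_contra h2
            exact hp' (by simp [hp]; omega)
          rw [qBinom_of_lt _ h2]
          simp
        · rw [qBinom_of_lt (q ^ 2) (not_le.1 h1)]
          simp
    · simp [h]
  rw [siteR, Finsupp.linearCombination_single, one_smul, ← hi, ← hj, ← hk]
  change ∑ a ∈ _, ∑ b ∈ _, ∑ c ∈ _, Finsupp.single (setSite r t a b c) _ = _
  simp only [key]
  rw [sum_comm_three, Finset.sum_product]
  refine Finset.sum_congr rfl fun lam hlam => Finset.sum_congr rfl fun mu hmu => ?_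
  rw [Finset.mem_range] at hlam hmu
  split_ifs with h
  · rw [Finset.sum_eq_single (i + j - (lam + mu)), Finset.sum_eq_single (lam + mu),
      Finset.sum_eq_single (j + k - (lam + mu)), if_pos]
    · omega
    · intro c _ hc
      exact if_neg (by omega)
    · intro hc
      exact absurd (Finset.mem_range.2 (by omega)) hc
    · intro b _ hb
      exact Finset.sum_eq_zero fun c _ => if_neg (by omega)
    · intro hc
      exact absurd (Finset.mem_range.2 (by omega)) hc
    · intro a _ ha
      exact Finset.sum_eq_zero fun b _ => Finset.sum_eq_zero fun c _ => if_neg (by omega)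
    · intro hc
      exact absurd (Finset.mem_range.2 (by omega)) hc
  · exact Finset.sum_eq_zero fun a _ => Finset.sum_eq_zero fun b _ =>
      Finset.sum_eq_zero fun c _ => if_neg (by omega)

/-- The two summands of `Y` commute up to `q ^ 2`, so the noncommutative `q`-binomial theorem
expands the power; each monomial acts as a weighted shift. The same applies to `X` in
`X_pow_setSite`. -/
theorem Y_pow_setSite (hq : IsGeneric q) (r : ZMod n) (t : Idx n) (j k : ℕ) :
    (siteTriple hq.1 r).Y ^ j • (Finsupp.single (setSite r t 0 0 k) 1 : Idx n →₀ K)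
      = ∑ lam ∈ Finset.range (j + 1), Finsupp.single (setSite r t (j - lam) lam (k + (j - lam)))
          (qBinom (q ^ 2) j lam * ((-1) ^ lam * q ^ ((1 + k) * lam))) := by
  have h : -(q • ((siteTriple hq.1 r).A.k * (siteTriple hq.1 r).C.k * (siteTriple hq.1 r).B.p))
        * ((siteTriple hq.1 r).A.p * (siteTriple hq.1 r).C.p)
      = q ^ 2 • ((siteTriple hq.1 r).A.p * (siteTriple hq.1 r).C.p
        * -(q • ((siteTriple hq.1 r).A.k * (siteTriple hq.1 r).C.k * (siteTriple hq.1 r).B.p))) := by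
    refine Finsupp.lhom_ext fun t c => ?_
    rw [← setSite_self r t]
    simp only [Module.End.mul_apply, LinearMap.neg_apply, LinearMap.smul_apply, Ap_setSite,
      Bp_setSite, Cp_setSite, Ak_setSite, Ck_setSite, Finsupp.smul_single,
      ← Finsupp.single_neg, smul_eq_mul]
    congr 1
    ring
  rw [OscillatorTriple.Y, sub_eq_add_neg, add_pow_of_qCommute hq.qPoch_ne h, Finset.sum_smul]
  refine Finset.sum_congr rfl fun lam _ => ?_
  rw [smul_assoc, mul_smul, BpAkCk_pow, ApCp_pow, Finsupp.smul_single, smul_eq_mul]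
  simp

theorem X_pow_setSite (hq : IsGeneric q) (r : ZMod n) (t : Idx n) (i a b c : ℕ) (x : K) :
    (siteTriple hq.1 r).X ^ i • (Finsupp.single (setSite r t a b c) x : Idx n →₀ K)
      = ∑ mu ∈ Finset.range (i + 1), Finsupp.single (setSite r t (a + (i - mu)) (b + mu) (c - mu))
          (x * (qBinom (q ^ 2) i mu * (q ^ (a * mu) * q ^ ((c - mu) * (i - mu))
            * ∏ s ∈ Finset.range mu, (1 - (q ^ 2) ^ (c - s))))) := by
  have h : (siteTriple hq.1 r).A.k * (siteTriple hq.1 r).B.p * (siteTriple hq.1 r).C.m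
        * ((siteTriple hq.1 r).C.k * (siteTriple hq.1 r).A.p)
      = q ^ 2 • ((siteTriple hq.1 r).C.k * (siteTriple hq.1 r).A.p
        * ((siteTriple hq.1 r).A.k * (siteTriple hq.1 r).B.p * (siteTriple hq.1 r).C.m)) := by
    refine Finsupp.lhom_ext fun t c => ?_
    rw [← setSite_self r t]
    simp only [Module.End.mul_apply, LinearMap.smul_apply, Ap_setSite, Cm_setSite,
      Bp_setSite, Ak_setSite, Ck_setSite, Finsupp.smul_single, smul_eq_mul]
    rcases Nat.eq_zero_or_pos t.2.2 with h | h
    · simp [h]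
    · obtain ⟨d, hd⟩ : ∃ d, t.2.2 = d + 1 := ⟨t.2.2 - 1, by omega⟩
      rw [hd, Nat.add_sub_cancel]
      congr 1
      ring
  rw [OscillatorTriple.X, add_pow_of_qCommute hq.qPoch_ne h, Finset.sum_smul]
  refine Finset.sum_congr rfl fun mu _ => ?_
  rw [smul_assoc, mul_smul, AkBpCm_pow, CkAp_pow, Finsupp.smul_single, smul_eq_mul]
  congr 1
  ring

/-- The link between the explicit matrix elements and the oscillator calculus: `lam` is the
expansion index of `Y ^ j`, `mu` that of `X ^ i`, and the ratio of `q`-factorials comes from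
applying `C.m` `mu` times. -/
theorem siteR_single (hq : IsGeneric q) (r : ZMod n) (t : Idx n) :
    siteR q r (Finsupp.single t 1)
      = (q ^ (t.1 r * t.2.1 r))⁻¹ • ((siteTriple hq.1 r).X ^ t.1 r * (siteTriple hq.1 r).Y ^ t.2.1 r)
          • (Finsupp.single (setSite r t 0 0 t.2.2) 1 : Idx n →₀ K) := by
  rw [siteR_single_eq_sum, mul_smul, Y_pow_setSite hq, Finset.smul_sum, Finset.smul_sum]
  refine Finset.sum_congr rfl fun lam hlam => ?_
  rw [X_pow_setSite hq, Finset.smul_sum]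
  refine Finset.sum_congr rfl fun mu hmu => ?_
  rw [Finset.mem_range] at hlam hmu
  generalize t.1 r = i at *
  generalize t.2.1 r = j at *
  generalize t.2.2 = k at *
  split_ifs with h
  · obtain ⟨e, rfl⟩ : ∃ e, j = lam + e := ⟨j - lam, by omega⟩
    obtain ⟨d, rfl⟩ : ∃ d, i = mu + d := ⟨i - mu, by omega⟩
    -- `Y ^ j` raises the third label by `e = j - lam` and `X ^ i` lowers it by `mu`, leaving the
    -- output label `c`.
    obtain ⟨c, hc⟩ : ∃ c, k + e = c + mu := ⟨k + e - mu, by omega⟩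
    have h1 : mu + d + (lam + e) - (lam + mu) = e + d := by omega
    have h2 : lam + e + k - (lam + mu) = c := by omega
    have h3 : c + mu - mu = c := by omega
    rw [h1, h2, Nat.add_sub_cancel_left, Nat.add_sub_cancel_left, hc, h3, Finsupp.smul_single,
      prod_one_sub_pow _ _ _ hq.qPoch_ne, smul_eq_mul, threeDRTerm]
    congr 1
    have hk : (k : ℤ) = c + mu - e := by omega
    have h0 := hq.1
    have hexp : q ^ ((((mu + d : ℕ) : ℤ)) * ((c : ℤ) - ((lam + e : ℕ) : ℤ)) + ((k : ℤ) + 1) * lam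
          + mu * ((mu : ℤ) - k))
        = (q ^ ((mu + d) * (lam + e)))⁻¹ * q ^ ((1 + k) * lam) * q ^ (e * mu) * q ^ (c * d) := by
      rw [← zpow_natCast, ← zpow_natCast, ← zpow_natCast, ← zpow_natCast, ← zpow_neg,
        ← zpow_add₀ h0, ← zpow_add₀ h0, ← zpow_add₀ h0]
      congr 1
      push_cast
      rw [hk]
      ring
    rw [hexp]
    ring
  -- Here `mu` exceeds `k + (j - lam)`, so the lowering operators annihilate the term on the right
  -- as well.
  · rw [prod_one_sub_pow_eq_zero (q ^ 2) (by omega)]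
    simp

end SiteR

/-! ### The site operators satisfy the axioms of `IsThreeDR` and commute with oscillators at other
sites. -/

section SiteThreeDR

variable {K : Type*} [Field K] {q : K} {n : ℕ}

theorem mem_of_mem_supported {ι M : Type*} [AddCommGroup M] [Module K M] {S : Set ι}
    (f : (ι →₀ K) →ₗ[K] M) {W : Submodule K M} (h : ∀ t ∈ S, f (Finsupp.single t 1) ∈ W)
    {v : ι →₀ K} (hv : v ∈ Finsupp.supported K K S) : f v ∈ W := by
  have : Finsupp.supported K K S ≤ W.comap f := by
    rw [Finsupp.supported_eq_span_single, Submodule.span_le]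
    rintro _ ⟨t, ht, rfl⟩
    exact h t ht
  exact this hv

theorem eq_of_mem_supported {ι M : Type*} [AddCommGroup M] [Module K M] {S : Set ι}
    {f g : (ι →₀ K) →ₗ[K] M} (h : ∀ t ∈ S, f (Finsupp.single t 1) = g (Finsupp.single t 1))
    {v : ι →₀ K} (hv : v ∈ Finsupp.supported K K S) : f v = g v := by
  have := mem_of_mem_supported (f - g) (W := ⊥)
    (fun t ht => by rw [LinearMap.sub_apply, h t ht, sub_self]; exact Submodule.zero_mem _) hv
  exact sub_eq_zero.1 ((Submodule.mem_bot K).1 this)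

/-- The span of the `|t⟩` with zeros in the `r`-th components of the first two factors. -/
def siteVac (K : Type*) [Field K] {n : ℕ} (r : ZMod n) : Submodule K (Idx n →₀ K) :=
  Finsupp.supported K K {t | t.1 r = 0 ∧ t.2.1 r = 0}

theorem setSite_vac {r : ZMod n} {t : Idx n} (h : t.1 r = 0 ∧ t.2.1 r = 0) :
    setSite r t 0 0 t.2.2 = t := by
  have := setSite_self r t
  rwa [h.1, h.2] at this

theorem siteR_vac (hq : IsGeneric q) {r : ZMod n} {t : Idx n} (h : t.1 r = 0 ∧ t.2.1 r = 0) :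
    siteR q r (Finsupp.single t 1) = Finsupp.single t 1 := by
  rw [siteR_single hq, setSite_vac h, h.1, h.2]
  simp

/-- All the content is in `siteR_single`: raising the second label appends a factor `Y`, raising the
first appends a factor `X`, and the powers of `q` match the prefactor `q ^ (-i * j)`. -/
theorem siteR_isThreeDR (hq : IsGeneric q) (r : ZMod n) :
    IsThreeDR (siteTriple hq.1 r) (siteR q r) (siteVac K r) where
  R_p := by
    refine Finsupp.lhom_ext' fun t => LinearMap.ext_ring ?_
    have e1 : (siteTriple hq.1 r).B.p (Finsupp.single t 1)
        = Finsupp.single (setSite r t (t.1 r) (t.2.1 r + 1) t.2.2) 1 := by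
      rw [← Bp_setSite hq.1, setSite_self]
    have e2 : setSite r (setSite r t (t.1 r) (t.2.1 r + 1) t.2.2) 0 0 t.2.2
        = setSite r t 0 0 t.2.2 := by
      simp [setSite]
    simp only [LinearMap.comp_apply, Finsupp.lsingle_apply, Module.End.mul_apply, e1]
    rw [siteR_single hq, siteR_single hq, map_smul, ← Module.End.smul_def (siteTriple hq.1 r).Y]
    simp only [setSite, Function.update_self] at e2 ⊢
    -- Passing the new `Y` to the left of `X ^ i` produces `q ^ i`, which compensates the change
    -- from `q ^ (i * j)` to `q ^ (i * (j + 1))` in the prefactor.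
    rw [e2, ← mul_smul _ _ (Finsupp.single _ _ : Idx n →₀ K), pow_succ', ← mul_assoc,
      pow_mul_of_qCommute ((siteTriple hq.1 r).relations hq.1).X_Y, smul_mul_assoc, mul_assoc,
      smul_assoc, smul_smul]
    congr 1
    have := hq.1
    field_simp
    ring
  R_kp := by
    refine Finsupp.lhom_ext' fun t => LinearMap.ext_ring ?_
    -- The number operator `B.k` contributes `q ^ j`, exactly the change of the prefactor when `i`
    -- grows by one.
    have e1 : (siteTriple hq.1 r).B.k ((siteTriple hq.1 r).A.p (Finsupp.single t 1))
        = q ^ t.2.1 r • Finsupp.single (setSite r t (t.1 r + 1) (t.2.1 r) t.2.2) 1 := by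
      nth_rw 1 [← setSite_self r t]
      rw [Ap_setSite hq.1, Bk_setSite, Finsupp.smul_single, smul_eq_mul, mul_comm]
    have e2 : setSite r (setSite r t (t.1 r + 1) (t.2.1 r) t.2.2) 0 0 t.2.2
        = setSite r t 0 0 t.2.2 := by
      simp [setSite]
    simp only [LinearMap.comp_apply, Finsupp.lsingle_apply, Module.End.mul_apply, e1, map_smul]
    rw [siteR_single hq, siteR_single hq, map_smul, ← Module.End.smul_def (siteTriple hq.1 r).X]
    simp only [setSite, Function.update_self] at e2 ⊢
    rw [e2, ← mul_smul _ _ (Finsupp.single _ _ : Idx n →₀ K), pow_succ', ← mul_assoc,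
      smul_smul]
    congr 1
    have := hq.1
    field_simp
    ring
  R_vac v hv := by
    refine eq_of_mem_supported (g := LinearMap.id) (fun t ht => ?_) hv
    rw [siteR_vac hq ht, LinearMap.id_apply]
  Am_vac v hv := by
    refine eq_of_mem_supported (g := 0) (fun t ht => ?_) hv
    rw [← setSite_vac ht, Am_setSite]
    simp
  Bm_vac v hv := by
    refine eq_of_mem_supported (g := 0) (fun t ht => ?_) hv
    rw [← setSite_vac ht, Bm_setSite]
    simp
  Ak_vac v hv := by
    refine eq_of_mem_supported (g := LinearMap.id) (fun t ht => ?_) hv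
    rw [← setSite_vac ht, Ak_setSite]
    simp
  Bk_vac v hv := by
    refine eq_of_mem_supported (g := LinearMap.id) (fun t ht => ?_) hv
    rw [← setSite_vac ht, Bk_setSite]
    simp
  Cp_vac v hv := by
    refine mem_of_mem_supported _ (fun t ht => ?_) hv
    rw [← setSite_vac ht, Cp_setSite]
    exact Finsupp.single_mem_supported _ _ (by simp [setSite])
  Cm_vac v hv := by
    refine mem_of_mem_supported _ (fun t ht => ?_) hv
    rw [← setSite_vac ht, Cm_setSite]
    exact Finsupp.single_mem_supported _ _ (by simp [setSite])
  Ck_vac v hv := by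
    refine mem_of_mem_supported _ (fun t ht => ?_) hv
    rw [← setSite_vac ht, Ck_setSite]
    exact Finsupp.single_mem_supported _ _ (by simp [setSite])
  generated D hB hA hv := by
    have key (a : ℕ) : ∀ (t : Idx n) (b : ℕ), D (Finsupp.single (setSite r t a b t.2.2) 1) = 0 := by
      intro t
      induction a with
      | zero =>
        intro b
        induction b with
        | zero => exact hv _ (Finsupp.single_mem_supported _ _ (by simp [setSite]))
        | succ b ih =>
          rw [← Bp_setSite hq.1]
          exact hB _ ih
      | succ a ih =>
        intro b
        -- The generator raises the first label only up to the nonzero scalar `q ^ b`, which is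
        -- cancelled.
        have h1 := hA _ (ih b)
        rw [Module.End.mul_apply, Ap_setSite, Bk_setSite, one_mul, ← mul_one (q ^ b),
          ← smul_eq_mul, ← Finsupp.smul_single, map_smul] at h1
        exact (smul_eq_zero.1 h1).resolve_left (pow_ne_zero _ hq.1)
    refine Finsupp.lhom_ext' fun t => LinearMap.ext_ring ?_
    have := key (t.1 r) t (t.2.1 r)
    rw [setSite_self] at this
    simpa using this

theorem siteR_comm_wShift (q : K) (r : ZMod n) {w : Idx n → K} {σ : Idx n → Idx n}
    (h1 : ∀ t, (σ t).1 r = t.1 r) (h2 : ∀ t, (σ t).2.1 r = t.2.1 r) (h3 : ∀ t, (σ t).2.2 = t.2.2)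
    (hw : ∀ t a b c, w (setSite r t a b c) = w t)
    (hσ : ∀ t a b c, σ (setSite r t a b c) = setSite r (σ t) a b c) :
    siteR q r * wShift w σ = wShift w σ * siteR q r := by
  refine Finsupp.lhom_ext' fun t => LinearMap.ext_ring ?_
  simp only [LinearMap.comp_apply, Finsupp.lsingle_apply, Module.End.mul_apply, wShift_single,
    siteR, Finsupp.linearCombination_single, h1, h2, h3, one_smul, one_mul, map_sum]
  rw [Finset.smul_sum]
  refine Finset.sum_congr rfl fun a _ => ?_
  rw [Finset.smul_sum]
  refine Finset.sum_congr rfl fun b _ => ?_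
  rw [Finset.smul_sum]
  refine Finset.sum_congr rfl fun c _ => ?_
  have e1 := hw t a b c
  have e2 := hσ t a b c
  simp only [setSite] at e1 e2
  rw [e1, e2, Finsupp.smul_single, smul_eq_mul, mul_comm]

theorem siteR_comm_ladderA (hq : q ≠ 0) {r s : ZMod n} (h : s ≠ r) :
    Commute (siteR q r) (siteTriple hq s).A.p ∧ Commute (siteR q r) (siteTriple hq s).A.m ∧
      Commute (siteR q r) (siteTriple hq s).A.k := by
  have e1 (f : ZMod n → ℕ) (a : ℕ) :
      Function.update f r a + Pi.single s 1 = Function.update (f + Pi.single s 1) r a := by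
    funext u
    by_cases hu : u = r
    · subst hu; simp [h.symm]
    · simp [hu]
  have e2 (f : ZMod n → ℕ) (a : ℕ) :
      Function.update f r a - Pi.single s 1 = Function.update (f - Pi.single s 1) r a := by
    funext u
    by_cases hu : u = r
    · subst hu; simp [h.symm]
    · simp [hu]
  refine ⟨siteR_comm_wShift q r ?_ ?_ ?_ ?_ ?_, siteR_comm_wShift q r ?_ ?_ ?_ ?_ ?_,
    siteR_comm_wShift q r ?_ ?_ ?_ ?_ ?_⟩ <;> intros <;>
  simp [ladderA, setSite, h, h.symm, e1, e2]

theorem siteR_comm_ladderB (hq : q ≠ 0) {r s : ZMod n} (h : s ≠ r) :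
    Commute (siteR q r) (siteTriple hq s).B.p ∧ Commute (siteR q r) (siteTriple hq s).B.m ∧
      Commute (siteR q r) (siteTriple hq s).B.k := by
  have e1 (f : ZMod n → ℕ) (a : ℕ) :
      Function.update f r a + Pi.single s 1 = Function.update (f + Pi.single s 1) r a := by
    funext u
    by_cases hu : u = r
    · subst hu; simp [h.symm]
    · simp [hu]
  have e2 (f : ZMod n → ℕ) (a : ℕ) :
      Function.update f r a - Pi.single s 1 = Function.update (f - Pi.single s 1) r a := by
    funext u
    by_cases hu : u = r
    · subst hu; simp [h.symm]
    · simp [hu]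
  refine ⟨siteR_comm_wShift q r ?_ ?_ ?_ ?_ ?_, siteR_comm_wShift q r ?_ ?_ ?_ ?_ ?_,
    siteR_comm_wShift q r ?_ ?_ ?_ ?_ ?_⟩ <;> intros <;>
  simp [ladderB, setSite, h, h.symm, e1, e2]

end SiteThreeDR

/-! ### Intertwining relations of the monodromy -/

section LocalRelations

variable {K E : Type*} [Field K] [Ring E] [Algebra K E] {q : K}

/-- Exchange relations of two consecutive factors of the monodromy: the operators `R`, `R'` of two
sites, the oscillators `a`, `b` (`a'`, `b'`) with number operators `ak`, `bk` (`ak'`, `bk'`) of the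
sites, and the oscillator `u`, `v`, `ck` of the third factor. -/
structure SiteExchange (q : K) (R R' a b ak bk a' b' ak' bk' u v ck : E) : Prop where
  R'_b' : R' * b' = (a' * u - q • (ak' * ck * b')) * R'
  R'_a' : R' * (bk' * a') = (ck * a' + ak' * b' * v) * R'
  R_a : R * (ck * a + ak * b * u) = bk * a * R
  R_b : R * (a * v - q • (ak * ck * b)) = b * R
  R'_comm_a : Commute R' a
  R'_comm_b : Commute R' b
  R'_comm_ak : Commute R' ak
  R'_comm_bk : Commute R' bk
  R_comm_a' : Commute R a'
  R_comm_b' : Commute R b'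
  R_comm_ak' : Commute R ak'
  R_comm_bk' : Commute R bk'
  u_a' : Commute u a'
  v_ak' : Commute v ak'
  v_b' : Commute v b'
  ck_a : Commute ck a
  ck_b : Commute ck b
  ck_ak' : Commute ck ak'
  a'_a : Commute a' a
  a'_bk : Commute a' bk
  b'_b : Commute b' b
  b'_ak : Commute b' ak
  bk'_a : Commute bk' a
  ak'_b : Commute ak' b

namespace SiteExchange

variable {R R' a b ak bk a' b' ak' bk' u v ck : E}

/-- `R'` turns `b'` and `bk' * a'` into combinations involving the third factor. Sorted by their
primed part, `a'` or `ak' * b'`, the resulting terms contain exactly the two combinations of `a`,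
`b`, `u`, `v`, `ck` that `R` converts into `bk * a` and `b`, free of the third factor. -/
theorem interior (h : SiteExchange q R R' a b ak bk a' b' ak' bk' u v ck) :
    R * R' * (ak * b * b' + a * bk' * a') = (bk * a * a' + b * ak' * b') * (R * R') := by
  have e1 : R' * (ak * b * b') = (ak * b * u * a' - q • (ak * ck * b * ak' * b')) * R' := by
    rw [← mul_assoc, ← mul_assoc, h.R'_comm_ak.eq, mul_assoc ak, h.R'_comm_b.eq, mul_assoc,
      mul_assoc, h.R'_b', ← mul_assoc, ← mul_assoc, mul_sub, mul_smul_comm,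
      ← h.u_a'.eq, ← h.ck_ak'.eq, mul_assoc ak ck b, h.ck_b.eq]
    simp only [mul_assoc]
  have e2 : R' * (a * bk' * a') = (ck * a * a' + a * v * ak' * b') * R' := by
    rw [mul_assoc a, ← mul_assoc, h.R'_comm_a.eq, mul_assoc, h.R'_a', ← mul_assoc, mul_add,
      h.ck_a.eq, mul_assoc a v, h.v_ak'.eq, mul_assoc ak' b', ← h.v_b'.eq]
    simp only [mul_assoc]
  have e3 : R * R' * (ak * b * b' + a * bk' * a')
      = R * (ck * a + ak * b * u) * a' * R'
        + R * (a * v - q • (ak * ck * b)) * (ak' * b') * R' := by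
    rw [mul_assoc, mul_add, e1, e2]
    simp only [mul_add, add_mul, mul_sub, sub_mul, smul_mul_assoc, mul_smul_comm, mul_assoc]
    abel
  rw [e3, h.R_a, h.R_b, mul_assoc _ R a', h.R_comm_a'.eq, mul_assoc _ R (ak' * b'),
    (h.R_comm_ak'.mul_right h.R_comm_b').eq]
  simp only [add_mul, mul_assoc]

/-- The mechanism of `interior` when `R'` is at the left end and `R` at the right end, with `B`
between them. The third-factor operators released by `R'` appear on the far left; `hu`, `hv` and
`hck` carry them around the trace to the right of `R`, exchanging the weights `p₁` and `p₂` for `u`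
and `v`. -/
theorem wrap (h : SiteExchange q R R' a b ak bk a' b' ak' bk' u v ck) {B : E}
    (ha : Commute B a) (hb : Commute B b) (hbk : Commute B bk)
    (ha' : Commute B a') (hb' : Commute B b') (hbk' : Commute B bk')
    {P : Type*} [CommRing P] [Algebra K P] (τ : E →ₗ[K] P) {p₁ p₂ : P}
    (hu : ∀ Y, p₁ * τ (u * Y) = p₂ * τ (Y * u)) (hv : ∀ Y, p₂ * τ (v * Y) = p₁ * τ (Y * v))
    (hck : ∀ Y, τ (ck * Y) = τ (Y * ck)) :
    p₁ * τ (R' * B * R * (ak * b * b')) + p₂ * τ (R' * B * R * (a * bk' * a'))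
      = p₂ * τ (bk * a * a' * (R' * B * R)) + p₁ * τ (b * ak' * b' * (R' * B * R)) := by
  obtain ⟨M, hM⟩ : ∃ M, M = R' * B * R := ⟨_, rfl⟩
  rw [← hM]
  -- `e1` and `e2` carry the primed operators leftwards through `R` and `B` up to `R'`, so that `u`,
  -- `v`, `ck` come out at the front.
  have e1 : M * (ak * b * b')
      = u * (a' * M * (ak * b)) - q • (ck * (ak' * b' * M * (ak * b))) := by
    rw [(h.b'_ak.symm.mul_left h.b'_b.symm).eq, ← mul_assoc, hM, mul_assoc _ R b', h.R_comm_b'.eq,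
      ← mul_assoc (R' * B) b' R, mul_assoc R' B b', hb'.eq, ← mul_assoc R' b' B, h.R'_b', ← h.u_a'.eq, ← h.ck_ak'.eq]
    simp only [mul_assoc, sub_mul, smul_mul_assoc]
  have e2 : M * (a * bk' * a') = ck * (a' * M * a) + v * (ak' * b' * M * a) := by
    rw [← h.bk'_a.eq, mul_assoc bk', ← h.a'_a.eq, ← mul_assoc bk', ← mul_assoc M, hM,
      mul_assoc _ R, (h.R_comm_bk'.mul_right h.R_comm_a').eq, ← mul_assoc, mul_assoc R' B,
      (hbk'.mul_right ha').eq, ← mul_assoc, h.R'_a', mul_assoc ak' b' v, ← h.v_b'.eq,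
      ← mul_assoc ak', ← h.v_ak'.eq]
    simp only [mul_assoc, add_mul]
  -- `e3` and `e4` are the absorption by `R`: the third factor disappears and the unprimed operators
  -- pass `B` and `R'`.
  have e3 : M * (ck * a + ak * b * u) = bk * a * M := by
    rw [hM, mul_assoc, h.R_a, ← mul_assoc, mul_assoc R' B, (hbk.mul_right ha).eq, ← mul_assoc,
      (h.R'_comm_bk.mul_right h.R'_comm_a).eq]
    simp only [mul_assoc]
  have e4 : M * (a * v - q • (ak * ck * b)) = b * M := by
    rw [hM, mul_assoc, h.R_b, ← mul_assoc, mul_assoc R' B, hb.eq, ← mul_assoc, h.R'_comm_b.eq]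
    simp only [mul_assoc]
  have e5 : bk * a * a' * M = a' * (M * (ck * a + ak * b * u)) := by
    rw [e3, ← mul_assoc, (h.a'_bk.mul_right h.a'_a).eq]
  have e6 : b * ak' * b' * M = ak' * b' * (M * (a * v - q • (ak * ck * b))) := by
    rw [e4, ← mul_assoc, (h.ak'_b.mul_left h.b'_b).eq, mul_assoc b]
  have c1 : a' * M * a * ck = a' * M * (ck * a) := by rw [h.ck_a.eq, mul_assoc (a' * M)]
  have c2 : ak' * b' * M * (ak * b) * ck = ak' * b' * M * (ak * ck * b) := by
    rw [mul_assoc ak ck, h.ck_b.eq]; simp only [mul_assoc]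
  rw [e1, e2, e5, e6, map_sub, map_smul, map_add, hck, hck, mul_sub, mul_add, hu, hv, c1, c2]
  simp only [← mul_assoc, mul_add, mul_sub, map_add, map_sub, mul_smul_comm, map_smul]
  ring

end SiteExchange

end LocalRelations

/-! ### Exchange relations of concrete sites, and the position of adjacent sites in the monodromy.
-/

section Monodromy

variable {K : Type*} [Field K] {q : K} {n : ℕ}

theorem ladderA_commutes {r s : ZMod n} (h : r ≠ s) : (ladderA r).Commutes (ladderA s) := by
  have h1 : (Pi.single r 1 : ZMod n → ℕ) s = 0 := Pi.single_eq_of_ne h.symm _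
  have h2 : (Pi.single s 1 : ZMod n → ℕ) r = 0 := Pi.single_eq_of_ne h _
  constructor <;> intro t <;>
    simp only [ladderA, Pi.add_apply, Pi.sub_apply, h1, h2, add_zero, Nat.sub_zero] <;>
    refine Prod.ext (funext fun u => ?_) rfl <;>
    by_cases hr : u = r <;> by_cases hs : u = s <;> simp_all

theorem ladderB_commutes {r s : ZMod n} (h : r ≠ s) : (ladderB r).Commutes (ladderB s) := by
  have h1 : (Pi.single r 1 : ZMod n → ℕ) s = 0 := Pi.single_eq_of_ne h.symm _
  have h2 : (Pi.single s 1 : ZMod n → ℕ) r = 0 := Pi.single_eq_of_ne h _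
  constructor <;> intro t <;>
    simp only [ladderB, Pi.add_apply, Pi.sub_apply, h1, h2, add_zero, Nat.sub_zero] <;>
    refine Prod.ext rfl (Prod.ext (funext fun u => ?_) rfl) <;>
    by_cases hr : u = r <;> by_cases hs : u = s <;> simp_all

theorem ladderA_commutes_ladderB (r s : ZMod n) : (ladderA r).Commutes (ladderB s) := by
  constructor <;> intro _ <;> rfl

/-- `e_r` moves a quantum from `r` to `r + 1`, so it uses annihilation operators at `r` and creation
operators at `s`; correspondingly `u` creates and `v` annihilates in the third factor. For `f_r` all
these roles are reversed. -/
theorem exchange_e (hq : IsGeneric q) {r s : ZMod n} (h : r ≠ s) :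
    SiteExchange q (siteR q r) (siteR q s) (siteTriple hq.1 r).A.m (siteTriple hq.1 r).B.m
      (siteTriple hq.1 r).A.k (siteTriple hq.1 r).B.k (siteTriple hq.1 s).A.p
      (siteTriple hq.1 s).B.p (siteTriple hq.1 s).A.k (siteTriple hq.1 s).B.k
      (siteTriple hq.1 r).C.p (siteTriple hq.1 r).C.m (siteTriple hq.1 r).C.k where
  R'_b' := (siteR_isThreeDR hq s).R_p
  R'_a' := (siteR_isThreeDR hq s).R_kp
  R_a := (siteR_isThreeDR hq r).R_Xb hq.1
  R_b := (siteR_isThreeDR hq r).R_Yb hq.1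
  R'_comm_a := (siteR_comm_ladderA hq.1 h).2.1
  R'_comm_b := (siteR_comm_ladderB hq.1 h).2.1
  R'_comm_ak := (siteR_comm_ladderA hq.1 h).2.2
  R'_comm_bk := (siteR_comm_ladderB hq.1 h).2.2
  R_comm_a' := (siteR_comm_ladderA hq.1 h.symm).1
  R_comm_b' := (siteR_comm_ladderB hq.1 h.symm).1
  R_comm_ak' := (siteR_comm_ladderA hq.1 h.symm).2.2
  R_comm_bk' := (siteR_comm_ladderB hq.1 h.symm).2.2
  u_a' := (siteTriple hq.1 s).hAC.cpp
  v_ak' := (siteTriple hq.1 s).hAC.cmk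
  v_b' := (siteTriple hq.1 s).hBC.cmp
  ck_a := (siteTriple hq.1 r).hAC.ckm
  ck_b := (siteTriple hq.1 r).hBC.ckm
  ck_ak' := (siteTriple hq.1 s).hAC.ckk
  a'_a := ((ladderA_commutes h).osc hq.1).cpm
  a'_bk := Commute.symm ((ladderA_commutes_ladderB s r).osc hq.1).ckp
  b'_b := ((ladderB_commutes h).osc hq.1).cpm
  b'_ak := ((ladderA_commutes_ladderB r s).osc hq.1).cpk
  bk'_a := ((ladderA_commutes_ladderB r s).osc hq.1).ckm
  ak'_b := Commute.symm ((ladderA_commutes_ladderB s r).osc hq.1).cmk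

theorem exchange_f (hq : IsGeneric q) {r s : ZMod n} (h : r ≠ s) :
    SiteExchange q (siteR q r) (siteR q s) (siteTriple hq.1 r).A.p (siteTriple hq.1 r).B.p
      (siteTriple hq.1 r).A.k (siteTriple hq.1 r).B.k (siteTriple hq.1 s).A.m
      (siteTriple hq.1 s).B.m (siteTriple hq.1 s).A.k (siteTriple hq.1 s).B.k
      (siteTriple hq.1 r).C.m (siteTriple hq.1 r).C.p (siteTriple hq.1 r).C.k where
  R'_b' := (siteR_isThreeDR hq s).R_m hq.1
  R'_a' := (siteR_isThreeDR hq s).R_km hq.1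
  R_a := (siteR_isThreeDR hq r).R_X hq.1
  R_b := (siteR_isThreeDR hq r).R_Y hq.1
  R'_comm_a := (siteR_comm_ladderA hq.1 h).1
  R'_comm_b := (siteR_comm_ladderB hq.1 h).1
  R'_comm_ak := (siteR_comm_ladderA hq.1 h).2.2
  R'_comm_bk := (siteR_comm_ladderB hq.1 h).2.2
  R_comm_a' := (siteR_comm_ladderA hq.1 h.symm).2.1
  R_comm_b' := (siteR_comm_ladderB hq.1 h.symm).2.1
  R_comm_ak' := (siteR_comm_ladderA hq.1 h.symm).2.2
  R_comm_bk' := (siteR_comm_ladderB hq.1 h.symm).2.2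
  u_a' := (siteTriple hq.1 s).hAC.cmm
  v_ak' := (siteTriple hq.1 s).hAC.cpk
  v_b' := (siteTriple hq.1 s).hBC.cpm
  ck_a := (siteTriple hq.1 r).hAC.ckp
  ck_b := (siteTriple hq.1 r).hBC.ckp
  ck_ak' := (siteTriple hq.1 s).hAC.ckk
  a'_a := ((ladderA_commutes h).osc hq.1).cmp
  a'_bk := Commute.symm ((ladderA_commutes_ladderB s r).osc hq.1).ckm
  b'_b := ((ladderB_commutes h).osc hq.1).cmp
  b'_ak := ((ladderA_commutes_ladderB r s).osc hq.1).cmk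
  bk'_a := ((ladderA_commutes_ladderB r s).osc hq.1).ckp
  ak'_b := Commute.symm ((ladderA_commutes_ladderB s r).osc hq.1).cpk

theorem natCast_succ_injOn {i j : ℕ} (hi : i < n) (hj : j < n)
    (h : ((i + 1 : ℕ) : ZMod n) = ((j + 1 : ℕ) : ZMod n)) : i = j := by
  rw [Nat.cast_succ, Nat.cast_succ, add_left_inj, ZMod.natCast_eq_natCast_iff',
    Nat.mod_eq_of_lt hi, Nat.mod_eq_of_lt hj] at h
  exact h

theorem commute_prod_siteR (q : K) {Z : Module.End K (Idx n →₀ K)} (L : List ℕ)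
    (h : ∀ i ∈ L, Commute (siteR q ((i + 1 : ℕ) : ZMod n)) Z) :
    Commute ((L.map fun i => siteR q ((i + 1 : ℕ) : ZMod n)).prod) Z := by
  induction L with
  | nil => exact Commute.one_left Z
  | cons i L ih =>
    rw [List.map_cons, List.prod_cons]
    exact (h i (by simp)).mul_left (ih fun j hj => h j (by simp [hj]))

/-- Site `0` is the site `n` and comes last in the product, so for `r ≠ 0` the factors of `r` and `r
+ 1` are neighbours. The outer factors involve only other sites, hence commute with anything their
site operators commute with. -/
theorem monodromy_interior (q : K) [NeZero n] {r : ZMod n} (hr : r ≠ 0) :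
    ∃ A B : Module.End K (Idx n →₀ K), monodromy q n = A * (siteR q r * siteR q (r + 1)) * B ∧
      ∀ Z, (∀ s, s ≠ r → s ≠ r + 1 → Commute (siteR q s) Z) → Commute A Z ∧ Commute B Z := by
  -- List position `v` carries the site `v + 1`.
  obtain ⟨v, hv⟩ : ∃ v, r.val = v + 1 :=
    ⟨r.val - 1, by have := (ZMod.val_eq_zero r).not.2 hr; omega⟩
  obtain ⟨w, hw⟩ : ∃ w, n = v + (2 + w) := ⟨n - v - 2, by have := ZMod.val_lt r; omega⟩
  have hr' : ((v + 1 : ℕ) : ZMod n) = r := by rw [← hv, ZMod.natCast_zmod_val]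
  have hr1 : (((v + 1) + 1 : ℕ) : ZMod n) = r + 1 := by rw [Nat.cast_succ, hr']
  have hlist : List.range n = List.range v ++ [v, v + 1]
      ++ (List.range w).map fun i => v + 2 + i := by
    nth_rw 1 [hw]
    rw [List.range_add, List.range_add, List.map_append, List.map_map, List.append_assoc]
    simp [List.range_succ, Function.comp_def, add_assoc]
  refine ⟨((List.range v).map fun i => siteR q ((i + 1 : ℕ) : ZMod n)).prod,
    (((List.range w).map fun i => v + 2 + i).map fun i => siteR q ((i + 1 : ℕ) : ZMod n)).prod,
    ?_, fun Z hZ => ⟨commute_prod_siteR q _ fun i hi => ?_, commute_prod_siteR q _ fun i hi => ?_⟩⟩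
  · rw [monodromy, hlist, List.map_append, List.map_append, List.prod_append, List.prod_append]
    simp only [List.map_cons, List.map_nil, List.prod_cons, List.prod_nil, mul_one, hr', hr1]
  · rw [List.mem_range] at hi
    refine hZ _ (fun h => ?_) fun h => ?_
    · have := natCast_succ_injOn (by omega) (by omega) (h.trans hr'.symm); omega
    · have := natCast_succ_injOn (by omega) (by omega) (h.trans hr1.symm); omega
  · rw [List.mem_map] at hi
    obtain ⟨j, hj, rfl⟩ := hi
    rw [List.mem_range] at hj
    refine hZ _ (fun h => ?_) fun h => ?_
    · have := natCast_succ_injOn (by omega) (by omega) (h.trans hr'.symm); omega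
    · have := natCast_succ_injOn (by omega) (by omega) (h.trans hr1.symm); omega

/-- The remaining adjacent pair: site `1` is the first factor and site `n`, that is `0`, the last.
-/
theorem monodromy_wrap (q : K) (hn : 2 ≤ n) :
    ∃ B : Module.End K (Idx n →₀ K), monodromy q n = siteR q (0 + 1) * B * siteR q 0 ∧
      ∀ Z, (∀ s, s ≠ 0 → s ≠ 0 + 1 → Commute (siteR q s) Z) → Commute B Z := by
  obtain ⟨w, rfl⟩ : ∃ w, n = 1 + (w + 1) := ⟨n - 2, by omega⟩
  have h0 : (((w + 1) + 1 : ℕ) : ZMod (1 + (w + 1))) = 0 := by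
    rw [add_comm (w + 1) 1, ZMod.natCast_self]
  have h1 : ((0 + 1 : ℕ) : ZMod (1 + (w + 1))) = 0 + 1 := by simp
  have hlist : List.range (1 + (w + 1)) = [0] ++ (List.range w).map (fun i => 1 + i)
      ++ [w + 1] := by
    rw [List.range_add]
    simp [List.range_succ, add_comm]
  refine ⟨(((List.range w).map fun i => 1 + i).map
    fun i => siteR q ((i + 1 : ℕ) : ZMod (1 + (w + 1)))).prod, ?_,
    fun Z hZ => commute_prod_siteR q _ fun i hi => ?_⟩
  · rw [monodromy, hlist, List.map_append, List.map_append, List.prod_append, List.prod_append]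
    simp only [List.map_cons, List.map_nil, List.prod_cons, List.prod_nil, mul_one, h0, h1]
  · rw [List.mem_map] at hi
    obtain ⟨j, hj, rfl⟩ := hi
    rw [List.mem_range] at hj
    refine hZ _ (fun h => ?_) fun h => ?_
    · have := natCast_succ_injOn (by omega) (by omega) (h.trans h0.symm); omega
    · have := natCast_succ_injOn (by omega) (by omega) (h.trans h1.symm); omega

end Monodromy

/-! ### Trace relations -/

section Trace

variable {K : Type*} [Field K] {q : K} {n : ℕ}

/-- Lowering maps with truncated subtraction are not injective; it is enough that `u` is the only
preimage of `s` carrying a nonzero weight. -/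
theorem wShift_apply {ι : Type*} {w : ι → K} {σ : ι → ι} {s u : ι} (h1 : σ u = s)
    (h2 : ∀ t, w t ≠ 0 → σ t = s → t = u) (v : ι →₀ K) : wShift w σ v s = w u * v u := by
  suffices h : Finsupp.lapply s ∘ₗ wShift w σ = w u • Finsupp.lapply u from
    LinearMap.congr_fun h v
  refine Finsupp.lhom_ext fun t c => ?_
  simp only [LinearMap.comp_apply, wShift_single, LinearMap.smul_apply, Finsupp.lapply_apply,
    smul_eq_mul]
  by_cases ht : t = u
  · subst ht
    rw [h1, Finsupp.single_eq_same, Finsupp.single_eq_same, mul_comm]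
  · rw [Finsupp.single_eq_of_ne (Ne.symm ht), mul_zero]
    by_cases hw : w t = 0
    · rw [hw, mul_zero, Finsupp.single_zero, Finsupp.zero_apply]
    · exact Finsupp.single_eq_of_ne fun h => ht (h2 t hw h.symm)

theorem wShift_apply_eq_zero {ι : Type*} {w : ι → K} {σ : ι → ι} {s : ι}
    (h : ∀ t, w t ≠ 0 → σ t ≠ s) (v : ι →₀ K) : wShift w σ v s = 0 := by
  suffices h : Finsupp.lapply s ∘ₗ wShift w σ = 0 from LinearMap.congr_fun h v
  refine Finsupp.lhom_ext fun t c => ?_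
  simp only [LinearMap.comp_apply, wShift_single, LinearMap.zero_apply, Finsupp.lapply_apply]
  by_cases hw : w t = 0
  · rw [hw, mul_zero, Finsupp.single_zero, Finsupp.zero_apply]
  · exact Finsupp.single_eq_of_ne (h t hw).symm

namespace Ladder

variable {ι : Type*} (L : Ladder ι) (hq : q ≠ 0) (v : ι →₀ K) (s : ι)

theorem osc_p_apply : (L.osc hq).p v s = if L.N s = 0 then 0 else v (L.down s) := by
  split_ifs with h
  · refine wShift_apply_eq_zero (fun t _ ht => ?_) v
    rw [← ht, L.N_up] at h
    omega
  · refine (wShift_apply (L.up_down s h) (fun t _ ht => ?_) v).trans (one_mul _)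
    rw [← ht, L.down_up]

theorem osc_m_apply : (L.osc hq).m v s = (1 - (q ^ 2) ^ (L.N s + 1)) * v (L.up s) := by
  rw [← L.N_up]
  refine wShift_apply (L.down_up s) (fun t ht h => ?_) v
  rw [← h, L.up_down]
  intro h0
  simp [h0] at ht

theorem osc_k_apply : (L.osc hq).k v s = q ^ L.N s * v s :=
  wShift_apply rfl (fun _ _ h => h) v

theorem osc_p_single (t : ι) (c : K) :
    (L.osc hq).p (Finsupp.single t c) = Finsupp.single (L.up t) c := by
  simp [osc, wShift_single]

theorem osc_m_single (t : ι) (c : K) : (L.osc hq).m (Finsupp.single t c)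
    = Finsupp.single (L.down t) (c * (1 - (q ^ 2) ^ L.N t)) := wShift_single _ _ _ _

theorem osc_k_single (t : ι) (c : K) : (L.osc hq).k (Finsupp.single t c)
    = Finsupp.single t (c * q ^ L.N t) := wShift_single _ _ _ _

end Ladder

/-- The matrix element `Tr_3 (z^{h_3} X)^{a,b}_{i,j}` as a linear function of the operator `X`. -/
def trFun (K : Type*) [Field K] {n : ℕ} (a b i j : ZMod n → ℕ) :
    Module.End K (Idx n →₀ K) →ₗ[K] PowerSeries K where
  toFun Y := PowerSeries.mk fun c => Y (Finsupp.single (i, j, c) 1) (a, b, c)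
  map_add' Y Y' := by ext c; simp
  map_smul' x Y := by ext c; simp

theorem coeff_trFun (a b i j : ZMod n → ℕ) (Y : Module.End K (Idx n →₀ K)) (c : ℕ) :
    PowerSeries.coeff c (trFun K a b i j Y) = Y (Finsupp.single (i, j, c) 1) (a, b, c) := by
  simp [trFun]

theorem single_eq_smul {ι : Type*} (t : ι) (w : K) :
    Finsupp.single t w = w • Finsupp.single t 1 := by
  rw [Finsupp.smul_single, smul_eq_mul, mul_one]

/-- Cyclicity of the trace together with `z ^ h * C.p = z * C.p * z ^ h`. The annihilation operator
gives the inverse factor, written in `trFun_Cm` with `z` on the other side. -/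
theorem trFun_Cp (hq : q ≠ 0) (r : ZMod n) (a b i j : ZMod n → ℕ)
    (Y : Module.End K (Idx n →₀ K)) :
    trFun K a b i j ((siteTriple hq r).C.p * Y)
      = PowerSeries.X * trFun K a b i j (Y * (siteTriple hq r).C.p) := by
  ext c
  rw [coeff_trFun, Module.End.mul_apply, siteTriple, Ladder.osc_p_apply]
  cases c with
  | zero => simp [ladderC]
  | succ c =>
    rw [PowerSeries.coeff_succ_X_mul, coeff_trFun, Module.End.mul_apply, Ladder.osc_p_single]
    simp [ladderC]

theorem trFun_Cm (hq : q ≠ 0) (r : ZMod n) (a b i j : ZMod n → ℕ)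
    (Y : Module.End K (Idx n →₀ K)) :
    PowerSeries.X * trFun K a b i j ((siteTriple hq r).C.m * Y)
      = trFun K a b i j (Y * (siteTriple hq r).C.m) := by
  ext c
  rw [coeff_trFun, Module.End.mul_apply, siteTriple, Ladder.osc_m_single, one_mul,
    single_eq_smul, map_smul, Finsupp.smul_apply]
  cases c with
  | zero => simp [ladderC]
  | succ c =>
    rw [PowerSeries.coeff_succ_X_mul, coeff_trFun, Module.End.mul_apply, Ladder.osc_m_apply]
    simp [ladderC]

theorem trFun_Ck (hq : q ≠ 0) (r : ZMod n) (a b i j : ZMod n → ℕ)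
    (Y : Module.End K (Idx n →₀ K)) :
    trFun K a b i j ((siteTriple hq r).C.k * Y)
      = trFun K a b i j (Y * (siteTriple hq r).C.k) := by
  ext c
  rw [coeff_trFun, coeff_trFun, Module.End.mul_apply, Module.End.mul_apply, siteTriple,
    Ladder.osc_k_single, Ladder.osc_k_apply, one_mul,
    single_eq_smul _ (q ^ _), map_smul, Finsupp.smul_apply, smul_eq_mul]
  rfl

/-- Moving a quantum from site `r` to site `s`. -/
abbrev hop (r s : ZMod n) (m : ZMod n → ℕ) : ZMod n → ℕ := m - Pi.single r 1 + Pi.single s 1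

theorem hop_eq {r s : ZMod n} (h : r ≠ s) (m : ZMod n → ℕ) :
    m + Pi.single s 1 - Pi.single r 1 = hop r s m := by
  funext u
  by_cases hr : u = r
  · subst hr; simp [Pi.single_eq_of_ne h]
  · simp [hr]

theorem trFun_mul_of_single {a b i j i' j' : ZMod n → ℕ} {Y D : Module.End K (Idx n →₀ K)} {w : K}
    (h : ∀ c, D (Finsupp.single (i, j, c) 1) = Finsupp.single (i', j', c) w) :
    trFun K a b i j (Y * D) = w • trFun K a b i' j' Y := by
  ext c
  rw [coeff_trFun, Module.End.mul_apply, h, PowerSeries.coeff_smul, coeff_trFun,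
    single_eq_smul, map_smul, Finsupp.smul_apply]

theorem trFun_mul_of_apply {a b i j a' b' : ZMod n → ℕ} {Y D : Module.End K (Idx n →₀ K)} {w : K}
    (h : ∀ v c, D v (a, b, c) = w * v (a', b', c)) :
    trFun K a b i j (D * Y) = w • trFun K a' b' i j Y := by
  ext c
  rw [coeff_trFun, Module.End.mul_apply, h, PowerSeries.coeff_smul, coeff_trFun, smul_eq_mul]

theorem trFun_mul_of_apply_zero {a b i j : ZMod n → ℕ} {Y D : Module.End K (Idx n →₀ K)}
    (h : ∀ v c, D v (a, b, c) = 0) : trFun K a b i j (D * Y) = 0 := by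
  ext c
  rw [coeff_trFun, Module.End.mul_apply, h, map_zero]

section Evaluation

variable (hq : q ≠ 0) {r s : ZMod n} (a b i j : ZMod n → ℕ) (Y : Module.End K (Idx n →₀ K))

theorem trFun_mul_AkBmBp (h : r ≠ s) :
    trFun K a b i j (Y * ((siteTriple hq r).A.k * (siteTriple hq r).B.m * (siteTriple hq s).B.p))
      = (q ^ i r * (1 - (q ^ 2) ^ j r)) • trFun K a b i (hop r s j) Y :=
  trFun_mul_of_single fun c => by
    simp only [Module.End.mul_apply, siteTriple, Ladder.osc_p_single, Ladder.osc_m_single,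
      Ladder.osc_k_single]
    simp [ladderA, ladderB, hop_eq h, Pi.single_eq_of_ne h, mul_comm]

theorem trFun_mul_AmBkAp (h : r ≠ s) :
    trFun K a b i j (Y * ((siteTriple hq r).A.m * (siteTriple hq s).B.k * (siteTriple hq s).A.p))
      = (q ^ j s * (1 - (q ^ 2) ^ i r)) • trFun K a b (hop r s i) j Y :=
  trFun_mul_of_single fun c => by
    simp only [Module.End.mul_apply, siteTriple, Ladder.osc_p_single, Ladder.osc_m_single,
      Ladder.osc_k_single]
    simp [ladderA, ladderB, hop_eq h, Pi.single_eq_of_ne h, mul_comm]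

theorem trFun_mul_AkBpBm :
    trFun K a b i j (Y * ((siteTriple hq r).A.k * (siteTriple hq r).B.p * (siteTriple hq s).B.m))
      = (q ^ i r * (1 - (q ^ 2) ^ j s)) • trFun K a b i (hop s r j) Y :=
  trFun_mul_of_single fun c => by
    simp only [Module.End.mul_apply, siteTriple, Ladder.osc_p_single, Ladder.osc_m_single,
      Ladder.osc_k_single]
    simp [ladderA, ladderB, mul_comm]

theorem trFun_mul_ApBkAm :
    trFun K a b i j (Y * ((siteTriple hq r).A.p * (siteTriple hq s).B.k * (siteTriple hq s).A.m))
      = (q ^ j s * (1 - (q ^ 2) ^ i s)) • trFun K a b (hop s r i) j Y :=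
  trFun_mul_of_single fun c => by
    simp only [Module.End.mul_apply, siteTriple, Ladder.osc_p_single, Ladder.osc_m_single,
      Ladder.osc_k_single]
    simp [ladderA, ladderB, mul_comm]

/-- An operator on the left is evaluated through the preimage of `a` under its hop. If the receiving
site `s` is empty in `a` there is no preimage, and the truncated `hop s r a` would be the wrong
label. -/
theorem trFun_BkAmAp_mul (h : r ≠ s) :
    trFun K a b i j (((siteTriple hq r).B.k * (siteTriple hq r).A.m * (siteTriple hq s).A.p) * Y)
      = if a s = 0 then 0 else (q ^ b r * (1 - (q ^ 2) ^ (a r + 1))) • trFun K (hop s r a) b i j Y := by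
  split_ifs with h0
  · refine trFun_mul_of_apply_zero fun v c => ?_
    simp only [Module.End.mul_apply, siteTriple, Ladder.osc_p_apply, Ladder.osc_m_apply,
      Ladder.osc_k_apply]
    simp [ladderA, ladderB, Pi.single_eq_of_ne h.symm, h0]
  · refine trFun_mul_of_apply fun v c => ?_
    simp only [Module.End.mul_apply, siteTriple, Ladder.osc_p_apply, Ladder.osc_m_apply,
      Ladder.osc_k_apply]
    simp [ladderA, ladderB, hop_eq h.symm, Pi.single_eq_of_ne h.symm, h0, mul_assoc]

theorem trFun_BmAkBp_mul (h : r ≠ s) :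
    trFun K a b i j (((siteTriple hq r).B.m * (siteTriple hq s).A.k * (siteTriple hq s).B.p) * Y)
      = if b s = 0 then 0 else (q ^ a s * (1 - (q ^ 2) ^ (b r + 1))) • trFun K a (hop s r b) i j Y := by
  split_ifs with h0
  · refine trFun_mul_of_apply_zero fun v c => ?_
    simp only [Module.End.mul_apply, siteTriple, Ladder.osc_p_apply, Ladder.osc_m_apply,
      Ladder.osc_k_apply]
    simp [ladderA, ladderB, Pi.single_eq_of_ne h.symm, h0]
  · refine trFun_mul_of_apply fun v c => ?_
    simp only [Module.End.mul_apply, siteTriple, Ladder.osc_p_apply, Ladder.osc_m_apply,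
      Ladder.osc_k_apply]
    simp [ladderA, ladderB, hop_eq h.symm, Pi.single_eq_of_ne h.symm, h0, mul_assoc, mul_left_comm]

theorem trFun_BkApAm_mul (h : r ≠ s) :
    trFun K a b i j (((siteTriple hq r).B.k * (siteTriple hq r).A.p * (siteTriple hq s).A.m) * Y)
      = if a r = 0 then 0 else (q ^ b r * (1 - (q ^ 2) ^ (a s + 1))) • trFun K (hop r s a) b i j Y := by
  split_ifs with h0
  · refine trFun_mul_of_apply_zero fun v c => ?_
    simp only [Module.End.mul_apply, siteTriple, Ladder.osc_p_apply, Ladder.osc_m_apply,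
      Ladder.osc_k_apply]
    simp [ladderA, ladderB, h0]
  · refine trFun_mul_of_apply fun v c => ?_
    simp only [Module.End.mul_apply, siteTriple, Ladder.osc_p_apply, Ladder.osc_m_apply,
      Ladder.osc_k_apply]
    simp [ladderA, ladderB, Pi.single_eq_of_ne h.symm, h0, mul_assoc]

theorem trFun_BpAkBm_mul (h : r ≠ s) :
    trFun K a b i j (((siteTriple hq r).B.p * (siteTriple hq s).A.k * (siteTriple hq s).B.m) * Y)
      = if b r = 0 then 0 else (q ^ a s * (1 - (q ^ 2) ^ (b s + 1))) • trFun K a (hop r s b) i j Y := by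
  split_ifs with h0
  · refine trFun_mul_of_apply_zero fun v c => ?_
    simp only [Module.End.mul_apply, siteTriple, Ladder.osc_p_apply, Ladder.osc_m_apply,
      Ladder.osc_k_apply]
    simp [ladderB, h0]
  · refine trFun_mul_of_apply fun v c => ?_
    simp only [Module.End.mul_apply, siteTriple, Ladder.osc_p_apply, Ladder.osc_m_apply,
      Ladder.osc_k_apply]
    simp [ladderA, ladderB, Pi.single_eq_of_ne h.symm, h0, mul_assoc]

end Evaluation

/-- The factor `z^{δ_{r,0}}` as a power series. -/
def wrapFactor (K : Type*) [Field K] {n : ℕ} (r : ZMod n) : PowerSeries K :=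
  if r = 0 then PowerSeries.X else 1

theorem ne_add_one (hn : 2 ≤ n) (r : ZMod n) : r ≠ r + 1 := by
  have : Fact (1 < n) := ⟨hn⟩
  simp

/-- Exchange relation of the trace with `Δ(e_r)`. -/
theorem trFun_exchange_e (hq : IsGeneric q) [NeZero n] (hn : 2 ≤ n) (r : ZMod n)
    (a b i j : ZMod n → ℕ) :
    trFun K a b i j (monodromy q n * ((siteTriple hq.1 r).A.k * (siteTriple hq.1 r).B.m
        * (siteTriple hq.1 (r + 1)).B.p))
      + wrapFactor K r * trFun K a b i j (monodromy q n * ((siteTriple hq.1 r).A.m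
        * (siteTriple hq.1 (r + 1)).B.k * (siteTriple hq.1 (r + 1)).A.p))
      = wrapFactor K r * trFun K a b i j ((siteTriple hq.1 r).B.k * (siteTriple hq.1 r).A.m
        * (siteTriple hq.1 (r + 1)).A.p * monodromy q n)
      + trFun K a b i j ((siteTriple hq.1 r).B.m * (siteTriple hq.1 (r + 1)).A.k
        * (siteTriple hq.1 (r + 1)).B.p * monodromy q n) := by
  have hex := exchange_e hq (ne_add_one hn r)
  by_cases hr : r = 0
  · obtain ⟨B, hM, hB⟩ := monodromy_wrap q hn
    rw [wrapFactor, if_pos hr]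
    subst hr
    -- For `e_0` the weight `z` sits on the terms in which the first tensor factor hops, in
    -- accordance with `x = y * z`.
    have := hex.wrap (B := B)
      (hB _ fun s h1 h2 => (siteR_comm_ladderA hq.1 h1.symm).2.1)
      (hB _ fun s h1 h2 => (siteR_comm_ladderB hq.1 h1.symm).2.1)
      (hB _ fun s h1 h2 => (siteR_comm_ladderB hq.1 h1.symm).2.2)
      (hB _ fun s h1 h2 => (siteR_comm_ladderA hq.1 h2.symm).1)
      (hB _ fun s h1 h2 => (siteR_comm_ladderB hq.1 h2.symm).1)
      (hB _ fun s h1 h2 => (siteR_comm_ladderB hq.1 h2.symm).2.2)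
      (trFun K a b i j) (p₁ := 1) (p₂ := PowerSeries.X)
      (fun Y => by rw [one_mul]; exact trFun_Cp hq.1 0 a b i j Y)
      (fun Y => by rw [one_mul]; exact trFun_Cm hq.1 0 a b i j Y)
      (fun Y => trFun_Ck hq.1 0 a b i j Y)
    rwa [← hM, one_mul, one_mul] at this
  · obtain ⟨A, B, hM, hAB⟩ := monodromy_interior q hr
    rw [wrapFactor, if_neg hr, one_mul, one_mul, ← map_add, ← map_add, ← mul_add, ← add_mul]
    congr 1
    have hD : Commute B ((siteTriple hq.1 r).A.k * (siteTriple hq.1 r).B.m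
        * (siteTriple hq.1 (r + 1)).B.p + (siteTriple hq.1 r).A.m
        * (siteTriple hq.1 (r + 1)).B.k * (siteTriple hq.1 (r + 1)).A.p) :=
      (hAB _ fun s h1 h2 => (((siteR_comm_ladderA hq.1 h1.symm).2.2.mul_right
        (siteR_comm_ladderB hq.1 h1.symm).2.1).mul_right
        (siteR_comm_ladderB hq.1 h2.symm).1).add_right
        (((siteR_comm_ladderA hq.1 h1.symm).2.1.mul_right
        (siteR_comm_ladderB hq.1 h2.symm).2.2).mul_right (siteR_comm_ladderA hq.1 h2.symm).1)).2
    have hD' : Commute A ((siteTriple hq.1 r).B.k * (siteTriple hq.1 r).A.m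
        * (siteTriple hq.1 (r + 1)).A.p + (siteTriple hq.1 r).B.m
        * (siteTriple hq.1 (r + 1)).A.k * (siteTriple hq.1 (r + 1)).B.p) :=
      (hAB _ fun s h1 h2 => (((siteR_comm_ladderB hq.1 h1.symm).2.2.mul_right
        (siteR_comm_ladderA hq.1 h1.symm).2.1).mul_right
        (siteR_comm_ladderA hq.1 h2.symm).1).add_right
        (((siteR_comm_ladderB hq.1 h1.symm).2.1.mul_right
        (siteR_comm_ladderA hq.1 h2.symm).2.2).mul_right (siteR_comm_ladderB hq.1 h2.symm).1)).1
    rw [hM, mul_assoc, hD.eq, ← mul_assoc, mul_assoc A, hex.interior, ← mul_assoc A, hD'.eq]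
    simp only [mul_assoc]

/-- Exchange relation of the trace with `Δ(f_r)`. -/
theorem trFun_exchange_f (hq : IsGeneric q) [NeZero n] (hn : 2 ≤ n) (r : ZMod n)
    (a b i j : ZMod n → ℕ) :
    wrapFactor K r * trFun K a b i j (monodromy q n * ((siteTriple hq.1 r).A.k
        * (siteTriple hq.1 r).B.p * (siteTriple hq.1 (r + 1)).B.m))
      + trFun K a b i j (monodromy q n * ((siteTriple hq.1 r).A.p
        * (siteTriple hq.1 (r + 1)).B.k * (siteTriple hq.1 (r + 1)).A.m))
      = trFun K a b i j ((siteTriple hq.1 r).B.k * (siteTriple hq.1 r).A.p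
        * (siteTriple hq.1 (r + 1)).A.m * monodromy q n)
      + wrapFactor K r * trFun K a b i j ((siteTriple hq.1 r).B.p * (siteTriple hq.1 (r + 1)).A.k
        * (siteTriple hq.1 (r + 1)).B.m * monodromy q n) := by
  have hex := exchange_f hq (ne_add_one hn r)
  by_cases hr : r = 0
  · obtain ⟨B, hM, hB⟩ := monodromy_wrap q hn
    rw [wrapFactor, if_pos hr]
    subst hr
    -- For `f_0` the weight `z` sits on the terms in which the second tensor factor hops, because
    -- `y⁻¹ = x⁻¹ * z`.
    have := hex.wrap (B := B)
      (hB _ fun s h1 h2 => (siteR_comm_ladderA hq.1 h1.symm).1)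
      (hB _ fun s h1 h2 => (siteR_comm_ladderB hq.1 h1.symm).1)
      (hB _ fun s h1 h2 => (siteR_comm_ladderB hq.1 h1.symm).2.2)
      (hB _ fun s h1 h2 => (siteR_comm_ladderA hq.1 h2.symm).2.1)
      (hB _ fun s h1 h2 => (siteR_comm_ladderB hq.1 h2.symm).2.1)
      (hB _ fun s h1 h2 => (siteR_comm_ladderB hq.1 h2.symm).2.2)
      (trFun K a b i j) (p₁ := PowerSeries.X) (p₂ := 1)
      (fun Y => by rw [one_mul]; exact trFun_Cm hq.1 0 a b i j Y)
      (fun Y => by rw [one_mul]; exact trFun_Cp hq.1 0 a b i j Y)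
      (fun Y => trFun_Ck hq.1 0 a b i j Y)
    rwa [← hM, one_mul, one_mul] at this
  · obtain ⟨A, B, hM, hAB⟩ := monodromy_interior q hr
    rw [wrapFactor, if_neg hr, one_mul, one_mul, ← map_add, ← map_add, ← mul_add, ← add_mul]
    congr 1
    have hD : Commute B ((siteTriple hq.1 r).A.k * (siteTriple hq.1 r).B.p
        * (siteTriple hq.1 (r + 1)).B.m + (siteTriple hq.1 r).A.p
        * (siteTriple hq.1 (r + 1)).B.k * (siteTriple hq.1 (r + 1)).A.m) :=
      (hAB _ fun s h1 h2 => (((siteR_comm_ladderA hq.1 h1.symm).2.2.mul_right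
        (siteR_comm_ladderB hq.1 h1.symm).1).mul_right
        (siteR_comm_ladderB hq.1 h2.symm).2.1).add_right
        (((siteR_comm_ladderA hq.1 h1.symm).1.mul_right
        (siteR_comm_ladderB hq.1 h2.symm).2.2).mul_right (siteR_comm_ladderA hq.1 h2.symm).2.1)).2
    have hD' : Commute A ((siteTriple hq.1 r).B.k * (siteTriple hq.1 r).A.p
        * (siteTriple hq.1 (r + 1)).A.m + (siteTriple hq.1 r).B.p
        * (siteTriple hq.1 (r + 1)).A.k * (siteTriple hq.1 (r + 1)).B.m) :=
      (hAB _ fun s h1 h2 => (((siteR_comm_ladderB hq.1 h1.symm).2.2.mul_right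
        (siteR_comm_ladderA hq.1 h1.symm).1).mul_right
        (siteR_comm_ladderA hq.1 h2.symm).2.1).add_right
        (((siteR_comm_ladderB hq.1 h1.symm).1.mul_right
        (siteR_comm_ladderA hq.1 h2.symm).2.2).mul_right (siteR_comm_ladderB hq.1 h2.symm).2.1)).1
    rw [hM, mul_assoc, hD.eq, ← mul_assoc, mul_assoc A, hex.interior, ← mul_assoc A, hD'.eq]
    simp only [mul_assoc]

end Trace

/-! ### Intertwining relations for matrix elements -/

section MatrixElements

variable {K : Type*} [Field K] {q : K} {n : ℕ}

theorem qInt_natCast (hq : IsGeneric q) (m : ℕ) :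
    qInt q m = -q / (q ^ 2 - 1) * ((q ^ m)⁻¹ * (1 - (q ^ 2) ^ m)) := by
  have h1 := hq.sq_sub_one_ne
  have h2 := pow_ne_zero m hq.1
  rw [qInt_eq hq, zpow_natCast, ← pow_mul, mul_comm 2 m, pow_mul]
  field_simp
  ring

/-- Converts the oscillator weight `q ^ v * (1 - q ^ (2 * u))` into a symmetric `q`-integer. The
conversion factor depends only on the total occupation `w` of the site, so all four terms of an
exchange relation can be rescaled by the same scalar. -/
theorem qInt_weight (hq : IsGeneric q) {u v w : ℕ} (h : w = u + v) :
    -q / (q ^ 2 - 1) * (q ^ w)⁻¹ * (q ^ v * (1 - (q ^ 2) ^ u)) = qInt q u := by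
  have h2 := pow_ne_zero u hq.1
  have h3 := pow_ne_zero v hq.1
  have h1 := hq.sq_sub_one_ne
  rw [qInt_natCast hq, h, pow_add]
  generalize (q ^ 2) ^ u = t
  field_simp

theorem qInt_weight_mul (hq : IsGeneric q) {u v w : ℕ} (t : ℕ) (h : w = u + v) :
    -q / (q ^ 2 - 1) * (q ^ w)⁻¹ * (q ^ t * (1 - (q ^ 2) ^ u))
      = qInt q u * q ^ (-(v : ℤ) + (t : ℤ)) := by
  rw [← qInt_weight hq h, zpow_add₀ hq.1, zpow_neg, zpow_natCast, zpow_natCast]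
  have h3 := pow_ne_zero v hq.1
  field_simp

theorem hop_apply_left {r s : ZMod n} (h : r ≠ s) (m : ZMod n → ℕ) : hop r s m r = m r - 1 := by
  simp [Pi.single_eq_of_ne h]

theorem hop_apply_right {r s : ZMod n} (h : r ≠ s) (m : ZMod n → ℕ) : hop r s m s = m s + 1 := by
  simp [Pi.single_eq_of_ne h.symm]

theorem trEntry_eq_trFun (a b i j : ZMod n → ℕ) :
    trEntry q a b i j = trFun K a b i j (monodromy q n) := rfl

theorem trEntry_eq_zero_of_site {a b i j : ZMod n → ℕ} (r : ZMod n)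
    (h : a r + b r ≠ i r + j r) : trEntry q a b i j = 0 :=
  trEntry_eq_zero q fun h' => h (congrFun h' r)

variable [NeZero n] (a b i j : ZMod n → ℕ)

/-- Matrix elements of `S^{tr} Δ(e_r) = Δ'(e_r) S^{tr}`. -/
theorem trEntry_exchange_e (hq : IsGeneric q) (hn : 2 ≤ n) {r s : ZMod n} (hs : s = r + 1) :
    qInt q (j r) • trEntry q a b i (hop r s j)
      + wrapFactor K r * ((qInt q (i r) * q ^ (-(j r : ℤ) + (j s : ℤ)))
        • trEntry q a b (hop r s i) j)
      = wrapFactor K r * (if a s = 0 then 0 else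
          qInt q ((a r + 1 : ℕ) : ℤ) • trEntry q (hop s r a) b i j)
        + if b s = 0 then 0 else (q ^ (-(a r : ℤ) + (a s : ℤ)) * qInt q ((b r + 1 : ℕ) : ℤ))
          • trEntry q a (hop s r b) i j := by
  have hrs : r ≠ s := hs ▸ ne_add_one hn r
  -- The rescaling is by the occupation of site `r`, which is `i r + j r` for the terms on the left
  -- and `a r + b r + 1` for those on the right. If these differ, the conservation law makes every
  -- term vanish.
  by_cases hc : a r + b r + 1 = i r + j r
  · have h := trFun_exchange_e hq hn r a b i j
    rw [← hs, trFun_mul_AkBmBp _ _ _ _ _ _ hrs, trFun_mul_AmBkAp _ _ _ _ _ _ hrs,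
      trFun_BkAmAp_mul _ _ _ _ _ _ hrs, trFun_BmAkBp_mul _ _ _ _ _ _ hrs] at h
    simp only [← trEntry_eq_trFun] at h
    have h0 := hq.1
    have h1 := congrArg (fun P => (-q / (q ^ 2 - 1) * (q ^ (i r + j r))⁻¹) • P) h
    simp only [smul_add, ← mul_smul_comm, smul_ite, smul_zero, smul_smul] at h1
    rw [qInt_weight hq (add_comm _ _), qInt_weight_mul hq (j s) rfl, ← hc,
      qInt_weight hq (show a r + b r + 1 = a r + 1 + b r by ring),
      qInt_weight_mul hq (v := a r) (a s) (by ring)] at h1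
    rw [h1, mul_comm (qInt _ ((b r + 1 : ℕ) : ℤ))]
  · have e1 : qInt q (j r) • trEntry q a b i (hop r s j) = 0 := by
      by_cases h0 : j r = 0
      · rw [h0, Nat.cast_zero, qInt_zero, zero_smul]
      · rw [trEntry_eq_zero_of_site r, smul_zero]
        rw [hop_apply_left hrs]
        omega
    have e2 : (qInt q (i r) * q ^ (-(j r : ℤ) + (j s : ℤ))) • trEntry q a b (hop r s i) j = 0 := by
      by_cases h0 : i r = 0
      · rw [h0, Nat.cast_zero, qInt_zero, zero_mul, zero_smul]
      · rw [trEntry_eq_zero_of_site r, smul_zero]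
        rw [hop_apply_left hrs]
        omega
    rw [e1, e2, trEntry_eq_zero_of_site (a := hop s r a) r, trEntry_eq_zero_of_site (b := hop s r b) r]
    · simp
    all_goals
      rw [hop_apply_right hrs.symm]
      omega

/-- Matrix elements of `S^{tr} Δ(f_r) = Δ'(f_r) S^{tr}`. -/
theorem trEntry_exchange_f (hq : IsGeneric q) (hn : 2 ≤ n) {r s : ZMod n} (hs : s = r + 1) :
    qInt q (i s) • trEntry q a b (hop s r i) j
      + wrapFactor K r * ((q ^ (-(-(i r : ℤ) + (i s : ℤ))) * qInt q (j s))
        • trEntry q a b i (hop s r j))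
      = wrapFactor K r * (if b r = 0 then 0 else
          qInt q ((b s + 1 : ℕ) : ℤ) • trEntry q a (hop r s b) i j)
        + if a r = 0 then 0 else (qInt q ((a s + 1 : ℕ) : ℤ) * q ^ (-(-(b r : ℤ) + (b s : ℤ))))
          • trEntry q (hop r s a) b i j := by
  have hrs : r ≠ s := hs ▸ ne_add_one hn r
  -- For `f_r` the quantum leaves the site `s = r + 1`, so the occupation of `s` sets the scale.
  by_cases hc : a s + b s + 1 = i s + j s
  · have h := trFun_exchange_f hq hn r a b i j
    rw [← hs, trFun_mul_AkBpBm, trFun_mul_ApBkAm,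
      trFun_BkApAm_mul _ _ _ _ _ _ hrs, trFun_BpAkBm_mul _ _ _ _ _ _ hrs] at h
    simp only [← trEntry_eq_trFun] at h
    have h0 := hq.1
    rw [add_comm, add_comm (ite _ _ _)] at h
    have h1 := congrArg (fun P => (-q / (q ^ 2 - 1) * (q ^ (i s + j s))⁻¹) • P) h
    simp only [smul_add, ← mul_smul_comm, smul_ite, smul_zero, smul_smul] at h1
    rw [qInt_weight hq rfl, qInt_weight_mul hq (v := i s) (i r) (add_comm _ _), ← hc,
      qInt_weight hq (show a s + b s + 1 = b s + 1 + a s by ring),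
      qInt_weight_mul hq (v := b s) (b r) (by ring)] at h1
    simp only [neg_add, neg_neg, add_comm (_ : ℤ) (-_)]
    rw [← h1, mul_comm (qInt _ (j s : ℤ))]
  · have e1 : qInt q (i s) • trEntry q a b (hop s r i) j = 0 := by
      by_cases h0 : i s = 0
      · rw [h0, Nat.cast_zero, qInt_zero, zero_smul]
      · rw [trEntry_eq_zero_of_site s, smul_zero]
        rw [hop_apply_left hrs.symm]
        omega
    have e2 : (q ^ (-(-(i r : ℤ) + (i s : ℤ))) * qInt q (j s)) • trEntry q a b i (hop s r j)
        = 0 := by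
      by_cases h0 : j s = 0
      · rw [h0, Nat.cast_zero, qInt_zero, mul_zero, zero_smul]
      · rw [trEntry_eq_zero_of_site s, smul_zero]
        rw [hop_apply_left hrs.symm]
        omega
    rw [e1, e2, trEntry_eq_zero_of_site (b := hop r s b) s, trEntry_eq_zero_of_site (a := hop r s a) s]
    · simp
    all_goals
      rw [hop_apply_right hrs]
      omega

end MatrixElements

/-! ### Coefficients in `F^{⊗n} ⊗ F^{⊗n}` -/

section Coefficients

variable {𝕜 : Type*} [Field 𝕜] {q : 𝕜} {n : ℕ}

/-- The coefficient of `|a⟩ ⊗ |b⟩`. -/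
def coef (𝕜 : Type*) [Field 𝕜] {n : ℕ} (a b : ZMod n → ℕ) : Fock 𝕜 n ⊗[𝕜] Fock 𝕜 n →ₗ[𝕜] 𝕜 :=
  Finsupp.lapply (a, b) ∘ₗ (finsuppTensorFinsupp' 𝕜 (ZMod n → ℕ) (ZMod n → ℕ)).toLinearMap

theorem coef_tmul (a b : ZMod n → ℕ) (v w : Fock 𝕜 n) :
    coef 𝕜 a b (v ⊗ₜ[𝕜] w) = v a * w b :=
  finsuppTensorFinsupp'_apply_apply _ _ _ v w a b

theorem ext_coef {t t' : Fock 𝕜 n ⊗[𝕜] Fock 𝕜 n} (h : ∀ a b, coef 𝕜 a b t = coef 𝕜 a b t') :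
    t = t' :=
  (finsuppTensorFinsupp' 𝕜 (ZMod n → ℕ) (ZMod n → ℕ)).injective
    (Finsupp.ext fun p => h p.1 p.2)

theorem ext_ket {M : Type*} [AddCommGroup M] [Module 𝕜 M]
    {f g : Fock 𝕜 n ⊗[𝕜] Fock 𝕜 n →ₗ[𝕜] M}
    (h : ∀ i j, f (ket 𝕜 i ⊗ₜ[𝕜] ket 𝕜 j) = g (ket 𝕜 i ⊗ₜ[𝕜] ket 𝕜 j)) : f = g := by
  refine TensorProduct.ext ?_
  ext i j
  exact h i j

theorem coef_map {A B : Module.End 𝕜 (Fock 𝕜 n)} {a b a' b' : ZMod n → ℕ} {α β : 𝕜}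
    (hA : ∀ v, A v a = α * v a') (hB : ∀ v, B v b = β * v b') (t : Fock 𝕜 n ⊗[𝕜] Fock 𝕜 n) :
    coef 𝕜 a b (TensorProduct.map A B t) = α * β * coef 𝕜 a' b' t := by
  induction t with
  | zero => simp
  | tmul v w => rw [TensorProduct.map_tmul, coef_tmul, coef_tmul, hA, hB]; ring
  | add t t' h h' => rw [map_add, map_add, map_add, h, h', mul_add]

theorem opE_eq_wShift (x : 𝕜ˣ) (r : ZMod n) : opE q x r
    = wShift (fun m => (if r = 0 then (x : 𝕜) else 1) * qInt q (m r)) (hop r (r + 1)) := by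
  rw [opE, wShift]
  simp only [Finsupp.smul_single, smul_eq_mul, mul_one]

theorem opF_eq_wShift (x : 𝕜ˣ) (r : ZMod n) : opF q x r
    = wShift (fun m => (if r = 0 then (x : 𝕜)⁻¹ else 1) * qInt q (m (r + 1)))
        (hop (r + 1) r) := by
  rw [opF, wShift]
  simp only [Finsupp.smul_single, smul_eq_mul, mul_one]

theorem opK_eq_wShift (r : ZMod n) :
    opK q r = wShift (fun m => q ^ (-(m r : ℤ) + (m (r + 1) : ℤ))) id := by
  rw [opK, wShift]
  simp only [Finsupp.smul_single, smul_eq_mul, mul_one, id]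

theorem opKinv_eq_wShift (r : ZMod n) :
    opKinv q r = wShift (fun m => q ^ (-(-(m r : ℤ) + (m (r + 1) : ℤ)))) id := by
  rw [opKinv, wShift]
  simp only [Finsupp.smul_single, smul_eq_mul, mul_one, id]

theorem wShift_ket (w : (ZMod n → ℕ) → 𝕜) (σ : (ZMod n → ℕ) → (ZMod n → ℕ)) (i : ZMod n → ℕ) :
    wShift w σ (ket 𝕜 i) = w i • ket 𝕜 (σ i) := by
  rw [wShift_single, one_mul, single_eq_smul]

theorem hop_hop {r s : ZMod n} (h : r ≠ s) {m : ZMod n → ℕ} (hm : m r ≠ 0) :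
    hop s r (hop r s m) = m := by
  funext u
  by_cases hr : u = r
  · subst hr
    simp [Pi.single_eq_of_ne h]
    omega
  · by_cases hs : u = s
    · subst hs
      simp [Pi.single_eq_of_ne hr]
    · simp [hr, hs]

/-- A label with `a s = 0` is not the result of a hop into `s`. Otherwise its only preimage with
nonzero weight is `hop s r a`, since hops out of an empty site have weight zero. -/
theorem hopShift_apply {r s : ZMod n} (h : r ≠ s) (ξ : 𝕜) (v : Fock 𝕜 n) (a : ZMod n → ℕ) :
    wShift (fun m => ξ * qInt q (m r)) (hop r s) v a
      = (if a s = 0 then 0 else ξ * qInt q ((a r + 1 : ℕ) : ℤ)) * v (hop s r a) := by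
  split_ifs with h0
  · rw [zero_mul]
    refine wShift_apply_eq_zero (fun t _ ht => ?_) v
    rw [← ht, hop_apply_right h] at h0
    omega
  · rw [← hop_apply_right h.symm a]
    refine wShift_apply (hop_hop h.symm h0) (fun t ht hta => ?_) v
    rw [← hta, hop_hop h]
    intro ht0
    simp [ht0, qInt_zero] at ht

theorem diag_apply (w : (ZMod n → ℕ) → 𝕜) (v : Fock 𝕜 n) (a : ZMod n → ℕ) :
    wShift w id v a = w a * v a :=
  wShift_apply rfl (fun _ _ h => h) v

end Coefficients

/-! ### `S^{tr}(z)` is an intertwiner -/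

section Intertwiner

variable {K : Type*} [Field K] {q : K} {n : ℕ}

local notation "𝕃" => LaurentSeries K

theorem coe_qInt (m : ℤ) : (HahnSeries.C (qInt q m) : 𝕃) = qInt (HahnSeries.C q) m := by
  simp only [qInt, map_div₀, map_sub, map_zpow₀, map_inv₀]

theorem coe_smul_powerSeries (c : K) (P : PowerSeries K) :
    ((c • P : PowerSeries K) : 𝕃) = HahnSeries.C c * (P : 𝕃) := by
  rw [PowerSeries.smul_eq_C_mul, PowerSeries.coe_mul, PowerSeries.coe_C]

theorem coe_wrapFactor (r : ZMod n) :
    ((wrapFactor K r : PowerSeries K) : 𝕃) = if r = 0 then zVar K else 1 := by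
  rw [wrapFactor]
  split_ifs
  · exact PowerSeries.coe_X
  · exact PowerSeries.coe_one

theorem zVar_ne_zero : zVar K ≠ 0 := HahnSeries.single_ne_zero one_ne_zero

variable [NeZero n]

theorem coef_traceS (a b i j : ZMod n → ℕ) :
    coef 𝕃 a b (traceS q n (ket 𝕃 i ⊗ₜ[𝕃] ket 𝕃 j)) = (trEntry q a b i j : 𝕃) := by
  rw [traceS, TensorProduct.lift.tmul]
  simp only [Finsupp.lift_apply, Finsupp.sum_single_index, zero_smul, one_smul,
    Finsupp.linearCombination_single, map_sum, map_smul, coef_tmul, smul_eq_mul]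
  have hz : trEntry q a b i j ≠ 0 → a + b = i + j := fun h => by_contra fun h' =>
    h (trEntry_eq_zero q h')
  rw [Finset.sum_eq_single a, Finset.sum_eq_single b]
  · simp
  · intro b' _ hb
    simp [hb]
  · intro hb
    have : trEntry q a b i j = 0 := by_contra fun h => hb (by
      rw [Finset.mem_Icc, ← hz h]
      exact ⟨zero_le, le_add_self⟩)
    simp [this]
  · intro a' _ ha
    simp [ha]
  · intro ha
    have : trEntry q a b i j = 0 := by_contra fun h => ha (by
      rw [Finset.mem_Icc, ← hz h]
      exact ⟨zero_le, le_self_add⟩)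
    refine Finset.sum_eq_zero fun b' _ => ?_
    by_cases hb : b' = b
    · subst hb; simp [this]
    · simp [hb]

theorem traceS_intertwines_e (hq : IsGeneric q) (hn : 2 ≤ n) {x y : 𝕃ˣ}
    (hxy : (x / y : 𝕃) = zVar K) (r : ZMod n) :
    (TensorProduct.map (opE (HahnSeries.C q) x r) LinearMap.id
        + TensorProduct.map (opK (HahnSeries.C q) r) (opE (HahnSeries.C q) y r)) ∘ₗ traceS q n
      = traceS q n ∘ₗ (TensorProduct.map LinearMap.id (opE (HahnSeries.C q) y r)
        + TensorProduct.map (opE (HahnSeries.C q) x r) (opK (HahnSeries.C q) r)) := by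
  have hrs := ne_add_one hn r
  refine ext_ket (𝕜 := 𝕃) (M := Fock 𝕃 n ⊗[𝕃] Fock 𝕃 n) fun i j => ?_
  refine ext_coef fun a b => ?_
  have h := congrArg (fun P : PowerSeries K => (if r = 0 then (y : 𝕃) else 1) * (P : 𝕃))
    (trEntry_exchange_e a b i j hq hn (r := r) rfl)
  -- The evaluation parameters enter only through a common factor `y` at `r = 0`; what remains
  -- depends on `z` alone.
  have hx : (if r = 0 then (x : 𝕃) else 1)
      = (if r = 0 then (y : 𝕃) else 1) * if r = 0 then zVar K else 1 := by
    split_ifs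
    · rw [← hxy, mul_div_cancel₀ _ y.ne_zero]
    · rw [one_mul]
  simp only [PowerSeries.coe_add, apply_ite (HahnSeries.ofPowerSeries ℤ K),
    PowerSeries.coe_zero, coe_smul_powerSeries, map_mul, coe_qInt, map_zpow₀, coe_wrapFactor] at h
  simp only [LinearMap.comp_apply, LinearMap.add_apply, map_add, TensorProduct.map_tmul,
    LinearMap.id_apply]
  rw [coef_map (a' := hop (r + 1) r a) (b' := b) (β := 1)
      (fun v => by rw [opE_eq_wShift, hopShift_apply hrs]) (fun v => (one_mul _).symm),
    coef_map (a' := a) (b' := hop (r + 1) r b)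
      (fun v => by rw [opK_eq_wShift, diag_apply])
      (fun v => by rw [opE_eq_wShift, hopShift_apply hrs])]
  simp only [opE_eq_wShift, opK_eq_wShift, wShift_ket, TensorProduct.tmul_smul,
    ← TensorProduct.smul_tmul', map_smul, coef_traceS, id, smul_eq_mul]
  rw [hx]
  refine Eq.trans ?_ (h.symm.trans ?_)
  · split_ifs <;> ring
  · ring

theorem traceS_intertwines_f (hq : IsGeneric q) (hn : 2 ≤ n) {x y : 𝕃ˣ}
    (hxy : (x / y : 𝕃) = zVar K) (r : ZMod n) :
    (TensorProduct.map LinearMap.id (opF (HahnSeries.C q) y r)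
        + TensorProduct.map (opF (HahnSeries.C q) x r) (opKinv (HahnSeries.C q) r)) ∘ₗ traceS q n
      = traceS q n ∘ₗ (TensorProduct.map (opF (HahnSeries.C q) x r) LinearMap.id
        + TensorProduct.map (opKinv (HahnSeries.C q) r) (opF (HahnSeries.C q) y r)) := by
  have hrs := ne_add_one hn r
  refine ext_ket (𝕜 := 𝕃) (M := Fock 𝕃 n ⊗[𝕃] Fock 𝕃 n) fun i j => ?_
  refine ext_coef fun a b => ?_
  have h := congrArg (fun P : PowerSeries K => (if r = 0 then (x : 𝕃)⁻¹ else 1) * (P : 𝕃))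
    (trEntry_exchange_f a b i j hq hn (r := r) rfl)
  have hy : (if r = 0 then (y : 𝕃)⁻¹ else 1)
      = (if r = 0 then (x : 𝕃)⁻¹ else 1) * if r = 0 then zVar K else 1 := by
    split_ifs
    · rw [← hxy, div_eq_mul_inv, inv_mul_cancel_left₀ x.ne_zero]
    · rw [one_mul]
  simp only [PowerSeries.coe_add, apply_ite (HahnSeries.ofPowerSeries ℤ K),
    PowerSeries.coe_zero, coe_smul_powerSeries, map_mul, coe_qInt, map_zpow₀, coe_wrapFactor] at h
  simp only [LinearMap.comp_apply, LinearMap.add_apply, map_add, TensorProduct.map_tmul,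
    LinearMap.id_apply]
  rw [coef_map (a' := a) (b' := hop r (r + 1) b) (α := 1) (fun v => (one_mul _).symm)
      (fun v => by rw [opF_eq_wShift, hopShift_apply hrs.symm]),
    coef_map (a' := hop r (r + 1) a) (b' := b)
      (fun v => by rw [opF_eq_wShift, hopShift_apply hrs.symm])
      (fun v => by rw [opKinv_eq_wShift, diag_apply])]
  simp only [opF_eq_wShift, opKinv_eq_wShift, wShift_ket, TensorProduct.tmul_smul,
    ← TensorProduct.smul_tmul', map_smul, coef_traceS, id, smul_eq_mul]
  rw [hy]
  refine Eq.trans ?_ (h.symm.trans ?_)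
  · split_ifs <;> ring
  · ring

/-- A grouplike diagonal operator acts on |i⟩ ⊗ |j⟩ through `i + j`, which `S^{tr}` conserves. -/
theorem traceS_comm_diag {w : (ZMod n → ℕ) → 𝕃} (W : (ZMod n → ℕ) → 𝕃)
    (hw : ∀ i j, w i * w j = W (i + j)) :
    TensorProduct.map (wShift w id) (wShift w id) ∘ₗ traceS q n
      = traceS q n ∘ₗ TensorProduct.map (wShift w id) (wShift w id) := by
  refine ext_ket (𝕜 := 𝕃) (M := Fock 𝕃 n ⊗[𝕃] Fock 𝕃 n) fun i j => ?_
  refine ext_coef fun a b => ?_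
  rw [LinearMap.comp_apply, LinearMap.comp_apply, coef_map (diag_apply w · a) (diag_apply w · b),
    TensorProduct.map_tmul, wShift_ket, wShift_ket, ← TensorProduct.smul_tmul',
    TensorProduct.tmul_smul, map_smul, map_smul, map_smul, map_smul, id, id, coef_traceS,
    smul_eq_mul, smul_eq_mul, ← mul_assoc, hw, hw]
  by_cases h : a + b = i + j
  · rw [h]
  · rw [trEntry_eq_zero q h, PowerSeries.coe_zero, mul_zero, mul_zero]

end Intertwiner

/-! ### The action on the tensor product -/

section TensorAction

variable {𝕜 : Type*} [Field 𝕜] {q : 𝕜} {n : ℕ}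

theorem rep_e (hq : IsGeneric q) (hn : 2 ≤ n) (x : 𝕜ˣ) (r : ZMod n) :
    rep hq hn x (Uq.e q r) = opE q x r := by
  rw [rep, Uq.e, Uq.lift_mk, FreeAlgebra.lift_ι_apply, genMap]

theorem rep_f (hq : IsGeneric q) (hn : 2 ≤ n) (x : 𝕜ˣ) (r : ZMod n) :
    rep hq hn x (Uq.f q r) = opF q x r := by
  rw [rep, Uq.f, Uq.lift_mk, FreeAlgebra.lift_ι_apply, genMap]

theorem rep_k (hq : IsGeneric q) (hn : 2 ≤ n) (x : 𝕜ˣ) (r : ZMod n) :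
    rep hq hn x (Uq.k q r) = opK q r := by
  rw [rep, Uq.k, Uq.lift_mk, FreeAlgebra.lift_ι_apply, genMap]

theorem rep_kinv (hq : IsGeneric q) (hn : 2 ≤ n) (x : 𝕜ˣ) (r : ZMod n) :
    rep hq hn x (Uq.kinv q r) = opKinv q r := by
  rw [rep, Uq.kinv, Uq.lift_mk, FreeAlgebra.lift_ι_apply, genMap]

theorem Uq.comul_e (hq : IsGeneric q) (r : ZMod n) :
    Uq.comul hq n (Uq.e q r) = 1 ⊗ₜ Uq.e q r + Uq.e q r ⊗ₜ Uq.k q r := by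
  rw [Uq.comul, Uq.e, Uq.lift_mk, FreeAlgebra.lift_ι_apply, genMap]
  rfl

theorem Uq.comul_f (hq : IsGeneric q) (r : ZMod n) :
    Uq.comul hq n (Uq.f q r) = Uq.f q r ⊗ₜ 1 + Uq.kinv q r ⊗ₜ Uq.f q r := by
  rw [Uq.comul, Uq.f, Uq.lift_mk, FreeAlgebra.lift_ι_apply, genMap]
  rfl

theorem Uq.comul_k (hq : IsGeneric q) (r : ZMod n) :
    Uq.comul hq n (Uq.k q r) = Uq.k q r ⊗ₜ Uq.k q r := by
  rw [Uq.comul, Uq.k, Uq.lift_mk, FreeAlgebra.lift_ι_apply, genMap]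
  rfl

theorem Uq.comul_kinv (hq : IsGeneric q) (r : ZMod n) :
    Uq.comul hq n (Uq.kinv q r) = Uq.kinv q r ⊗ₜ Uq.kinv q r := by
  rw [Uq.comul, Uq.kinv, Uq.lift_mk, FreeAlgebra.lift_ι_apply, genMap]
  rfl

theorem Uq.comulOp_apply (hq : IsGeneric q) (g : Uq q n) :
    Uq.comulOp hq n g = Algebra.TensorProduct.comm 𝕜 (Uq q n) (Uq q n) (Uq.comul hq n g) := rfl

/-- Induction over `U_q`. -/
theorem Uq.induction {P : Uq q n → Prop} (scalar : ∀ c : 𝕜, P (algebraMap 𝕜 (Uq q n) c))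
    (e : ∀ r, P (Uq.e q r)) (f : ∀ r, P (Uq.f q r)) (k : ∀ r, P (Uq.k q r))
    (kinv : ∀ r, P (Uq.kinv q r)) (mul : ∀ g h, P g → P h → P (g * h))
    (add : ∀ g h, P g → P h → P (g + h)) (g : Uq q n) : P g := by
  obtain ⟨a, rfl⟩ := RingQuot.mkAlgHom_surjective 𝕜 (UqRel q n) g
  induction a using FreeAlgebra.induction with
  | grade0 c => rw [AlgHom.commutes]; exact scalar c
  | grade1 g =>
    cases g with
    | e r => exact e r
    | f r => exact f r
    | k r => exact k r
    | kinv r => exact kinv r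
  | mul a b ha hb => rw [map_mul]; exact mul _ _ ha hb
  | add a b ha hb => rw [map_add]; exact add _ _ ha hb

/-- The action of an element of `U_q ⊗ U_q` on `V_x ⊗ V_y`. -/
def repTensorFock (hq : IsGeneric q) (hn : 2 ≤ n) (x y : 𝕜ˣ) :
    Uq q n ⊗[𝕜] Uq q n →ₐ[𝕜] Module.End 𝕜 (Fock 𝕜 n ⊗[𝕜] Fock 𝕜 n) :=
  (Module.endTensorEndAlgHom (R := 𝕜) (A := 𝕜)).comp
    (Algebra.TensorProduct.map (rep hq hn x) (rep hq hn y))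

theorem repTensorFock_tmul (hq : IsGeneric q) (hn : 2 ≤ n) (x y : 𝕜ˣ) (g h : Uq q n) :
    repTensorFock hq hn x y (g ⊗ₜ h) = TensorProduct.map (rep hq hn x g) (rep hq hn y h) := rfl

variable [NeZero n]

/-- The inclusion of `V_{x,m} ⊗ V_{y,l}` into `V_x ⊗ V_y`. -/
def inclTensor (𝕜 : Type*) [Field 𝕜] (n : ℕ) [NeZero n] (m l : ℕ) :
    level 𝕜 n m ⊗[𝕜] level 𝕜 n l →ₗ[𝕜] Fock 𝕜 n ⊗[𝕜] Fock 𝕜 n :=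
  TensorProduct.map (level 𝕜 n m).subtype (level 𝕜 n l).subtype

theorem inclTensor_repTensor (hq : IsGeneric q) (hn : 2 ≤ n) (x y : 𝕜ˣ) (m l : ℕ)
    (T : Uq q n ⊗[𝕜] Uq q n) (t : level 𝕜 n m ⊗[𝕜] level 𝕜 n l) :
    inclTensor 𝕜 n m l (repTensor hq hn x y m l T t)
      = repTensorFock hq hn x y T (inclTensor 𝕜 n m l t) := by
  induction T with
  | zero => simp
  | add T T' h h' =>
    rw [map_add, map_add, LinearMap.add_apply, LinearMap.add_apply, map_add, h, h']
  | tmul g g' =>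
    induction t with
    | zero => simp
    | add t t' h h' => rw [map_add, map_add, map_add, map_add, h, h']
    | tmul v w => rfl

open scoped Classical in
/-- The projection onto a level of the Fock space. -/
def projLevel (𝕜 : Type*) [Field 𝕜] (n : ℕ) [NeZero n] (l : ℕ) : Fock 𝕜 n →ₗ[𝕜] level 𝕜 n l :=
  Finsupp.restrictDom 𝕜 𝕜 {m : ZMod n → ℕ | ∑ r, m r = l}

theorem projLevel_subtype (l : ℕ) :
    projLevel 𝕜 n l ∘ₗ (level 𝕜 n l).subtype = LinearMap.id :=
  Finsupp.restrictDom_comp_subtype _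

theorem projLevel_apply (l : ℕ) (v : Fock 𝕜 n) (a : ZMod n → ℕ) :
    (projLevel 𝕜 n l v : Fock 𝕜 n) a = (if ∑ r, a r = l then 1 else 0) * v a := by
  classical
  rw [ite_mul, one_mul, zero_mul]
  exact Finsupp.filter_apply _ v a

/-- The projection of `V_x ⊗ V_y` onto `V_{x,m} ⊗ V_{y,l}`. -/
def projTensor (𝕜 : Type*) [Field 𝕜] (n : ℕ) [NeZero n] (m l : ℕ) :
    Fock 𝕜 n ⊗[𝕜] Fock 𝕜 n →ₗ[𝕜] level 𝕜 n m ⊗[𝕜] level 𝕜 n l :=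
  TensorProduct.map (projLevel 𝕜 n m) (projLevel 𝕜 n l)

theorem projTensor_inclTensor (m l : ℕ) (t : level 𝕜 n m ⊗[𝕜] level 𝕜 n l) :
    projTensor 𝕜 n m l (inclTensor 𝕜 n m l t) = t := by
  rw [projTensor, inclTensor, ← LinearMap.comp_apply, ← TensorProduct.map_comp,
    projLevel_subtype, projLevel_subtype, TensorProduct.map_id, LinearMap.id_apply]

theorem inclTensor_injective (m l : ℕ) : Function.Injective (inclTensor 𝕜 n m l) :=
  Function.LeftInverse.injective (projTensor_inclTensor m l)

theorem coef_inclTensor_projTensor (m l : ℕ) (a b : ZMod n → ℕ) (t : Fock 𝕜 n ⊗[𝕜] Fock 𝕜 n) :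
    coef 𝕜 a b (inclTensor 𝕜 n m l (projTensor 𝕜 n m l t))
      = (if ∑ r, a r = m then 1 else 0) * (if ∑ r, b r = l then 1 else 0) * coef 𝕜 a b t := by
  change coef 𝕜 a b ((TensorProduct.map (level 𝕜 n m).subtype (level 𝕜 n l).subtype ∘ₗ
    TensorProduct.map (projLevel 𝕜 n m) (projLevel 𝕜 n l)) t) = _
  rw [← TensorProduct.map_comp]
  exact coef_map (projLevel_apply m · a) (projLevel_apply l · b) t

end TensorAction

/-! ### The intertwining property on all of `U_q`, and the splitting into levels. -/

section Decomposition

variable {K : Type*} [Field K] {q : K} {n : ℕ} [NeZero n]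

local notation "𝕃" => LaurentSeries K

theorem traceS_intertwines (hq : IsGeneric q) (hn : 2 ≤ n) {x y : 𝕃ˣ}
    (hxy : (x / y : 𝕃) = zVar K) (g : Uq (HahnSeries.C q : 𝕃) n) :
    repTensorFock hq.laurent hn x y (Uq.comulOp hq.laurent n g) * traceS q n
      = traceS q n * repTensorFock hq.laurent hn x y (Uq.comul hq.laurent n g) := by
  have hC := hq.laurent.1
  induction g using Uq.induction with
  | scalar c =>
    simp only [AlgHom.commutes]
    exact Algebra.commutes _ _
  | e r =>
    rw [Uq.comulOp_apply, Uq.comul_e, map_add, map_add, map_add,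
      Algebra.TensorProduct.comm_tmul, Algebra.TensorProduct.comm_tmul]
    simp only [repTensorFock_tmul, map_one, rep_e, rep_k]
    exact traceS_intertwines_e hq hn hxy r
  | f r =>
    rw [Uq.comulOp_apply, Uq.comul_f, map_add, map_add, map_add,
      Algebra.TensorProduct.comm_tmul, Algebra.TensorProduct.comm_tmul]
    simp only [repTensorFock_tmul, map_one, rep_f, rep_kinv]
    exact traceS_intertwines_f hq hn hxy r
  | k r =>
    rw [Uq.comulOp_apply, Uq.comul_k, Algebra.TensorProduct.comm_tmul]
    simp only [repTensorFock_tmul, rep_k, opK_eq_wShift]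
    refine traceS_comm_diag
      (fun m => (HahnSeries.C q : 𝕃) ^ (-(m r : ℤ) + (m (r + 1) : ℤ))) fun i j => ?_
    rw [← zpow_add₀ hC]
    congr 1
    simp only [Pi.add_apply]
    push_cast
    ring
  | kinv r =>
    rw [Uq.comulOp_apply, Uq.comul_kinv, Algebra.TensorProduct.comm_tmul]
    simp only [repTensorFock_tmul, rep_kinv, opKinv_eq_wShift]
    refine traceS_comm_diag
      (fun m => (HahnSeries.C q : 𝕃) ^ (-(-(m r : ℤ) + (m (r + 1) : ℤ)))) fun i j => ?_
    rw [← zpow_add₀ hC]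
    congr 1
    simp only [Pi.add_apply]
    push_cast
    ring
  | mul g h hg hh =>
    rw [map_mul, map_mul, map_mul, map_mul, mul_assoc, hh, ← mul_assoc, hg, mul_assoc]
  | add g h hg hh =>
    rw [map_add, map_add, map_add, map_add, add_mul, mul_add, hg, hh]

/-- The second conservation law `b + c = j + k` of the 3d `R`, summed over the sites that share the
third factor. -/
theorem siteR_conserves_second (q : K) (r : ZMod n) (s : ℕ) (v : Idx n →₀ K)
    (hv : v ∈ Finsupp.supported K K {t : Idx n | ∑ u, t.2.1 u + t.2.2 = s}) :
    siteR q r v ∈ Finsupp.supported K K {t : Idx n | ∑ u, t.2.1 u + t.2.2 = s} := by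
  rw [siteR, Finsupp.linearCombination_apply]
  refine Submodule.sum_mem _ fun t ht => Submodule.smul_mem _ _ ?_
  have ht' : ∑ u, t.2.1 u + t.2.2 = s := (Finsupp.mem_supported K v).1 hv ht
  refine Submodule.sum_mem _ fun a _ => Submodule.sum_mem _ fun b _ =>
    Submodule.sum_mem _ fun c _ => ?_
  by_cases h : b + c = t.2.1 r + t.2.2
  · refine Finsupp.single_mem_supported K _ ?_
    change ∑ u, Function.update t.2.1 r b u + c = s
    rw [Finset.sum_update_of_mem (Finset.mem_univ r), ← ht',
      ← Finset.add_sum_erase _ _ (Finset.mem_univ r), ← Finset.sdiff_singleton_eq_erase]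
    omega
  · rw [threeDR, if_neg fun h' => h h'.2, Finsupp.single_zero]
    exact Submodule.zero_mem _

/-- `S^{tr}(z)` preserves the levels of both factors. -/
theorem trEntry_eq_zero_of_sum {a b i j : ZMod n → ℕ}
    (h : ∑ u, a u ≠ ∑ u, i u ∨ ∑ u, b u ≠ ∑ u, j u) : trEntry q a b i j = 0 := by
  have key : ∀ (s : ℕ) (L : List (ZMod n)) (v : Idx n →₀ K),
      v ∈ Finsupp.supported K K {t : Idx n | ∑ u, t.2.1 u + t.2.2 = s} →
      (L.map (siteR q)).prod v
        ∈ Finsupp.supported K K {t : Idx n | ∑ u, t.2.1 u + t.2.2 = s} := by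
    intro s L
    induction L with
    | nil => intro v hv; simpa using hv
    | cons r L ih =>
      intro v hv
      rw [List.map_cons, List.prod_cons]
      exact siteR_conserves_second q r s _ (ih v hv)
  by_contra h0
  have hab : a + b = i + j := by_contra fun h' => h0 (trEntry_eq_zero q h')
  have hsum : ∑ u, a u + ∑ u, b u = ∑ u, i u + ∑ u, j u := by
    rw [← Finset.sum_add_distrib, ← Finset.sum_add_distrib]
    exact Finset.sum_congr rfl fun u _ => congrFun hab u
  refine h0 (PowerSeries.ext fun c => ?_)
  rw [trEntry, PowerSeries.coeff_mk, map_zero]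
  have h1 := key _ ((List.range n).map fun r => ((r + 1 : ℕ) : ZMod n))
    (Finsupp.single (i, j, c) 1) (Finsupp.single_mem_supported K _ rfl)
  rw [List.map_map] at h1
  by_contra h2
  -- The trace fixes the same `c` at both ends, so the degree of the second factor is conserved;
  -- that of the first follows from `hsum`.
  have h3 : ∑ u, b u + c = ∑ u, j u + c :=
    (Finsupp.mem_supported K _).1 h1 (Finsupp.mem_support_iff.2 h2)
  omega

/-- The component of `S^{tr}(z)` on `V_{x,m} ⊗ V_{y,l}`. -/
def traceSLevel (q : K) (n : ℕ) [NeZero n] (m l : ℕ) :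
    Module.End 𝕃 (level 𝕃 n m ⊗[𝕃] level 𝕃 n l) :=
  projTensor 𝕃 n m l ∘ₗ traceS q n ∘ₗ inclTensor 𝕃 n m l

theorem proj_comm_traceS (m l : ℕ) :
    inclTensor 𝕃 n m l ∘ₗ projTensor 𝕃 n m l ∘ₗ traceS q n
      = traceS q n ∘ₗ inclTensor 𝕃 n m l ∘ₗ projTensor 𝕃 n m l := by
  have hP (l : ℕ) (i : ZMod n → ℕ) : (projLevel 𝕃 n l (ket 𝕃 i) : Fock 𝕃 n)
      = (if ∑ r, i r = l then (1 : 𝕃) else 0) • ket 𝕃 i := by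
    ext a
    rw [projLevel_apply, Finsupp.smul_apply, smul_eq_mul]
    by_cases ha : a = i
    · rw [ha]
    · rw [Finsupp.single_eq_of_ne ha, mul_zero, mul_zero]
  refine ext_ket (𝕜 := 𝕃) (M := Fock 𝕃 n ⊗[𝕃] Fock 𝕃 n) fun i j => ?_
  refine ext_coef fun a b => ?_
  rw [LinearMap.comp_apply, LinearMap.comp_apply, LinearMap.comp_apply, LinearMap.comp_apply,
    coef_inclTensor_projTensor, projTensor, inclTensor, TensorProduct.map_tmul,
    TensorProduct.map_tmul, Submodule.subtype_apply, Submodule.subtype_apply, hP, hP,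
    ← TensorProduct.smul_tmul', TensorProduct.tmul_smul, map_smul, map_smul, map_smul, map_smul,
    coef_traceS, smul_eq_mul, smul_eq_mul, ← mul_assoc]
  by_cases h : ∑ u, a u ≠ ∑ u, i u ∨ ∑ u, b u ≠ ∑ u, j u
  · rw [trEntry_eq_zero_of_sum h, PowerSeries.coe_zero, mul_zero, mul_zero]
  · push Not at h
    rw [h.1, h.2]

theorem inclTensor_traceSLevel (m l : ℕ) (t : level 𝕃 n m ⊗[𝕃] level 𝕃 n l) :
    inclTensor 𝕃 n m l (traceSLevel q n m l t) = traceS q n (inclTensor 𝕃 n m l t) := by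
  have h := LinearMap.congr_fun (proj_comm_traceS (q := q) m l) (inclTensor 𝕃 n m l t)
  rw [LinearMap.comp_apply, LinearMap.comp_apply, LinearMap.comp_apply, LinearMap.comp_apply,
    projTensor_inclTensor] at h
  exact h

theorem traceSLevel_intertwines (hq : IsGeneric q) (hn : 2 ≤ n) {x y : 𝕃ˣ}
    (hxy : (x / y : 𝕃) = zVar K) (m l : ℕ) (g : Uq (HahnSeries.C q : 𝕃) n) :
    repTensor hq.laurent hn x y m l (Uq.comulOp hq.laurent n g) * traceSLevel q n m l
      = traceSLevel q n m l * repTensor hq.laurent hn x y m l (Uq.comul hq.laurent n g) := by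
  refine LinearMap.ext fun t => inclTensor_injective m l ?_
  have h := LinearMap.congr_fun (traceS_intertwines hq hn hxy g) (inclTensor 𝕃 n m l t)
  rw [Module.End.mul_apply, Module.End.mul_apply] at h ⊢
  rw [inclTensor_repTensor, inclTensor_traceSLevel, inclTensor_traceSLevel,
    inclTensor_repTensor, h]

theorem traceS_eq_directSumR : traceS q n = directSumR (traceSLevel q n) := by
  refine ext_ket (𝕜 := 𝕃) (M := Fock 𝕃 n ⊗[𝕃] Fock 𝕃 n) fun i j => ?_
  rw [directSumR, TensorProduct.lift.tmul (R := 𝕃)]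
  simp only [Finsupp.lift_apply, Finsupp.sum_single_index, zero_smul, one_smul,
    Finsupp.linearCombination_single]
  exact (inclTensor_traceSLevel (q := q) (∑ r, i r) (∑ r, j r)
    (⟨ket 𝕃 i, ket_mem_level rfl⟩ ⊗ₜ[𝕃] ⟨ket 𝕃 j, ket_mem_level rfl⟩)).symm

end Decomposition

/-! ### The normalization -/

section QIdentities

variable {K : Type*} [Field K] {q : K}

theorem IsGeneric.inv (hq : IsGeneric q) : IsGeneric q⁻¹ :=
  ⟨inv_ne_zero hq.1, fun N hN h => hq.2 N hN (by rwa [inv_pow, inv_eq_one] at h)⟩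

/-- A `q`-Vandermonde expansion in the basis of products of `u - p ^ s`. The induction step splits
`u - M * p ^ l` as `(u - p ^ k) + p ^ k * (1 - M * p ^ (l - k))`: the first part lengthens the basis
product, the second the `q`-factorial, and Pascal's rule recombines them. -/
theorem prod_sub_eq_sum {p : K} (hp : ∀ m, qPoch p p m ≠ 0) (u M : K) (l : ℕ) :
    ∏ k ∈ Finset.range l, (u - M * p ^ k) = ∑ k ∈ Finset.range (l + 1),
      qBinom p l k * ((∏ s ∈ Finset.range k, (u - p ^ s)) * qPoch M p (l - k)) := by
  induction l with
  | zero => simp [qBinom_zero hp, qPoch_zero]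
  | succ l ih =>
    rw [Finset.prod_range_succ, ih, Finset.sum_mul, Finset.sum_range_succ' _ (l + 1)]
    have e1 : ∀ k ∈ Finset.range (l + 1),
        qBinom p l k * ((∏ s ∈ Finset.range k, (u - p ^ s)) * qPoch M p (l - k)) * (u - M * p ^ l)
          = qBinom p l k * ((∏ s ∈ Finset.range (k + 1), (u - p ^ s)) * qPoch M p (l - k))
            + p ^ k * qBinom p l k
              * ((∏ s ∈ Finset.range k, (u - p ^ s)) * qPoch M p (l + 1 - k)) := by
      intro k hk
      obtain ⟨d, rfl⟩ : ∃ d, l = k + d := ⟨l - k, by rw [Finset.mem_range] at hk; omega⟩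
      rw [Finset.prod_range_succ, Nat.add_sub_cancel_left, show k + d + 1 - k = d + 1 by omega,
        qPoch_succ, pow_add]
      ring
    rw [Finset.sum_congr rfl e1, Finset.sum_add_distrib]
    have e2 : ∑ k ∈ Finset.range (l + 1), p ^ k * qBinom p l k
          * ((∏ s ∈ Finset.range k, (u - p ^ s)) * qPoch M p (l + 1 - k))
        = ∑ k ∈ Finset.range (l + 1), p ^ (k + 1) * qBinom p l (k + 1)
          * ((∏ s ∈ Finset.range (k + 1), (u - p ^ s)) * qPoch M p (l - k))
          + qBinom p (l + 1) 0 * qPoch M p (l + 1) := by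
      rw [← add_zero (∑ k ∈ Finset.range (l + 1), p ^ k * qBinom p l k * _),
        ← show p ^ (l + 1) * qBinom p l (l + 1) * ((∏ s ∈ Finset.range (l + 1), (u - p ^ s))
          * qPoch M p (l + 1 - (l + 1))) = 0 by
            rw [qBinom_of_lt p l.lt_succ_self, mul_zero, zero_mul],
        ← Finset.sum_range_succ (fun k => p ^ k * qBinom p l k
          * ((∏ s ∈ Finset.range k, (u - p ^ s)) * qPoch M p (l + 1 - k))),
        Finset.sum_range_succ' _ (l + 1)]
      simp [qBinom_zero hp]
    rw [e2, ← add_assoc, ← Finset.sum_add_distrib]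
    congr 1
    · refine Finset.sum_congr rfl fun k _ => ?_
      rw [qBinom_succ hp, Nat.add_sub_add_right]
      ring
    · simp

theorem qPoch_inv (hq : q ≠ 0) (m : ℕ) : qPoch (q⁻¹ ^ 2) (q⁻¹ ^ 2) m
    = (-1) ^ m * (q ^ (m * (m + 1)))⁻¹ * qPoch (q ^ 2) (q ^ 2) m := by
  induction m with
  | zero => simp [qPoch_zero]
  | succ m ih =>
    rw [qPoch_succ, ih, qPoch_succ, show (m + 1) * (m + 1 + 1) = m * (m + 1) + 2 * (m + 1) by ring,
      pow_add, ← pow_succ', ← pow_succ', ← pow_mul, ← pow_mul, inv_pow]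
    have := pow_ne_zero (2 * (m + 1)) hq
    field_simp
    ring

theorem qBinom_inv (hq : IsGeneric q) (k d : ℕ) : qBinom (q⁻¹ ^ 2) (k + d) k
    = (q ^ (2 * k * d))⁻¹ * qBinom (q ^ 2) (k + d) k := by
  rw [qBinom, qBinom, if_pos (by omega), if_pos (by omega), Nat.add_sub_cancel_left,
    qPoch_inv hq.1, qPoch_inv hq.1, qPoch_inv hq.1,
    show (k + d) * (k + d + 1) = k * (k + 1) + d * (d + 1) + 2 * k * d by ring, pow_add, pow_add,
    pow_add]
  have h0 := hq.1
  have h1 := hq.qPoch_ne k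
  have h2 := hq.qPoch_ne d
  field_simp

theorem prod_sub_inv_pow (hq : q ≠ 0) (u : K) (k : ℕ) :
    q ^ (k * k) * ∏ s ∈ Finset.range k, (u - (q⁻¹ ^ 2) ^ s) = (-1) ^ k * q ^ k * qPoch u (q ^ 2) k := by
  induction k with
  | zero => simp [qPoch_zero]
  | succ k ih =>
    rw [Finset.prod_range_succ, show (k + 1) * (k + 1) = k * k + 2 * k + 1 by ring, pow_add,
      qPoch_succ]
    have e : q ^ (2 * k) * (u - (q⁻¹ ^ 2) ^ k) = -(1 - u * (q ^ 2) ^ k) := by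
      rw [← pow_mul, ← pow_mul, inv_pow]
      have := pow_ne_zero (2 * k) hq
      field_simp
      ring
    rw [pow_add, pow_succ (-1 : K), pow_succ q k]
    linear_combination q * (q ^ (2 * k) * (u - (q⁻¹ ^ 2) ^ k)) * ih
      + q * ((-1) ^ k * q ^ k * qPoch u (q ^ 2) k) * e

/-- Inverting the base makes the exponents descend from `m`. For `k > m` both sides vanish: the left
has the factor `1 - 1`, the right a zero binomial. -/
theorem qPoch_pow_inv (hq : IsGeneric q) (m k : ℕ) :
    qPoch (q ^ (2 * m)) (q⁻¹ ^ 2) k = qPoch (q ^ 2) (q ^ 2) k * qBinom (q ^ 2) m k := by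
  have h0 := hq.1
  by_cases h : k ≤ m
  · obtain ⟨c, rfl⟩ : ∃ c, m = c + k := ⟨m - k, by omega⟩
    rw [qBinom, if_pos h, Nat.add_sub_cancel]
    have h1 := hq.qPoch_ne k
    have h2 := hq.qPoch_ne c
    have h3 := prod_one_sub_pow (q ^ 2) c k hq.qPoch_ne
    have h4 : qPoch (q ^ (2 * (c + k))) (q⁻¹ ^ 2) k
        = ∏ s ∈ Finset.range k, (1 - (q ^ 2) ^ (c + k - s)) := by
      refine Finset.prod_congr rfl fun s hs => ?_
      rw [Finset.mem_range] at hs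
      obtain ⟨d, hd⟩ : ∃ d, c + k = d + s := ⟨c + k - s, by omega⟩
      rw [hd, Nat.add_sub_cancel, pow_mul, pow_add, mul_assoc, ← mul_pow, inv_pow,
        mul_inv_cancel₀ (pow_ne_zero 2 h0), one_pow, mul_one]
    rw [h4, h3]
    field_simp
  · rw [qBinom_of_lt _ (by omega), mul_zero]
    refine Finset.prod_eq_zero (Finset.mem_range.2 (by omega : m < k)) ?_
    rw [pow_mul, ← mul_pow, inv_pow, mul_inv_cancel₀ (pow_ne_zero 2 h0), one_pow, sub_self]

/-- With `u = q ^ (m - l) * z`, the right side times `q ^ (l * (m - l))` is the product of `u - q ^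
(2 * m) * q ^ (-2 * k)` over `k < l`. The claim is then `prod_sub_eq_sum` with base `q ^ (-2)` and
`M = q ^ (2 * m)`, rewritten in base `q ^ 2`. -/
theorem sum_antidiagonal_qPoch (hq : IsGeneric q) {z : K} (hz : z ≠ 0) (m l : ℕ) :
    ∑ p ∈ Finset.HasAntidiagonal.antidiagonal l,
      (-1) ^ p.1 * q ^ (-((m : ℤ) * l) + p.1 + (p.2 : ℤ) * p.2) * qBinom (q ^ 2) m p.2
        * qBinom (q ^ 2) l p.1 * (qPoch (q ^ 2) (q ^ 2) p.2
          * qPoch (q ^ ((m : ℤ) - l) * z) (q ^ 2) p.1)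
      = z ^ l * qPoch (q ^ ((m : ℤ) - l + 2) * z⁻¹) (q ^ 2) l := by
  have h0 := hq.1
  have hl : q ^ ((l : ℤ) * ((m : ℤ) - l)) ≠ 0 := zpow_ne_zero _ h0
  refine mul_left_cancel₀ hl ?_
  set u := q ^ ((m : ℤ) - l) * z with hu
  have hR : q ^ ((l : ℤ) * ((m : ℤ) - l)) * (z ^ l * qPoch (q ^ ((m : ℤ) - l + 2) * z⁻¹) (q ^ 2) l)
      = ∏ k ∈ Finset.range l, (u - q ^ (2 * m) * (q⁻¹ ^ 2) ^ k) := by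
    rw [mul_comm (l : ℤ), zpow_mul, zpow_natCast, ← mul_assoc, ← mul_pow, ← hu, qPoch,
      ← Finset.prod_range_reflect, show u ^ l = ∏ _k ∈ Finset.range l, u by simp,
      ← Finset.prod_mul_distrib]
    refine Finset.prod_congr rfl fun k hk => ?_
    rw [Finset.mem_range] at hk
    obtain ⟨d, rfl⟩ : ∃ d, l = d + 1 + k := ⟨l - 1 - k, by omega⟩
    rw [show d + 1 + k - 1 - k = d by omega, mul_sub, mul_one, hu]
    congr 1
    have e : q ^ (2 * m) * (q⁻¹ ^ 2) ^ k = q ^ (2 * (m : ℤ) - 2 * k) := by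
      rw [inv_pow, inv_pow, ← pow_mul, ← zpow_natCast, ← zpow_natCast, ← zpow_neg,
        ← zpow_add₀ h0]
      congr 1
    have e' : (q ^ 2) ^ d = q ^ (2 * (d : ℤ)) := by
      rw [← pow_mul, ← zpow_natCast]
      congr 1
    have e'' : 2 * (m : ℤ) - 2 * k = ((m : ℤ) - ((d + 1 + k : ℕ) : ℤ))
        + ((m : ℤ) - ((d + 1 + k : ℕ) : ℤ) + 2) + 2 * (d : ℤ) := by push_cast; ring
    rw [e, e', e'']
    generalize (m : ℤ) - ((d + 1 + k : ℕ) : ℤ) = v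
    simp only [zpow_add₀ h0]
    field_simp
  rw [hR, prod_sub_eq_sum hq.inv.qPoch_ne, Finset.Nat.sum_antidiagonal_eq_sum_range_succ_mk,
    Finset.mul_sum]
  refine Finset.sum_congr rfl fun k hk => ?_
  rw [Finset.mem_range] at hk
  obtain ⟨d, rfl⟩ : ∃ d, l = k + d := ⟨l - k, by omega⟩
  rw [Nat.add_sub_cancel_left, qBinom_inv hq, qPoch_pow_inv hq]
  have h1 := prod_sub_inv_pow h0 u k
  have h2 : q ^ (k * k) ≠ 0 := pow_ne_zero _ h0
  have h3 : ∏ s ∈ Finset.range k, (u - (q⁻¹ ^ 2) ^ s)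
      = (q ^ (k * k))⁻¹ * ((-1) ^ k * q ^ k * qPoch u (q ^ 2) k) := by
    rw [← h1, inv_mul_cancel_left₀ h2]
  rw [h3]
  have e : q ^ (((k + d : ℕ) : ℤ) * ((m : ℤ) - ((k + d : ℕ) : ℤ)))
      * q ^ (-((m : ℤ) * ((k + d : ℕ) : ℤ)) + (k : ℤ) + (d : ℤ) * d)
      = (q ^ (2 * k * d))⁻¹ * (q ^ (k * k))⁻¹ * q ^ k := by
    rw [← zpow_natCast, ← zpow_natCast, ← zpow_natCast, ← zpow_neg, ← zpow_neg, ← zpow_add₀ h0,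
      ← zpow_add₀ h0, ← zpow_add₀ h0]
    congr 1
    push_cast
    ring
  linear_combination ((-1) ^ k * qBinom (q ^ 2) m d * qBinom (q ^ 2) (k + d) k
    * (qPoch (q ^ 2) (q ^ 2) d * qPoch u (q ^ 2) k)) * e

/-- The `q`-binomial series `∑_c (Q)_{c+μ} / (Q)_c w^c z^c = (Q)_μ / (wz; Q)_{μ+1}`. -/
theorem qBinom_series {Q : K} (hQ : ∀ m, qPoch Q Q m ≠ 0) (w : K) (μ : ℕ) :
    PowerSeries.mk (fun c => qPoch Q Q (c + μ) / qPoch Q Q c * w ^ c)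
      * ∏ k ∈ Finset.range (μ + 1), (1 - PowerSeries.C (w * Q ^ k) * PowerSeries.X)
      = PowerSeries.C (qPoch Q Q μ) := by
  induction μ with
  | zero =>
    rw [Finset.prod_range_one, pow_zero, mul_one, qPoch_zero, map_one]
    refine PowerSeries.ext fun c => ?_
    rw [mul_sub, mul_one, mul_comm (PowerSeries.C w), ← mul_assoc, map_sub,
      PowerSeries.coeff_mul_C, PowerSeries.coeff_mk]
    cases c with
    | zero => simp [qPoch_zero]
    | succ c =>
      rw [PowerSeries.coeff_succ_mul_X, PowerSeries.coeff_mk, PowerSeries.coeff_one,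
        if_neg c.succ_ne_zero, add_zero, add_zero, div_self (hQ _), div_self (hQ _)]
      ring
  | succ μ ih =>
    -- The last factor of the product lowers `μ + 1` to `μ`, by `(1 - Q ^ (c + μ + 1)) - Q ^ (μ + 1)
    -- * (1 - Q ^ c) = 1 - Q ^ (μ + 1)` in each coefficient.
    have key : PowerSeries.mk (fun c => qPoch Q Q (c + (μ + 1)) / qPoch Q Q c * w ^ c)
        * (1 - PowerSeries.C (w * Q ^ (μ + 1)) * PowerSeries.X)
        = PowerSeries.C (1 - Q * Q ^ μ)
          * PowerSeries.mk (fun c => qPoch Q Q (c + μ) / qPoch Q Q c * w ^ c) := by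
      refine PowerSeries.ext fun c => ?_
      rw [mul_sub, mul_one, mul_comm (PowerSeries.C _) PowerSeries.X, ← mul_assoc, map_sub,
        PowerSeries.coeff_mul_C, PowerSeries.coeff_mk, PowerSeries.coeff_C_mul,
        PowerSeries.coeff_mk]
      cases c with
      | zero => simp [qPoch_zero, qPoch_succ, mul_comm]
      | succ c =>
        rw [PowerSeries.coeff_succ_mul_X, PowerSeries.coeff_mk,
          show c + 1 + (μ + 1) = c + (μ + 1) + 1 by ring, show c + 1 + μ = c + (μ + 1) by ring,
          qPoch_succ, qPoch_succ Q Q c]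
        have h := hQ (c + 1)
        rw [qPoch_succ] at h
        have h1 := left_ne_zero_of_mul h
        have h2 := right_ne_zero_of_mul h
        field_simp
        ring
    rw [Finset.prod_range_succ, mul_comm (∏ k ∈ _, _), ← mul_assoc, key, mul_assoc, ih, ← map_mul,
      qPoch_succ, mul_comm]

end QIdentities

/-! ### The matrix element of the trace on the top vectors. -/

section Normalization

variable {K : Type*} [Field K] {q : K} {n : ℕ}

theorem siteR_single_apply_self (q : K) (r : ZMod n) (t : Idx n) :
    siteR q r (Finsupp.single t 1) t
      = threeDR q (t.1 r) (t.2.1 r) t.2.2 (t.1 r) (t.2.1 r) t.2.2 := by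
  rw [siteR, Finsupp.linearCombination_single, one_smul]
  simp only [Finsupp.finsetSum_apply]
  have h (a b c : ℕ) (hne : ¬(a = t.1 r ∧ b = t.2.1 r ∧ c = t.2.2)) (x : K) :
      (Finsupp.single (Function.update t.1 r a, Function.update t.2.1 r b, c) x : Idx n →₀ K) t
        = 0 := by
    refine Finsupp.single_eq_of_ne fun he => hne ?_
    have h1 := congrFun (congrArg Prod.fst he) r
    have h2 := congrFun (congrArg (fun t : Idx n => t.2.1) he) r
    have h3 := congrArg (fun t : Idx n => t.2.2) he
    simp only [Function.update_self] at h1 h2 h3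
    exact ⟨h1.symm, h2.symm, h3.symm⟩
  rw [Finset.sum_eq_single (t.1 r), Finset.sum_eq_single (t.2.1 r), Finset.sum_eq_single t.2.2]
  · simp
  · exact fun c _ hc => h _ _ _ (fun h' => hc h'.2.2) _
  · exact fun hc => absurd (Finset.mem_range.2 (by omega)) hc
  · exact fun b _ hb => Finset.sum_eq_zero fun c _ => h _ _ _ (fun h' => hb h'.2.1) _
  · exact fun hb => absurd (Finset.mem_range.2 (by omega)) hb
  · exact fun a _ ha => Finset.sum_eq_zero fun b _ => Finset.sum_eq_zero fun c _ =>
      h _ _ _ (fun h' => ha h'.1) _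
  · exact fun ha => absurd (Finset.mem_range.2 (by omega)) ha

/-- The span of the basis vectors which are vacuous at all sites other than `0`. -/
def vacAway (K : Type*) [Field K] (n : ℕ) : Submodule K (Idx n →₀ K) :=
  Finsupp.supported K K {t | ∀ r, r ≠ 0 → t.1 r = 0 ∧ t.2.1 r = 0}

theorem siteR_zero_mem_vacAway (q : K) {t : Idx n}
    (ht : ∀ r, r ≠ 0 → t.1 r = 0 ∧ t.2.1 r = 0) :
    siteR q 0 (Finsupp.single t 1) ∈ vacAway K n := by
  rw [siteR, Finsupp.linearCombination_single, one_smul]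
  refine Submodule.sum_mem _ fun a _ => Submodule.sum_mem _ fun b _ =>
    Submodule.sum_mem _ fun c _ => Finsupp.single_mem_supported K _ fun r hr => ?_
  simp only [Function.update_of_ne hr]
  exact ht r hr

theorem siteR_of_mem_vacAway (hq : IsGeneric q) {r : ZMod n} (hr : r ≠ 0) {v : Idx n →₀ K}
    (hv : v ∈ vacAway K n) : siteR q r v = v :=
  eq_of_mem_supported (S := {t : Idx n | ∀ r, r ≠ 0 → t.1 r = 0 ∧ t.2.1 r = 0})
    (g := LinearMap.id) (fun _ ht => siteR_vac hq (ht r hr)) hv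

/-- The factor of site `0` acts first and leaves the other sites vacuous; the remaining factors then
fix the result. -/
theorem monodromy_single (hq : IsGeneric q) [NeZero n] {t : Idx n}
    (ht : ∀ r, r ≠ 0 → t.1 r = 0 ∧ t.2.1 r = 0) :
    monodromy q n (Finsupp.single t 1) = siteR q 0 (Finsupp.single t 1) := by
  obtain ⟨k, rfl⟩ : ∃ k, n = k + 1 := ⟨n - 1, by have := NeZero.ne n; omega⟩
  rw [monodromy, List.range_succ, List.map_append, List.prod_append, List.map_singleton,
    List.prod_singleton, ZMod.natCast_self, Module.End.mul_apply]
  have key : ∀ L : List ℕ, (∀ i ∈ L, i < k) → ∀ v ∈ vacAway K (k + 1),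
      (L.map fun r => siteR q ((r + 1 : ℕ) : ZMod (k + 1))).prod v = v := by
    intro L
    induction L with
    | nil => intro _ v _; simp
    | cons i L ih =>
      intro hL v hv
      rw [List.map_cons, List.prod_cons, Module.End.mul_apply,
        ih (fun j hj => hL j (List.mem_cons_of_mem i hj)) v hv]
      refine siteR_of_mem_vacAway hq (fun h => ?_) hv
      rw [ZMod.natCast_eq_zero_iff] at h
      have h1 := hL i List.mem_cons_self
      have h2 := Nat.le_of_dvd i.succ_pos h
      omega
  exact key _ (fun i hi => List.mem_range.1 hi) _ (siteR_zero_mem_vacAway q ht)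

theorem trEntry_top (hq : IsGeneric q) [NeZero n] (m l : ℕ) :
    trEntry q (Pi.single (0 : ZMod n) m) (Pi.single 0 l) (Pi.single 0 m) (Pi.single 0 l)
      = PowerSeries.mk fun c => threeDR q m l c m l c := by
  refine PowerSeries.ext fun c => ?_
  rw [trEntry, PowerSeries.coeff_mk, PowerSeries.coeff_mk, monodromy_single hq,
    siteR_single_apply_self]
  · simp
  · intro r hr
    exact ⟨Pi.single_eq_of_ne hr _, Pi.single_eq_of_ne hr _⟩

/-- On the diagonal the exponent of `q` is affine in `c`, with slope `m + λ - μ = m - l + 2 * λ`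
because `λ + μ = l`. Each `(λ, μ)` thus contributes a series of the form in `qBinom_series`. -/
theorem threeDR_diag (hq : IsGeneric q) (m l : ℕ) :
    (PowerSeries.mk fun c => threeDR q m l c m l c)
      = ∑ p ∈ Finset.HasAntidiagonal.antidiagonal l,
        ((-1) ^ p.1 * q ^ (-((m : ℤ) * l) + p.1 + (p.2 : ℤ) * p.2) * qBinom (q ^ 2) m p.2
          * qBinom (q ^ 2) l p.1) • PowerSeries.mk fun c => qPoch (q ^ 2) (q ^ 2) (c + p.2)
            / qPoch (q ^ 2) (q ^ 2) c * (q ^ ((m : ℤ) - l) * (q ^ 2) ^ p.1) ^ c := by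
  refine PowerSeries.ext fun c => ?_
  rw [PowerSeries.coeff_mk, map_sum, threeDR, if_pos ⟨rfl, rfl⟩]
  refine Finset.sum_congr rfl fun p hp => ?_
  rw [Finset.HasAntidiagonal.mem_antidiagonal] at hp
  have h0 := hq.1
  have e : q ^ ((m : ℤ) * ((c : ℤ) - l) + ((c : ℤ) + 1) * p.1 + p.2 * ((p.2 : ℤ) - c))
      = q ^ (-((m : ℤ) * l) + p.1 + (p.2 : ℤ) * p.2) * (q ^ ((m : ℤ) - l) * (q ^ 2) ^ p.1) ^ c := by
    rw [← pow_mul, ← zpow_natCast q, ← zpow_add₀ h0, ← zpow_natCast, ← zpow_mul, ← zpow_add₀ h0]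
    congr 1
    rw [← hp]
    push_cast
    ring
  rw [PowerSeries.coeff_smul, PowerSeries.coeff_mk, e, smul_eq_mul]
  ring

local notation "𝕃" => LaurentSeries K

theorem map_qPoch {L : Type*} [Field L] (φ : K →+* L) (z Q : K) (m : ℕ) :
    φ (qPoch z Q m) = qPoch (φ z) (φ Q) m := by
  simp [qPoch, map_prod]

theorem map_qBinom {L : Type*} [Field L] (φ : K →+* L) (Q : K) (m k : ℕ) :
    φ (qBinom Q m k) = qBinom (φ Q) m k := by
  rw [qBinom, qBinom, apply_ite φ, map_div₀, map_mul, map_qPoch, map_qPoch, map_qPoch, map_zero]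

theorem qPoch_add (z Q : K) (k d : ℕ) :
    qPoch z Q (k + d) = qPoch z Q k * qPoch (z * Q ^ k) Q d := by
  rw [qPoch, Finset.prod_range_add, qPoch, qPoch]
  simp only [pow_add, mul_assoc]

/-- Every factor has constant term `1`. -/
theorem qPoch_zVar_ne_zero (w Q : K) (m : ℕ) :
    qPoch (HahnSeries.C w * zVar K) (HahnSeries.C Q : 𝕃) m ≠ 0 := by
  refine Finset.prod_ne_zero_iff.2 fun k _ h => ?_
  have h1 := congrArg (fun s : 𝕃 => s.coeff 0) h
  rw [← map_pow, mul_right_comm, ← map_mul] at h1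
  simp [zVar, HahnSeries.coeff_single_of_ne] at h1

theorem coe_qBinom_series (hq : IsGeneric q) (w : K) (μ : ℕ) :
    ((PowerSeries.mk fun c => qPoch (q ^ 2) (q ^ 2) (c + μ) / qPoch (q ^ 2) (q ^ 2) c * w ^ c :
        PowerSeries K) : 𝕃) * qPoch (HahnSeries.C w * zVar K) (HahnSeries.C q ^ 2) (μ + 1)
      = qPoch (HahnSeries.C q ^ 2) (HahnSeries.C q ^ 2) μ := by
  have h := congrArg (HahnSeries.ofPowerSeries ℤ K) (qBinom_series hq.qPoch_ne w μ)
  rw [map_mul, map_prod, PowerSeries.coe_C, map_qPoch, map_pow] at h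
  rw [← h]
  congr 1
  refine Finset.prod_congr rfl fun k _ => ?_
  rw [map_sub, map_one, map_mul, PowerSeries.coe_C, PowerSeries.coe_X, map_mul, map_pow, map_pow,
    mul_right_comm]
  rfl

/-- The matrix element of `S^{tr}(z)` on the top vectors. -/
theorem coe_trEntry_top (hq : IsGeneric q) [NeZero n] (m l : ℕ) :
    ((trEntry q (Pi.single (0 : ZMod n) m) (Pi.single 0 l) (Pi.single 0 m) (Pi.single 0 l) :
        PowerSeries K) : 𝕃)
      = zVar K ^ l * qPoch (HahnSeries.C q ^ ((m : ℤ) - l + 2) * (zVar K)⁻¹) (HahnSeries.C q ^ 2) l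
        / qPoch (HahnSeries.C q ^ ((m : ℤ) - l) * zVar K) (HahnSeries.C q ^ 2) (l + 1) := by
  have hw : (HahnSeries.C q : 𝕃) ^ ((m : ℤ) - l) = HahnSeries.C (q ^ ((m : ℤ) - l)) :=
    (map_zpow₀ _ _ _).symm
  have hne : qPoch (HahnSeries.C q ^ ((m : ℤ) - l) * zVar K) (HahnSeries.C q ^ 2 : 𝕃) (l + 1) ≠ 0 := by
    rw [hw, ← map_pow]
    exact qPoch_zVar_ne_zero _ _ _
  rw [eq_div_iff hne, ← sum_antidiagonal_qPoch hq.laurent zVar_ne_zero, trEntry_top hq,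
    threeDR_diag hq, map_sum, Finset.sum_mul]
  refine Finset.sum_congr rfl fun p hp => ?_
  rw [Finset.HasAntidiagonal.mem_antidiagonal] at hp
  have hs := coe_qBinom_series hq (q ^ ((m : ℤ) - l) * (q ^ 2) ^ p.1) p.2
  -- The common denominator with `l + 1 = λ + (μ + 1)` factors splits into its first `λ` factors and
  -- the denominator of the series for `μ`; the former are the numerators expected by
  -- `sum_antidiagonal_qPoch`.
  rw [coe_smul_powerSeries, ← hs, ← hp, add_assoc p.1, qPoch_add]
  rw [hp]
  simp only [map_mul, map_pow, map_neg, map_one, map_zpow₀, map_qBinom]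
  rw [mul_right_comm (HahnSeries.C q ^ ((m : ℤ) - l)) _ (zVar K)]
  ring

end Normalization

/-! ### The blocks of the trace are quantum `R` matrices. -/

section IsQuantumR

variable {K : Type*} [Field K] {q : K} {n : ℕ} [NeZero n]

local notation "𝕃" => LaurentSeries K

theorem inclTensor_topKet {𝕜 : Type*} [Field 𝕜] (m l : ℕ) :
    inclTensor 𝕜 n m l (topKet 𝕜 n m ⊗ₜ topKet 𝕜 n l)
      = ket 𝕜 (Pi.single 0 m) ⊗ₜ ket 𝕜 (Pi.single 0 l) := by
  have h : ((n : ℕ) : ZMod n) = 0 := ZMod.natCast_self n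
  change ket 𝕜 (Pi.single (n : ZMod n) m) ⊗ₜ ket 𝕜 (Pi.single (n : ZMod n) l) = _
  rw [h]

theorem eq_zero_of_add_eq_single {a b : ZMod n → ℕ} {m l : ℕ}
    (h : a + b = Pi.single 0 m + Pi.single 0 l) (ha : ∑ u, a u = m) : a = Pi.single 0 m := by
  have h1 : ∀ u, u ≠ 0 → a u = 0 := fun u hu => by
    have := congrFun h u
    simp only [Pi.add_apply, Pi.single_eq_of_ne hu] at this
    omega
  rw [Finset.sum_eq_single 0 (fun u _ hu => h1 u hu) (fun h => absurd (Finset.mem_univ _) h)] at ha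
  funext u
  by_cases hu : u = 0
  · rw [hu, ha, Pi.single_eq_same]
  · rw [h1 u hu, Pi.single_eq_of_ne hu]

/-- Site-wise conservation confines all quanta to site `0`, and conservation of the two degrees
fixes how they are shared, so the top vector is an eigenvector. -/
theorem traceS_top (m l : ℕ) :
    traceS q n (ket 𝕃 (Pi.single 0 m) ⊗ₜ[𝕃] ket 𝕃 (Pi.single 0 l))
      = ((trEntry q (Pi.single (0 : ZMod n) m) (Pi.single 0 l) (Pi.single 0 m) (Pi.single 0 l) :
        PowerSeries K) : 𝕃) • (ket 𝕃 (Pi.single 0 m) ⊗ₜ[𝕃] ket 𝕃 (Pi.single 0 l)) := by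
  refine ext_coef fun a b => ?_
  rw [coef_traceS, map_smul, coef_tmul, smul_eq_mul]
  by_cases hab : a = Pi.single 0 m ∧ b = Pi.single 0 l
  · rw [hab.1, hab.2, Finsupp.single_eq_same, Finsupp.single_eq_same, mul_one, mul_one]
  · have h1 : trEntry q a b (Pi.single 0 m) (Pi.single 0 l) = 0 := by
      by_contra h0
      have h2 : a + b = Pi.single 0 m + Pi.single 0 l := by_contra fun h => h0 (trEntry_eq_zero q h)
      have h3 := not_or.1 fun h => h0 (trEntry_eq_zero_of_sum h)
      rw [not_not, not_not, Finset.sum_pi_single', Finset.sum_pi_single',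
        if_pos (Finset.mem_univ _), if_pos (Finset.mem_univ _)] at h3
      exact hab ⟨eq_zero_of_add_eq_single h2 h3.1,
        eq_zero_of_add_eq_single ((add_comm b a).trans (h2.trans (add_comm _ _))) h3.2⟩
    rw [h1, PowerSeries.coe_zero]
    rcases not_and_or.1 hab with h | h <;> simp [Finsupp.single_eq_of_ne h]

theorem traceSLevel_isQuantumR (hq : IsGeneric q) (hn : 2 ≤ n) {x y : 𝕃ˣ}
    (hxy : (x / y : 𝕃) = zVar K) (m l : ℕ) :
    IsQuantumR hq.laurent hn x y m l (traceSLevel q n m l) where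
  intertwines := traceSLevel_intertwines hq hn hxy m l
  normalized := by
    refine inclTensor_injective m l ?_
    rw [inclTensor_traceSLevel, inclTensor_topKet, traceS_top, map_smul, inclTensor_topKet,
      coe_trEntry_top hq, hxy]

end IsQuantumR

/-! ### Uniqueness -/

/-! ### Reaching every label of a level from the top label by hops. -/

section Reachability

variable {n : ℕ} [NeZero n]

theorem eq_single_of_forall_ne {j : ZMod n → ℕ} (h : ∀ s, s ≠ 0 → j s = 0) :
    j = Pi.single 0 (∑ u, j u) := by
  rw [Finset.sum_eq_single 0 (fun u _ hu => h u hu) (fun h => absurd (Finset.mem_univ _) h)]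
  funext u
  by_cases hu : u = 0
  · rw [hu, Pi.single_eq_same]
  · rw [h u hu, Pi.single_eq_of_ne hu]

/-- A hop changes the weight of a label by `h s - h r`, stated additively to stay within the natural
numbers. With `h = 1` it says that the degree is preserved. -/
theorem sum_mul_hop (h : ZMod n → ℕ) {r s : ZMod n} {j : ZMod n → ℕ} (hj : j r ≠ 0) :
    ∑ u, h u * hop r s j u + h r = ∑ u, h u * j u + h s := by
  have e : ∀ u, hop r s j u + (Pi.single r 1 : ZMod n → ℕ) u
      = j u + (Pi.single s 1 : ZMod n → ℕ) u := by
    intro u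
    by_cases hu : u = r
    · subst hu
      simp only [Pi.add_apply, Pi.sub_apply, Pi.single_eq_same]
      omega
    · simp [Pi.single_eq_of_ne hu]
  have e1 (r : ZMod n) : h r = ∑ u, h u * (Pi.single r 1 : ZMod n → ℕ) u := by
    simp [Pi.single_apply]
  rw [e1 r, e1 s, ← Finset.sum_add_distrib, ← Finset.sum_add_distrib]
  refine Finset.sum_congr rfl fun u _ => ?_
  rw [← mul_add, ← mul_add, e]

theorem sum_hop {r s : ZMod n} {j : ZMod n → ℕ} (hj : j r ≠ 0) :
    ∑ u, hop r s j u = ∑ u, j u := by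
  have := sum_mul_hop (fun _ => 1) (s := s) hj
  simp only [one_mul] at this
  omega

/-- Every label is obtained from the top label by hops `σ s → s` with `s ≠ 0`. -/
theorem hop_induction {P : (ZMod n → ℕ) → Prop} {l : ℕ} (σ : ZMod n → ZMod n) (h : ZMod n → ℕ)
    (hσ : ∀ s, s ≠ 0 → h (σ s) < h s) (top : P (Pi.single 0 l))
    (step : ∀ s j, s ≠ 0 → ∑ u, j u = l → j (σ s) ≠ 0 → P j → P (hop (σ s) s j))
    (j : ZMod n → ℕ) (hj : ∑ u, j u = l) : P j := by
  -- If some site `s ≠ 0` is occupied, moving one quantum back to `σ s` strictly lowers the weight;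
  -- if none is, the label is the top one.
  induction hN : ∑ u, h u * j u using Nat.strong_induction_on generalizing j with
  | _ N ih =>
    by_cases hs : ∃ s, s ≠ 0 ∧ j s ≠ 0
    · obtain ⟨s, hs0, hjs⟩ := hs
      have hne : s ≠ σ s := fun h' => by have := hσ s hs0; rw [← h'] at this; omega
      have h1 := sum_mul_hop h (s := σ s) hjs
      have h2 := hσ s hs0
      have h3 : ∑ u, hop s (σ s) j u = l := (sum_hop hjs).trans hj
      rw [← hop_hop hne hjs]
      refine step s _ hs0 h3 ?_ (ih _ ?_ _ h3 rfl)
      · rw [hop_apply_right hne]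
        exact Nat.succ_ne_zero _
      · omega
    · push Not at hs
      rw [eq_single_of_forall_ne hs, hj]
      exact top

theorem val_sub_one_lt {s : ZMod n} (hs : s ≠ 0) : (s - 1).val < s.val := by
  have h1 : s.val ≠ 0 := (ZMod.val_ne_zero s).2 hs
  have h2 : s - 1 = ((s.val - 1 : ℕ) : ZMod n) := by
    rw [Nat.cast_sub (by omega), ZMod.natCast_zmod_val, Nat.cast_one]
  rw [h2, ZMod.val_natCast]
  exact (Nat.mod_le _ _).trans_lt (by omega)

end Reachability

/-! ### The `z`-adic filtration on tensors. -/

section Filtration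

variable {K : Type*} [Field K] {n : ℕ}

local notation "𝕃" => LaurentSeries K

/-- The Laurent series in `z^w K[[z]]`. -/
def powFil (K : Type*) [Field K] (w : ℤ) : AddSubgroup (LaurentSeries K) :=
  ((AddMonoidHom.mulLeft (zVar K ^ w)).comp
    (HahnSeries.ofPowerSeries ℤ K).toAddMonoidHom).range

theorem mem_powFil {w : ℤ} {s : 𝕃} :
    s ∈ powFil K w ↔ ∃ P : PowerSeries K, zVar K ^ w * (P : 𝕃) = s := Iff.rfl

theorem C_mul_mem_powFil (c : K) {w : ℤ} {s : 𝕃} (hs : s ∈ powFil K w) :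
    HahnSeries.C c * s ∈ powFil K w := by
  obtain ⟨P, rfl⟩ := mem_powFil.1 hs
  exact mem_powFil.2 ⟨PowerSeries.C c * P, by
    rw [PowerSeries.coe_mul, PowerSeries.coe_C, mul_left_comm]⟩

theorem zVar_mul_mem_powFil {w : ℤ} {s : 𝕃} (hs : s ∈ powFil K w) :
    zVar K * s ∈ powFil K (w + 1) := by
  obtain ⟨P, rfl⟩ := mem_powFil.1 hs
  exact mem_powFil.2 ⟨P, by rw [zpow_add_one₀ zVar_ne_zero]; ring⟩

theorem powFil_antitone : Antitone (powFil K) := by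
  intro w w' h s hs
  obtain ⟨P, rfl⟩ := mem_powFil.1 hs
  refine mem_powFil.2 ⟨PowerSeries.X ^ (w' - w).toNat * P, ?_⟩
  rw [PowerSeries.coe_mul, PowerSeries.coe_pow, PowerSeries.coe_X, ← mul_assoc]
  change zVar K ^ w * zVar K ^ _ * _ = _
  rw [← zpow_natCast, ← zpow_add₀ zVar_ne_zero, Int.toNat_of_nonneg (by omega),
    add_sub_cancel]

theorem zVar_zpow (w : ℤ) : zVar K ^ w = HahnSeries.single w 1 := (RatFunc.single_zpow w).symm

theorem exists_mem_powFil (s : 𝕃) : ∃ w, s ∈ powFil K w :=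
  ⟨s.order, mem_powFil.2 ⟨s.powerSeriesPart, by
    rw [zVar_zpow]; exact LaurentSeries.single_order_mul_powerSeriesPart s⟩⟩

theorem eq_zero_of_forall_mem_powFil {s : 𝕃} {w : ℤ} (h : ∀ w', w ≤ w' → s ∈ powFil K w') :
    s = 0 := by
  by_contra hs
  -- A nonzero series is not divisible by a power of `z` beyond its order.
  obtain ⟨P, hP⟩ := mem_powFil.1 (h (max w (s.order + 1)) (le_max_left _ _))
  refine HahnSeries.coeff_order_eq_zero.not.2 hs ?_
  have hlt : s.order - max w (s.order + 1) < 0 := by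
    have := le_max_right w (s.order + 1)
    omega
  generalize s.order = d at hP hlt ⊢
  rw [← hP, zVar_zpow, HahnSeries.coeff_single_mul, one_mul, PowerSeries.coeff_coe, if_pos hlt]

/-- The tensors all of whose coefficients lie in `z^w K[[z]]`. -/
def tensorFil (K : Type*) [Field K] (n : ℕ) (w : ℤ) :
    AddSubgroup (Fock (LaurentSeries K) n ⊗[LaurentSeries K] Fock (LaurentSeries K) n) :=
  ⨅ p : (ZMod n → ℕ) × (ZMod n → ℕ),
    (powFil K w).comap (coef (LaurentSeries K) p.1 p.2).toAddMonoidHom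

theorem mem_tensorFil {w : ℤ} {t : Fock 𝕃 n ⊗[𝕃] Fock 𝕃 n} :
    t ∈ tensorFil K n w ↔ ∀ a b, coef 𝕃 a b t ∈ powFil K w := by
  simp only [tensorFil, AddSubgroup.mem_iInf, Prod.forall]
  rfl

theorem C_smul_mem_tensorFil (c : K) {w : ℤ} {t : Fock 𝕃 n ⊗[𝕃] Fock 𝕃 n}
    (ht : t ∈ tensorFil K n w) : (HahnSeries.C c : 𝕃) • t ∈ tensorFil K n w :=
  mem_tensorFil.2 fun a b => by
    rw [map_smul]; exact C_mul_mem_powFil c (mem_tensorFil.1 ht a b)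

theorem mem_tensorFil_of_C_smul {c : K} (hc : c ≠ 0) {w : ℤ} {t : Fock 𝕃 n ⊗[𝕃] Fock 𝕃 n}
    (ht : (HahnSeries.C c : 𝕃) • t ∈ tensorFil K n w) : t ∈ tensorFil K n w := by
  have := C_smul_mem_tensorFil c⁻¹ ht
  rwa [smul_smul, ← map_mul, inv_mul_cancel₀ hc, map_one, one_smul] at this

theorem zVar_smul_mem_tensorFil {w : ℤ} {t : Fock 𝕃 n ⊗[𝕃] Fock 𝕃 n}
    (ht : t ∈ tensorFil K n w) : zVar K • t ∈ tensorFil K n (w + 1) :=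
  mem_tensorFil.2 fun a b => by
    rw [map_smul]; exact zVar_mul_mem_powFil (mem_tensorFil.1 ht a b)

theorem tensorFil_antitone : Antitone (tensorFil K n) :=
  fun _ _ h _ ht => mem_tensorFil.2 fun a b => powFil_antitone h (mem_tensorFil.1 ht a b)

/-- A tensor has finitely many nonzero coefficients, so their orders have a common lower bound. -/
theorem exists_mem_tensorFil (t : Fock 𝕃 n ⊗[𝕃] Fock 𝕃 n) : ∃ w, t ∈ tensorFil K n w := by
  suffices h : ∀ f : (ZMod n → ℕ) × (ZMod n → ℕ) →₀ 𝕃, ∃ w, ∀ p, f p ∈ powFil K w by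
    obtain ⟨w, hw⟩ := h (finsuppTensorFinsupp' 𝕃 (ZMod n → ℕ) (ZMod n → ℕ) t)
    exact ⟨w, mem_tensorFil.2 fun a b => hw (a, b)⟩
  intro f
  induction f using Finsupp.induction_linear with
  | zero => exact ⟨0, fun p => zero_mem _⟩
  | add f g hf hg =>
    obtain ⟨w, hw⟩ := hf
    obtain ⟨w', hw'⟩ := hg
    exact ⟨min w w', fun p => add_mem (powFil_antitone (min_le_left _ _) (hw p))
      (powFil_antitone (min_le_right _ _) (hw' p))⟩
  | single p s =>
    obtain ⟨w, hw⟩ := exists_mem_powFil s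
    refine ⟨w, fun p' => ?_⟩
    by_cases h : p' = p
    · rw [h, Finsupp.single_eq_same]; exact hw
    · rw [Finsupp.single_eq_of_ne h]; exact zero_mem _

theorem eq_zero_of_forall_mem_tensorFil {t : Fock 𝕃 n ⊗[𝕃] Fock 𝕃 n} {w : ℤ}
    (h : ∀ w', w ≤ w' → t ∈ tensorFil K n w') : t = 0 :=
  ext_coef fun a b => by
    rw [map_zero]
    exact eq_zero_of_forall_mem_powFil fun w' hw' => mem_tensorFil.1 (h w' hw') a b

/-- Operators which act on coefficients by a shift and a scalar from `K`. -/
def IsConstShift (A : Module.End 𝕃 (Fock 𝕃 n)) : Prop :=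
  ∀ a, ∃ (a' : ZMod n → ℕ) (c : K), ∀ v : Fock 𝕃 n, A v a = HahnSeries.C c * v a'

theorem isConstShift_id : IsConstShift (LinearMap.id : Module.End 𝕃 (Fock 𝕃 n)) :=
  fun a => ⟨a, 1, fun v => by rw [map_one, one_mul, LinearMap.id_apply]⟩

/-- The generators stripped of their spectral parameters have entries in `K`, so they do not lower
the `z`-adic order. -/
theorem IsConstShift.map_mem {A B : Module.End 𝕃 (Fock 𝕃 n)} (hA : IsConstShift A)
    (hB : IsConstShift B) {w : ℤ} {t : Fock 𝕃 n ⊗[𝕃] Fock 𝕃 n} (ht : t ∈ tensorFil K n w) :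
    TensorProduct.map A B t ∈ tensorFil K n w := by
  refine mem_tensorFil.2 fun a b => ?_
  obtain ⟨a', c, hc⟩ := hA a
  obtain ⟨b', d, hd⟩ := hB b
  rw [coef_map hc hd, ← map_mul]
  exact C_mul_mem_powFil _ (mem_tensorFil.1 ht a' b')

theorem isConstShift_hopShift (q : K) {r s : ZMod n} (h : r ≠ s) :
    IsConstShift (wShift (fun m => qInt (HahnSeries.C q : 𝕃) (m r)) (hop r s)) := fun a =>
  ⟨hop s r a, if a s = 0 then 0 else qInt q ((a r + 1 : ℕ) : ℤ), fun v => by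
    have := hopShift_apply (q := (HahnSeries.C q : 𝕃)) h 1 v a
    simp only [one_mul] at this
    rw [this, apply_ite HahnSeries.C, map_zero, coe_qInt]⟩

theorem isConstShift_opK (q : K) (r : ZMod n) :
    IsConstShift (opK (HahnSeries.C q : 𝕃) r) := fun a =>
  ⟨a, q ^ (-(a r : ℤ) + (a (r + 1) : ℤ)), fun v => by
    rw [opK_eq_wShift, diag_apply, map_zpow₀]⟩

theorem isConstShift_opKinv (q : K) (r : ZMod n) :
    IsConstShift (opKinv (HahnSeries.C q : 𝕃) r) := fun a =>
  ⟨a, q ^ (-(-(a r : ℤ) + (a (r + 1) : ℤ))), fun v => by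
    rw [opKinv_eq_wShift, diag_apply, map_zpow₀]⟩

end Filtration

/-! ### Generators with the spectral parameter factored out. -/

section HopOperators

variable {𝕜 : Type*} [Field 𝕜] {n : ℕ}

/-- The operator `|m⟩ ↦ [m_r] |m - e_r + e_s⟩`. -/
def opHop (q : 𝕜) (r s : ZMod n) : Module.End 𝕜 (Fock 𝕜 n) :=
  wShift (fun m => qInt q (m r)) (hop r s)

theorem opHop_ket (q : 𝕜) (r s : ZMod n) (m : ZMod n → ℕ) :
    opHop q r s (ket 𝕜 m) = qInt q (m r) • ket 𝕜 (hop r s m) := wShift_ket _ _ _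

theorem opE_eq_smul (q : 𝕜) (x : 𝕜ˣ) (r : ZMod n) :
    opE q x r = (if r = 0 then (x : 𝕜) else 1) • opHop q r (r + 1) := by
  refine Finsupp.lhom_ext fun m c => ?_
  rw [opE_eq_wShift, opHop, LinearMap.smul_apply, wShift_single, wShift_single,
    Finsupp.smul_single, smul_eq_mul, mul_left_comm]

theorem opF_eq_opHop (q : 𝕜) (x : 𝕜ˣ) {r : ZMod n} (hr : r ≠ 0) :
    opF q x r = opHop q (r + 1) r := by
  rw [opF_eq_wShift, opHop]
  simp only [if_neg hr, one_mul]

end HopOperators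

/-! ### Vanishing of null intertwiners and uniqueness of the quantum `R` matrix. -/

section Uniqueness

variable {K : Type*} [Field K] {q : K} {n : ℕ} [NeZero n]

local notation "𝕃" => LaurentSeries K

theorem qInt_natCast_ne_zero (hq : IsGeneric q) {m : ℕ} (hm : m ≠ 0) : qInt q m ≠ 0 := by
  rw [qInt_natCast hq, ← pow_mul]
  obtain ⟨k, hk⟩ : ∃ k, 2 * m = k + 1 := ⟨2 * m - 1, by omega⟩
  refine mul_ne_zero (div_ne_zero (neg_ne_zero.2 hq.1) hq.sq_sub_one_ne)
    (mul_ne_zero (inv_ne_zero (pow_ne_zero _ hq.1)) ?_)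
  rw [hk]
  exact hq.one_sub_ne k

/-- An operator on `V_x ⊗ V_y` which intertwines `Δ` and `Δ'` on the generators `e_r`, and `f_r`
with `r ≠ 0`, lives on the component `V_{x,m} ⊗ V_{y,l}` and annihilates its top vector. -/
structure IsNullIntertwiner (q : K) (n : ℕ) [NeZero n] (m l : ℕ)
    (T : Module.End 𝕃 (Fock 𝕃 n ⊗[𝕃] Fock 𝕃 n)) : Prop where
  comm_e : ∀ (r : ZMod n) t,
    (if r = 0 then zVar K else 1) • TensorProduct.map (opHop (HahnSeries.C q) r (r + 1))
        LinearMap.id (T t)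
      + TensorProduct.map (opK (HahnSeries.C q) r) (opHop (HahnSeries.C q) r (r + 1)) (T t)
    = T (TensorProduct.map LinearMap.id (opHop (HahnSeries.C q) r (r + 1)) t)
      + (if r = 0 then zVar K else 1) • T (TensorProduct.map
        (opHop (HahnSeries.C q) r (r + 1)) (opK (HahnSeries.C q) r) t)
  comm_f : ∀ (r : ZMod n), r ≠ 0 → ∀ t,
    TensorProduct.map LinearMap.id (opHop (HahnSeries.C q) (r + 1) r) (T t)
      + TensorProduct.map (opHop (HahnSeries.C q) (r + 1) r) (opKinv (HahnSeries.C q) r) (T t)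
    = T (TensorProduct.map (opHop (HahnSeries.C q) (r + 1) r) LinearMap.id t)
      + T (TensorProduct.map (opKinv (HahnSeries.C q) r) (opHop (HahnSeries.C q) (r + 1) r) t)
  level : ∀ i j, ∑ u, i u ≠ m ∨ ∑ u, j u ≠ l → T (ket 𝕃 i ⊗ₜ[𝕃] ket 𝕃 j) = 0
  top : T (ket 𝕃 (Pi.single 0 m) ⊗ₜ[𝕃] ket 𝕃 (Pi.single 0 l)) = 0

namespace IsNullIntertwiner

variable {m l : ℕ}

/-- With the first factor at the top, the relation for `e_r` expresses `T` after a hop `r → r + 1`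
in the second factor through `T` before it, plus a term containing `e_r` on the first factor. That
term is zero for `r ≠ 0`, where the top vector is empty, and carries a factor `z` for `r = 0`. This
is where one power of `z` is gained. -/
theorem top_left_mem {T : Module.End 𝕃 (Fock 𝕃 n ⊗[𝕃] Fock 𝕃 n)}
    (h : IsNullIntertwiner q n m l T) (hq : IsGeneric q) (hn : 2 ≤ n) {w : ℤ}
    (hw : ∀ i j, T (ket 𝕃 i ⊗ₜ[𝕃] ket 𝕃 j) ∈ tensorFil K n w) (j : ZMod n → ℕ) :
    T (ket 𝕃 (Pi.single 0 m) ⊗ₜ[𝕃] ket 𝕃 j) ∈ tensorFil K n (w + 1) := by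
  by_cases hj : ∑ u, j u = l
  · refine hop_induction (P := fun j => T (ket 𝕃 (Pi.single 0 m) ⊗ₜ[𝕃] ket 𝕃 j)
      ∈ tensorFil K n (w + 1)) (· - 1) ZMod.val (fun s hs => val_sub_one_lt hs)
      (by rw [h.top]; exact zero_mem _) (fun s j hs _ hjr hP => ?_) j hj
    obtain ⟨r, rfl⟩ : ∃ r, s = r + 1 := ⟨s - 1, by ring⟩
    simp only [add_sub_cancel_right] at hjr ⊢
    have hr := ne_add_one hn r
    have hc := h.comm_e r (ket 𝕃 (Pi.single 0 m) ⊗ₜ[𝕃] ket 𝕃 j)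
    rw [TensorProduct.map_tmul, TensorProduct.map_tmul, LinearMap.id_apply, opHop_ket, opHop_ket,
      opK_eq_wShift, wShift_ket, TensorProduct.tmul_smul, map_smul, ← opK_eq_wShift, id,
      TensorProduct.tmul_smul, ← TensorProduct.smul_tmul', map_smul, map_smul,
      ← coe_qInt, ← coe_qInt, ← map_zpow₀] at hc
    refine mem_tensorFil_of_C_smul (qInt_natCast_ne_zero hq hjr) ?_
    refine Eq.mpr (congrArg (· ∈ tensorFil K n (w + 1)) (eq_sub_of_add_eq hc.symm)) ?_
    refine sub_mem (add_mem ?_ ?_) ?_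
    · have := (isConstShift_hopShift q hr).map_mem isConstShift_id hP
      split_ifs
      · exact tensorFil_antitone (by omega) (zVar_smul_mem_tensorFil this)
      · rwa [one_smul]
    · exact (isConstShift_opK q r).map_mem (isConstShift_hopShift q hr) hP
    -- The only place where the weaker hypothesis `hw` is used, compensated by the explicit factor
    -- `z`.
    · split_ifs with h0
      · exact zVar_smul_mem_tensorFil (C_smul_mem_tensorFil _ (C_smul_mem_tensorFil _ (hw _ _)))
      · rw [Pi.single_eq_of_ne h0, Nat.cast_zero, qInt_zero, map_zero, zero_smul, smul_zero,
          smul_zero]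
        exact zero_mem _
  · rw [h.level _ _ (Or.inr hj)]
    exact zero_mem _

/-- The relations for `f_s` with `s ≠ 0` contain no spectral parameter. They carry the gain of
`top_left_mem` from the top label to every label of the first factor, with hops `s + 1 → s`. -/
theorem mem_succ {T : Module.End 𝕃 (Fock 𝕃 n ⊗[𝕃] Fock 𝕃 n)}
    (h : IsNullIntertwiner q n m l T) (hq : IsGeneric q) (hn : 2 ≤ n) {w : ℤ}
    (hw : ∀ i j, T (ket 𝕃 i ⊗ₜ[𝕃] ket 𝕃 j) ∈ tensorFil K n w) (i j : ZMod n → ℕ) :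
    T (ket 𝕃 i ⊗ₜ[𝕃] ket 𝕃 j) ∈ tensorFil K n (w + 1) := by
  by_cases hi : ∑ u, i u = m
  -- The induction keeps `j` arbitrary because the correction term also changes the second label.
  -- Hops now go downwards from `0 = n`, so the weight of a site is its distance `-s`.
  · refine hop_induction (P := fun i => ∀ j, T (ket 𝕃 i ⊗ₜ[𝕃] ket 𝕃 j)
      ∈ tensorFil K n (w + 1)) (· + 1) (fun s => (-s).val) (fun s hs => ?_)
      (h.top_left_mem hq hn hw) (fun s i hs _ hir hP j => ?_) i hi j
    · rw [neg_add, ← sub_eq_add_neg]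
      exact val_sub_one_lt (neg_ne_zero.2 hs)
    have hr := (ne_add_one hn s).symm
    have hc := h.comm_f s hs (ket 𝕃 i ⊗ₜ[𝕃] ket 𝕃 j)
    rw [TensorProduct.map_tmul, TensorProduct.map_tmul, LinearMap.id_apply, opHop_ket, opHop_ket,
      opKinv_eq_wShift, wShift_ket, TensorProduct.tmul_smul, map_smul, ← opKinv_eq_wShift, id,
      ← TensorProduct.smul_tmul', ← TensorProduct.smul_tmul', map_smul, map_smul,
      ← coe_qInt, ← coe_qInt, ← map_zpow₀] at hc
    refine mem_tensorFil_of_C_smul (qInt_natCast_ne_zero hq hir) ?_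
    refine Eq.mpr (congrArg (· ∈ tensorFil K n (w + 1)) (eq_sub_of_add_eq hc.symm)) ?_
    refine sub_mem (add_mem ?_ ?_) ?_
    · exact isConstShift_id.map_mem (isConstShift_hopShift q hr) (hP _)
    · exact (isConstShift_hopShift q hr).map_mem (isConstShift_opKinv q s) (hP _)
    · exact C_smul_mem_tensorFil _ (C_smul_mem_tensorFil _ (hP _))
  · rw [h.level _ _ (Or.inl hi)]
    exact zero_mem _

theorem finite_sum_eq (m : ℕ) : {i : ZMod n → ℕ | ∑ u, i u = m}.Finite :=
  (Set.finite_Icc 0 fun _ => m).subset fun _ hi => Set.mem_Icc.2 ⟨fun _ => Nat.zero_le _,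
    fun u => (Finset.single_le_sum (fun _ _ => Nat.zero_le _) (Finset.mem_univ u)).trans_eq hi⟩

/-- A level contains finitely many labels, and `T` vanishes on the others; this starts the iteration
in `eq_zero`. -/
theorem exists_forall_mem {T : Module.End 𝕃 (Fock 𝕃 n ⊗[𝕃] Fock 𝕃 n)}
    (h : IsNullIntertwiner q n m l T) :
    ∃ w, ∀ i j, T (ket 𝕃 i ⊗ₜ[𝕃] ket 𝕃 j) ∈ tensorFil K n w := by
  choose w hw using fun p : (ZMod n → ℕ) × (ZMod n → ℕ) =>
    exists_mem_tensorFil (T (ket 𝕃 p.1 ⊗ₜ[𝕃] ket 𝕃 p.2))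
  obtain ⟨w₀, hw₀⟩ := (((finite_sum_eq (n := n) m).prod (finite_sum_eq l)).image w).bddBelow
  refine ⟨w₀, fun i j => ?_⟩
  by_cases hij : ∑ u, i u ≠ m ∨ ∑ u, j u ≠ l
  · rw [h.level i j hij]
    exact zero_mem _
  · push Not at hij
    exact tensorFil_antitone (hw₀ ⟨(i, j), hij, rfl⟩) (hw (i, j))

theorem eq_zero {T : Module.End 𝕃 (Fock 𝕃 n ⊗[𝕃] Fock 𝕃 n)}
    (h : IsNullIntertwiner q n m l T) (hq : IsGeneric q) (hn : 2 ≤ n) : T = 0 := by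
  obtain ⟨w, hw⟩ := h.exists_forall_mem
  refine ext_ket (𝕜 := 𝕃) (M := Fock 𝕃 n ⊗[𝕃] Fock 𝕃 n) fun i j => ?_
  refine eq_zero_of_forall_mem_tensorFil (w := w) fun w' hw' => ?_
  induction w', hw' using Int.leInduction generalizing i j with
  | base => exact hw i j
  | succ w' _ ih => exact h.mem_succ hq hn ih i j

end IsNullIntertwiner

theorem projLevel_of_mem {𝕜 : Type*} [Field 𝕜] {l : ℕ} {v : Fock 𝕜 n} (hv : v ∈ level 𝕜 n l) :
    projLevel 𝕜 n l v = ⟨v, hv⟩ :=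
  LinearMap.congr_fun (projLevel_subtype l) ⟨v, hv⟩

theorem projLevel_of_mem_ne {𝕜 : Type*} [Field 𝕜] {l l' : ℕ} (h : l' ≠ l) {v : Fock 𝕜 n}
    (hv : v ∈ level 𝕜 n l') : projLevel 𝕜 n l v = 0 := by
  refine Subtype.ext (Finsupp.ext fun a => ?_)
  rw [projLevel_apply]
  change _ = (0 : 𝕜)
  by_cases ha : ∑ u, a u = l
  · rw [Finsupp.notMem_support_iff.1 fun h' => h
      (((Finsupp.mem_supported 𝕜 v).1 hv h').symm.trans ha), mul_zero]
  · rw [if_neg ha, zero_mul]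

theorem projLevel_rep {𝕜 : Type*} [Field 𝕜] {q : 𝕜} (hq : IsGeneric q) (hn : 2 ≤ n) (x : 𝕜ˣ)
    (l : ℕ) (g : Uq q n) :
    projLevel 𝕜 n l ∘ₗ rep hq hn x g = repLevel hq hn x l g ∘ₗ projLevel 𝕜 n l := by
  refine Finsupp.lhom_ext' fun i => LinearMap.ext_ring ?_
  simp only [LinearMap.comp_apply, Finsupp.lsingle_apply]
  have hi : ket 𝕜 i ∈ level 𝕜 n (∑ u, i u) := ket_mem_level rfl
  by_cases h : ∑ u, i u = l
  · rw [h] at hi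
    rw [projLevel_of_mem hi, projLevel_of_mem (rep_mem_level hq hn x l g _ hi)]
    rfl
  · rw [projLevel_of_mem_ne h hi, projLevel_of_mem_ne h (rep_mem_level hq hn x _ g _ hi), map_zero]

theorem projTensor_repTensorFock {𝕜 : Type*} [Field 𝕜] {q : 𝕜} (hq : IsGeneric q) (hn : 2 ≤ n)
    (x y : 𝕜ˣ) (m l : ℕ) (S : Uq q n ⊗[𝕜] Uq q n) (t : Fock 𝕜 n ⊗[𝕜] Fock 𝕜 n) :
    projTensor 𝕜 n m l (repTensorFock hq hn x y S t)
      = repTensor hq hn x y m l S (projTensor 𝕜 n m l t) := by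
  induction S with
  | zero => simp
  | add S S' h h' =>
    rw [map_add, map_add, LinearMap.add_apply, LinearMap.add_apply, map_add, h, h']
  | tmul g g' =>
    induction t with
    | zero => simp
    | add t t' h h' => rw [map_add, map_add, map_add, map_add, h, h']
    | tmul v w =>
      exact congrArg₂ (fun a b => a ⊗ₜ[𝕜] b) (LinearMap.congr_fun (projLevel_rep hq hn x m g) v)
        (LinearMap.congr_fun (projLevel_rep hq hn y l g') w)

/-- The units `x` and `y` may have any order in `z`, which would spoil the filtration. Dividing the
relation for `e_0` by `y` leaves only `z = x / y`, and the `f_r` with `r ≠ 0` contain neither. -/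
theorem isNullIntertwiner_of_intertwines (hq : IsGeneric q) (hn : 2 ≤ n) {x y : 𝕃ˣ}
    (hxy : (x / y : 𝕃) = zVar K) {m l : ℕ}
    {D : Module.End 𝕃 (level 𝕃 n m ⊗[𝕃] level 𝕃 n l)}
    (hD : ∀ g, repTensor hq.laurent hn x y m l (Uq.comulOp hq.laurent n g) * D
      = D * repTensor hq.laurent hn x y m l (Uq.comul hq.laurent n g))
    (htop : D (topKet 𝕃 n m ⊗ₜ topKet 𝕃 n l) = 0) :
    IsNullIntertwiner q n m l (inclTensor 𝕃 n m l ∘ₗ D ∘ₗ projTensor 𝕃 n m l) := by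
  have hT (g : Uq (HahnSeries.C q : 𝕃) n) (t : Fock 𝕃 n ⊗[𝕃] Fock 𝕃 n) :
      repTensorFock hq.laurent hn x y (Uq.comulOp hq.laurent n g)
        ((inclTensor 𝕃 n m l ∘ₗ D ∘ₗ projTensor 𝕃 n m l) t)
      = (inclTensor 𝕃 n m l ∘ₗ D ∘ₗ projTensor 𝕃 n m l)
        (repTensorFock hq.laurent hn x y (Uq.comul hq.laurent n g) t) := by
    have := LinearMap.congr_fun (hD g) (projTensor 𝕃 n m l t)
    rw [Module.End.mul_apply, Module.End.mul_apply] at this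
    rw [LinearMap.comp_apply, LinearMap.comp_apply, LinearMap.comp_apply, LinearMap.comp_apply,
      projTensor_repTensorFock, ← this, inclTensor_repTensor]
  have hx (r : ZMod n) : (if r = 0 then (x : 𝕃) else 1)
      = (if r = 0 then (y : 𝕃) else 1) * if r = 0 then zVar K else 1 := by
    split_ifs
    · rw [← hxy, mul_div_cancel₀ _ y.ne_zero]
    · rw [one_mul]
  refine ⟨fun r t => ?_, fun r hr t => ?_, fun i j hij => ?_, ?_⟩
  · have h := hT (Uq.e _ r) t
    rw [Uq.comulOp_apply, Uq.comul_e, map_add, map_add, map_add, Algebra.TensorProduct.comm_tmul,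
      Algebra.TensorProduct.comm_tmul] at h
    simp only [repTensorFock_tmul, map_one, rep_e, rep_k, opE_eq_smul, hx,
      TensorProduct.map_smul_left, TensorProduct.map_smul_right, LinearMap.add_apply,
      LinearMap.smul_apply, map_add, map_smul, mul_smul, ← smul_add] at h
    have hy : (if r = 0 then (y : 𝕃) else 1) ≠ 0 := by
      split_ifs
      · exact y.ne_zero
      · exact one_ne_zero
    exact smul_right_injective _ hy h
  · have h := hT (Uq.f _ r) t
    rw [Uq.comulOp_apply, Uq.comul_f, map_add, map_add, map_add, Algebra.TensorProduct.comm_tmul,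
      Algebra.TensorProduct.comm_tmul] at h
    simp only [repTensorFock_tmul, map_one, rep_f, rep_kinv, opF_eq_opHop _ _ hr,
      LinearMap.add_apply, map_add] at h
    exact h
  · have hi : ket 𝕃 i ∈ level 𝕃 n (∑ u, i u) := ket_mem_level rfl
    have hj : ket 𝕃 j ∈ level 𝕃 n (∑ u, j u) := ket_mem_level rfl
    have h0 : projTensor 𝕃 n m l (ket 𝕃 i ⊗ₜ[𝕃] ket 𝕃 j) = 0 := by
      rw [projTensor, TensorProduct.map_tmul]
      rcases hij with h | h
      · rw [projLevel_of_mem_ne h hi, TensorProduct.zero_tmul]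
      · rw [projLevel_of_mem_ne h hj, TensorProduct.tmul_zero]
    rw [LinearMap.comp_apply, LinearMap.comp_apply, h0, map_zero, map_zero]
  · rw [← inclTensor_topKet, LinearMap.comp_apply, LinearMap.comp_apply, projTensor_inclTensor,
      htop, map_zero]

theorem IsQuantumR.unique (hq : IsGeneric q) (hn : 2 ≤ n) {x y : 𝕃ˣ}
    (hxy : (x / y : 𝕃) = zVar K) {m l : ℕ}
    {R R' : Module.End 𝕃 (level 𝕃 n m ⊗[𝕃] level 𝕃 n l)}
    (hR : IsQuantumR hq.laurent hn x y m l R) (hR' : IsQuantumR hq.laurent hn x y m l R') :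
    R = R' := by
  -- Both operators have the same eigenvalue on the top vector, so their difference annihilates it.
  have h := (isNullIntertwiner_of_intertwines hq hn hxy (D := R + (-1 : 𝕃) • R')
    (fun g => by rw [mul_add, add_mul, mul_smul_comm, smul_mul_assoc, hR.intertwines,
      hR'.intertwines])
    (by rw [LinearMap.add_apply, LinearMap.smul_apply, hR.normalized, hR'.normalized, smul_smul,
      ← add_smul, neg_one_mul, add_neg_cancel, zero_smul])).eq_zero hq hn
  refine LinearMap.ext fun t => inclTensor_injective m l ?_
  have h1 := LinearMap.congr_fun h (inclTensor 𝕃 n m l t)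
  rw [LinearMap.comp_apply, LinearMap.comp_apply, projTensor_inclTensor, LinearMap.add_apply,
    LinearMap.smul_apply, map_add, map_smul, LinearMap.zero_apply] at h1
  exact add_neg_eq_zero.1 ((congrArg _ (neg_one_smul 𝕃 _).symm).trans h1)

end Uniqueness

end TraceReduction

end

theorem propositionB1 {K : Type*} [Field K] {q : K} (hq : TraceReduction.IsGeneric q)
    (n : ℕ) [NeZero n] (hn : 2 ≤ n) :
    ∃ R : ∀ m l : ℕ, Module.End (LaurentSeries K)
        (TensorProduct (LaurentSeries K)
          (TraceReduction.level (LaurentSeries K) n m)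
          (TraceReduction.level (LaurentSeries K) n l)),
      (∀ x y : (LaurentSeries K)ˣ, (x / y : LaurentSeries K) = TraceReduction.zVar K →
        ∀ m l : ℕ, ∀ R', TraceReduction.IsQuantumR hq.laurent hn x y m l R' ↔ R' = R m l) ∧
      TraceReduction.traceS q n = TraceReduction.directSumR R := by
  refine ⟨TraceReduction.traceSLevel q n, fun x y hxy m l R' => ⟨fun h => ?_, ?_⟩,
    TraceReduction.traceS_eq_directSumR⟩
  · exact h.unique hq hn hxy (TraceReduction.traceSLevel_isQuantumR hq hn hxy m l)
  · rintro rfl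
    exact TraceReduction.traceSLevel_isQuantumR hq hn hxy m l
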